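/- A signature $S$ consists of a finite set $D$ of directions with an involution $d\mapsto -d$ (possibly with fixed points), a finite set $\Sigma$ of node labels, a non-empty set $\Sigma_0\subseteq\Sigma$ of initial labels, and a set $D_a\subseteq D$ for each $a\in\Sigma$. $L(S)$ is the set of all graphs over $S$. Such a graph has a finite set $V$ of nodes, an initial node $v_0 \in V$, a labelling $\lambda\colon V\to\Sigma$ and a partial operation $+\colon V\times D\to V$. It is connected; $v+d$ is defined if and only if $d\in D_{\lambda(v)}$; if $v+d$ is defined, then $(v+d)+(-d)$ is defined and equals $v$; and $\lambda(v)\in\Sigma_0$ if and only if $v=v_0$. A (deterministic) graph-walking automaton over $S$ is $A=(Q,q_0,F,\delta)$, where $Q$ is a finite set of states, $q_0\in Q$, $F\subseteq Q\times\Sigma$, and $\delta$ is a partial function from $(Q\times\Sigma)\setminus F$ to $Q\times D$ with $\delta(q,a)\in Q\times D_a$ whenever $\delta(q,a)$ is defined. On a graph it starts in the configuration $(q_0,v_0)$ and moves from $(q,v)$ to $(q',v+d)$ if $\delta(q,\lambda(v))=(q',d)$; it accepts if it reaches some $(q,v)$ with $(q,\lambda(v))\in F$. $L(A)$ is the set of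 graphs over $S$ that $A$ accepts. A (node-replacement) homomorphism $h\colon L(S)\to L(S)$ is given by a non-empty finite connected subgraph $h(a)$ over $S$ for each $a\in\Sigma$, which has exactly one external edge in each direction $d\in D_a$ and no other external edges, and which contains an initial node (exactly one) if $a\in\Sigma_0$ and none otherwise. The graph $h(G)$ is obtained from $G$ by replacing each node $v$ with a copy of $h(\lambda(v))$; for each edge $v+d=u$ of $G$, the external edge in the direction $d$ of the copy replacing $v$ is joined with the external edge in the direction $-d$ of the copy replacing $u$. Theorem. For every $k\geqslant 9$ there are a signature $S$ with $k$ directions and a homomorphism $h\colon L(S)\to L(S)$ such that, for every $n\geqslant 4$, there exists a graph-walking automaton $A$ over $S$ with $n$ states such that every graph-walking automaton $B$ over $S$ with $L(B)=h^{-1}(L(A))$ (that is, $B$ accepts $G$ if and only if $A$ accepts $h(G)$, for all graphs $G$ over $S$) has at least $nk$ states. -/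

import Mathlib

namespace GraphWalking

/-- A signature: a finite set of directions with an involution `opp` (which may have fixed
points), a finite set of node labels, a nonempty set of initial labels, and for every label the
set of directions that are present at nodes with this label. -/
structure Signature where
  Dir : Type
  [finDir : Fintype Dir]
  opp : Dir → Dir
  opp_opp : ∀ d, opp (opp d) = d
  Label : Type
  [finLabel : Fintype Label]
  init : Set Label
  init_nonempty : init.Nonempty
  dirs : Label → Set Dir

attribute [instance] Signature.finDir Signature.finLabel

/-- A finite connected graph over a signature. `step v d` is the partial operation `v + d`. -/
structure Graph (S : Signature) where
  V : Type
  [finV : Fintype V]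
  v0 : V
  step : V → S.Dir → Option V
  label : V → S.Label
  step_opp : ∀ v d w, step v d = some w → step w (S.opp d) = some v
  step_isSome_iff : ∀ v d, (step v d).isSome ↔ d ∈ S.dirs (label v)
  label_init_iff : ∀ v, label v ∈ S.init ↔ v = v0
  connected : ∀ u v, Relation.ReflTransGen (fun x y => ∃ d, step x d = some y) u v

attribute [instance] Graph.finV

/-- A deterministic graph-walking automaton: finitely many states, an initial state, acceptance
conditions, and a partial transition function that is undefined on acceptance conditions and
moves only in directions that are present at the current label. -/
structure Automaton (S : Signature) where
  Q : Type
  [finQ : Fintype Q]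
  q0 : Q
  F : Set (Q × S.Label)
  δ : Q → S.Label → Option (Q × S.Dir)
  δ_of_mem : ∀ q a, (q, a) ∈ F → δ q a = none
  δ_dir : ∀ q a q' d, δ q a = some (q', d) → d ∈ S.dirs a

attribute [instance] Automaton.finQ

namespace Automaton

variable {S : Signature}

/-- The number of states. -/
def numStates (A : Automaton S) : ℕ := Fintype.card A.Q

/-- One step of the computation of `A` on `G`, between configurations (state, node). -/
def Step (A : Automaton S) (G : Graph S) (c c' : A.Q × G.V) : Prop :=
  ∃ d, A.δ c.1 (G.label c.2) = some (c'.1, d) ∧ G.step c.2 d = some c'.2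

/-- `A` accepts `G`: the computation from the initial configuration reaches some `(q, v)` whose
state and label form an acceptance condition. -/
def Accepts (A : Automaton S) (G : Graph S) : Prop :=
  ∃ q v, Relation.ReflTransGen (A.Step G) (A.q0, G.v0) (q, v) ∧ (q, G.label v) ∈ A.F

/-- The set `L(A)` of all graphs accepted by `A`. -/
def language (A : Automaton S) : Set (Graph S) := {G | A.Accepts G}

end Automaton

/-- A nonempty connected subgraph over `S` with exactly one external edge in each direction
`d ∈ E`, attached to the node `port d`. The value of `port` outside `E` is irrelevant.
`step` describes the internal edges; the edges present at a node, internal or external, are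
exactly those prescribed by its label. -/
structure Fragment (S : Signature) (E : Set S.Dir) where
  V : Type
  [finV : Fintype V]
  [nonempty : Nonempty V]
  step : V → S.Dir → Option V
  label : V → S.Label
  port : S.Dir → V
  step_opp : ∀ v d w, step v d = some w → step w (S.opp d) = some v
  step_port : ∀ d ∈ E, step (port d) d = none
  dirs_iff : ∀ v d, d ∈ S.dirs (label v) ↔ ((step v d).isSome ∨ (d ∈ E ∧ port d = v))
  connected : ∀ u v, Relation.ReflTransGen (fun x y => ∃ d, step x d = some y) u v

attribute [instance] Fragment.finV Fragment.nonempty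

/-- The data of a node-replacement homomorphism `L(S) → L(S)`: for every label `a` a subgraph
`h(a)` with one external edge for each direction in `D_a`, containing an initial node (which is
then unique) if and only if `a` is initial. -/
structure Homomorphism (S : Signature) where
  frag : (a : S.Label) → Fragment S (S.dirs a)
  init_of_mem : ∀ a ∈ S.init, ∃! x, (frag a).label x ∈ S.init
  init_of_notMem : ∀ a ∉ S.init, ∀ x, (frag a).label x ∉ S.init

namespace Homomorphism

variable {S : Signature}

/-- The nodes of `h(G)`: pairs of a node `v` of `G` and a node of the copy `h(v)`. -/
abbrev Node (h : Homomorphism S) (G : Graph S) : Type :=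
  Σ v : G.V, (h.frag (G.label v)).V

open Classical in
/-- The edges of `h(G)`: the internal edges of all copies `h(v)`, and for every edge
`v + d = u` of `G`, an edge joining the external edge of `h(v)` in the direction `d`
with the external edge of `h(u)` in the direction `-d`. -/
noncomputable def step (h : Homomorphism S) (G : Graph S) (p : h.Node G) (d : S.Dir) :
    Option (h.Node G) :=
  match (h.frag (G.label p.1)).step p.2 d with
  | some y => some ⟨p.1, y⟩
  | none =>
    if (h.frag (G.label p.1)).port d = p.2 then
      (G.step p.1 d).map fun u => ⟨u, (h.frag (G.label u)).port (S.opp d)⟩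
    else none

theorem step_eq_some_iff (h : Homomorphism S) (G : Graph S) (p q : h.Node G) (d : S.Dir) :
    h.step G p d = some q ↔
      (∃ y, (h.frag (G.label p.1)).step p.2 d = some y ∧ (⟨p.1, y⟩ : h.Node G) = q) ∨
      ((h.frag (G.label p.1)).port d = p.2 ∧
        ∃ u, G.step p.1 d = some u ∧
          (⟨u, (h.frag (G.label u)).port (S.opp d)⟩ : h.Node G) = q) := by
  unfold step
  cases hs : (h.frag (G.label p.1)).step p.2 d with
  | some y =>
    simp only [Option.some.injEq]
    constructor
    · intro e; exact Or.inl ⟨y, rfl, e⟩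
    · rintro (⟨z, hz, e⟩ | ⟨hp, u, hu, e⟩)
      · subst hz; exact e
      · exfalso
        have hd : d ∈ S.dirs (G.label p.1) := by
          rw [← G.step_isSome_iff, hu]; rfl
        have := (h.frag (G.label p.1)).step_port d hd
        rw [hp, hs] at this
        cases this
  | none =>
    by_cases hp : (h.frag (G.label p.1)).port d = p.2
    · simp [hp]
    · simp [hp]

theorem step_opp (h : Homomorphism S) (G : Graph S) (p : h.Node G) (d : S.Dir) (q : h.Node G)
    (hq : h.step G p d = some q) : h.step G q (S.opp d) = some p := by
  rw [step_eq_some_iff] at hq ⊢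
  rcases p with ⟨v, x⟩
  rcases hq with ⟨y, hy, rfl⟩ | ⟨hp, u, hu, rfl⟩
  · exact Or.inl ⟨x, (h.frag _).step_opp _ _ _ hy, rfl⟩
  · refine Or.inr ⟨rfl, v, G.step_opp _ _ _ hu, ?_⟩
    rw [S.opp_opp]
    simp only at hp
    rw [hp]

theorem step_isSome_iff (h : Homomorphism S) (G : Graph S) (p : h.Node G) (d : S.Dir) :
    (h.step G p d).isSome ↔ d ∈ S.dirs ((h.frag (G.label p.1)).label p.2) := by
  rw [(h.frag (G.label p.1)).dirs_iff, Option.isSome_iff_exists, Option.isSome_iff_exists]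
  constructor
  · rintro ⟨q, hq⟩
    rw [step_eq_some_iff] at hq
    rcases hq with ⟨y, hy, -⟩ | ⟨hp, u, hu, -⟩
    · exact Or.inl ⟨y, hy⟩
    · refine Or.inr ⟨?_, hp⟩
      rw [← G.step_isSome_iff, hu]; rfl
  · rintro (⟨y, hy⟩ | ⟨hd, hp⟩)
    · exact ⟨_, (h.step_eq_some_iff G p _ d).2 (Or.inl ⟨y, hy, rfl⟩)⟩
    · rw [← G.step_isSome_iff, Option.isSome_iff_exists] at hd
      obtain ⟨u, hu⟩ := hd
      exact ⟨_, (h.step_eq_some_iff G p _ d).2 (Or.inr ⟨hp, u, hu, rfl⟩)⟩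

theorem connected_fiber (h : Homomorphism S) (G : Graph S) (v : G.V)
    (x y : (h.frag (G.label v)).V) :
    Relation.ReflTransGen (fun p q => ∃ d, h.step G p d = some q)
      (⟨v, x⟩ : h.Node G) ⟨v, y⟩ := by
  induction (h.frag (G.label v)).connected x y with
  | refl => exact .refl
  | @tail b c _ hbc ih =>
    obtain ⟨d, hd⟩ := hbc
    exact ih.tail ⟨d, (h.step_eq_some_iff G _ _ d).2 (Or.inl ⟨c, hd, rfl⟩)⟩

theorem connected (h : Homomorphism S) (G : Graph S) (p q : h.Node G) :
    Relation.ReflTransGen (fun p q => ∃ d, h.step G p d = some q) p q := by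
  rcases p with ⟨u, x⟩
  rcases q with ⟨v, y⟩
  have key : ∀ y : (h.frag (G.label v)).V,
      Relation.ReflTransGen (fun p q => ∃ d, h.step G p d = some q)
        (⟨u, x⟩ : h.Node G) ⟨v, y⟩ := by
    have huv := G.connected u v
    clear y
    induction huv with
    | refl => exact fun y => h.connected_fiber G u x y
    | @tail v w _ hvw ih =>
      intro y
      obtain ⟨d, hd⟩ := hvw
      refine ((ih ((h.frag (G.label v)).port d)).tail ⟨d, ?_⟩).trans
        (h.connected_fiber G w ((h.frag (G.label w)).port (S.opp d)) y)
      exact (h.step_eq_some_iff G _ _ d).2 (Or.inr ⟨rfl, w, hd, rfl⟩)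
  exact key y

/-- The initial node of `h(G)`: the unique initial node in the copy of `h(a)` that replaces the
initial node of `G`. -/
noncomputable def initNode (h : Homomorphism S) (G : Graph S) : h.Node G :=
  ⟨G.v0, (h.init_of_mem (G.label G.v0) ((G.label_init_iff G.v0).2 rfl)).choose⟩

theorem label_init_iff (h : Homomorphism S) (G : Graph S) (p : h.Node G) :
    (h.frag (G.label p.1)).label p.2 ∈ S.init ↔ p = h.initNode G := by
  have spec := (h.init_of_mem (G.label G.v0) ((G.label_init_iff G.v0).2 rfl)).choose_spec
  constructor
  · intro hp
    rcases p with ⟨v, x⟩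
    have hv : v = G.v0 := by
      rw [← G.label_init_iff]
      by_contra hn
      exact h.init_of_notMem _ hn _ hp
    subst hv
    have := spec.2 x hp
    rw [initNode, ← this]
  · rintro rfl
    exact spec.1

/-- The graph `h(G)`, obtained from `G` by replacing every node `v` with a copy of the
subgraph `h(a)`, where `a` is the label of `v`. -/
noncomputable def apply (h : Homomorphism S) (G : Graph S) : Graph S where
  V := h.Node G
  v0 := h.initNode G
  step := h.step G
  label p := (h.frag (G.label p.1)).label p.2
  step_opp := h.step_opp G
  step_isSome_iff := h.step_isSome_iff G
  label_init_iff := h.label_init_iff G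
  connected := h.connected G

end Homomorphism

end GraphWalking

/-!
The signature has two axes with the directions `a`, `-a`, `b`, `-b`, and `K = k - 4 ≥ 5`
directions that are their own opposites. The homomorphism replaces a node labelled `cell` by a
gadget in which an automaton `aut K n` with `n` states, entering through `-a` or `-b`, adds one to
its state modulo `n` and then continues along the axis on which it came, except that it changes
the axis when its state becomes zero. So on a large array of cells it walks in laps `aⁿbⁿ`: the
port through which it enters a cell supplies the bit that its state lacks to distinguish `2n`
phases. An automaton `B` that accepts the inverse image sees single nodes labelled `cell` instead,
and has to keep all this in its state.

In the arrays used here a cell has a base in `ZMod (2 * n)` and counters modulo a huge number `N`,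
which record the displacement, and the two ends of an array are `L` laps apart. An automaton can
get from one end to the other only in a periodic walk whose displacement over a period is a
multiple of a lap (`mem_cyclic_of_displacement`). As a lap has no rotational symmetry, a state
that occurs in such walks belongs to one base only (`Cyclic.unique`). Counting states, an
automaton with fewer than `nk = 4n + Kn` of them has a base at which it arrives in at most one
state, or a base `q < n` at which it never looks in some direction `l` (`few_states`). With this
base, and with the gate of the array placed in the direction `l`, one obtains a diode. The
automaton `aut K n` traverses it from its start to its finish (`DiodeIn.traverse`), while `B`,
coming back from the finish, does not reach the start at all, or passes the entrance in a fixed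
state (`Side.step`, `Closed.step`).

The diodes are built into test graphs. Such a graph has two arms with `n` diodes (teeth) each, and
the arms lead from the teeth to a common hub in two different directions. The initial node is at
one of the teeth. Behind the hub there are two exits, each of them protected by another diode, and
each of them marked as accepting or not. On the image of the graph, `aut K n` leaves an arm in a
state determined by the tooth, and the hub either keeps this state or replaces it by the arm;
accordingly, `aut K n` goes to different exits from any two given teeth, in the same direction or
in different ones (`exists_frame`). If `B` left two such teeth towards the hub in the same state,
then it could neither return to the initial node to find out where it started, nor carry the mark
of an exit back through the diode, so it could not accept the right graphs (`Confusion.absurd`).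
Hence the states in which `B` leaves the `n` teeth in the `k` directions are pairwise different,
and there are `nk` of them (`Blocked.card_le`).
-/

namespace GraphWalking

/-! ### Runs of partial maps -/

/-- `Run f t a b`: iterating the partial map `f` exactly `t` times leads from `a` to `b`. -/
def Run {α : Type*} (f : α → Option α) : ℕ → α → α → Prop
  | 0, a, b => a = b
  | t + 1, a, b => ∃ c, f a = some c ∧ Run f t c b

/-- The run of `f` from `a` visits the set `F`. -/
def Hits {α : Type*} (f : α → Option α) (F : Set α) (a : α) : Prop :=
  ∃ t b, Run f t a b ∧ b ∈ F

namespace Run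

variable {α β : Type*} {f g : α → Option α}

theorem add {s t : ℕ} {a b c : α} (h : Run f s a b) (h' : Run f t b c) : Run f (s + t) a c := by
  induction s generalizing a with
  | zero => cases h; simpa using h'
  | succ s ih =>
    obtain ⟨d, hd, h⟩ := h
    rw [Nat.add_right_comm]
    exact ⟨d, hd, ih h⟩

theorem unique {t : ℕ} {a b b' : α} (h : Run f t a b) (h' : Run f t a b') : b = b' := by
  induction t generalizing a with
  | zero => cases h; exact h'
  | succ t ih =>
    obtain ⟨d, hd, h⟩ := h
    obtain ⟨d', hd', h'⟩ := h'
    rw [hd] at hd'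
    cases hd'
    exact ih h h'

theorem split {s t : ℕ} {a c : α} (h : Run f (s + t) a c) :
    ∃ b, Run f s a b ∧ Run f t b c := by
  induction s generalizing a with
  | zero => exact ⟨a, rfl, by simpa using h⟩
  | succ s ih =>
    rw [Nat.add_right_comm] at h
    obtain ⟨d, hd, h⟩ := h
    obtain ⟨b, hb, h⟩ := ih h
    exact ⟨b, ⟨d, hd, hb⟩, h⟩

theorem cancel {s t : ℕ} {a b c : α} (h : Run f s a b) (h' : Run f (s + t) a c) :
    Run f t b c := by
  obtain ⟨b', hb, hc⟩ := split h'
  rwa [h.unique hb]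

theorem one {a b : α} (h : f a = some b) : Run f 1 a b := ⟨b, h, rfl⟩

/-- A run that starts in a set which the map leaves only through the point `r` stays in this set or
passes `r`. -/
theorem mem_or_exit {S : Set α} {r : α} (hS : ∀ a ∈ S, ∀ b, f a = some b → b ∈ S ∨ b = r)
    {t : ℕ} {a b : α} (ha : a ∈ S) (h : Run f t a b) :
    b ∈ S ∨ ∃ u, 0 < u ∧ u ≤ t ∧ Run f u a r := by
  induction t generalizing a with
  | zero => cases h; exact Or.inl ha
  | succ t ih =>
    obtain ⟨c, hc, h⟩ := h
    rcases hS a ha c hc with hcS | rfl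
    · rcases ih hcS h with hb | ⟨u, hu, hut, hur⟩
      · exact Or.inl hb
      · exact Or.inr ⟨u + 1, by omega, by omega, c, hc, hur⟩
    · exact Or.inr ⟨1, by omega, by omega, one hc⟩

theorem mem {S : Set α} (hS : ∀ a ∈ S, ∀ b, f a = some b → b ∈ S)
    {t : ℕ} {a b : α} (ha : a ∈ S) (h : Run f t a b) : b ∈ S := by
  induction t generalizing a with
  | zero => cases h; exact ha
  | succ t ih =>
    obtain ⟨c, hc, h⟩ := h
    exact ih (hS a ha c hc) h

theorem congr {S : Set α} (hfg : ∀ a ∈ S, f a = g a) {a : α}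
    (hS : ∀ t b, Run f t a b → b ∈ S) {t : ℕ} {b : α} (h : Run f t a b) : Run g t a b := by
  induction t generalizing a with
  | zero => exact h
  | succ t ih =>
    obtain ⟨c, hc, h⟩ := h
    exact ⟨c, (hfg a (hS 0 a rfl)) ▸ hc, ih (fun u d hd => hS (u + 1) d ⟨c, hc, hd⟩) h⟩

theorem congr_symm {S : Set α} (hfg : ∀ a ∈ S, f a = g a) {a : α}
    (hS : ∀ t b, Run f t a b → b ∈ S) {t : ℕ} {b : α} (h : Run g t a b) : Run f t a b := by
  induction t generalizing a with
  | zero => exact h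
  | succ t ih =>
    obtain ⟨c, hc, h⟩ := h
    rw [← hfg a (hS 0 a rfl)] at hc
    exact ⟨c, hc, ih (fun u d hd => hS (u + 1) d ⟨c, hc, hd⟩) h⟩

theorem map {g : β → Option β} {φ : α → β} (hφ : ∀ a b, f a = some b → g (φ a) = some (φ b))
    {t : ℕ} {a b : α} (h : Run f t a b) : Run g t (φ a) (φ b) := by
  induction t generalizing a with
  | zero => cases h; rfl
  | succ t ih =>
    obtain ⟨c, hc, h⟩ := h
    exact ⟨φ c, hφ _ _ hc, ih h⟩

theorem comap {g : β → Option β} {φ : α → β}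
    (hφ : ∀ a y, g (φ a) = some y → ∃ b, f a = some b ∧ φ b = y)
    {t : ℕ} {a : α} {y : β} (h : Run g t (φ a) y) : ∃ b, Run f t a b ∧ φ b = y := by
  induction t generalizing a with
  | zero => exact ⟨a, rfl, h⟩
  | succ t ih =>
    obtain ⟨c, hc, h⟩ := h
    obtain ⟨b, hb, rfl⟩ := hφ a c hc
    obtain ⟨b', hb', rfl⟩ := ih h
    exact ⟨b', ⟨b, hb, hb'⟩, rfl⟩

end Run

namespace Hits

variable {α : Type*} {f g : α → Option α} {F F' : Set α}

theorem of_run {t : ℕ} {a b : α} (h : Run f t a b) : Hits f F b → Hits f F a := by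
  rintro ⟨u, c, hc, hF⟩
  exact ⟨t + u, c, h.add hc, hF⟩

/-- If `f` is undefined on `F`, then a visit to `F` happens after every other configuration of
the run. -/
theorem le_of_run (hF : ∀ a ∈ F, f a = none) {t u : ℕ} {a b c : α} (hb : Run f t a b)
    (hc : Run f u a c) (hcF : c ∈ F) : t ≤ u := by
  by_contra hlt
  obtain ⟨k, rfl⟩ : ∃ k, t = u + (k + 1) := ⟨t - u - 1, by omega⟩
  obtain ⟨d, hd, -⟩ := hc.cancel hb
  rw [hF c hcF] at hd
  cases hd

/-- A run passing through `b` visits the halting configurations `F` if and only if it does so after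
`b`. -/
theorem run_iff (hF : ∀ a ∈ F, f a = none) {t : ℕ} {a b : α} (h : Run f t a b) :
    Hits f F a ↔ Hits f F b := by
  refine ⟨?_, of_run h⟩
  rintro ⟨u, c, hc, hcF⟩
  obtain ⟨k, rfl⟩ := Nat.exists_eq_add_of_le (le_of_run hF h hc hcF)
  exact ⟨k, c, h.cancel hc, hcF⟩

theorem congr {S : Set α} (hfg : ∀ a ∈ S, f a = g a) (hFF : ∀ a ∈ S, a ∈ F ↔ a ∈ F')
    {a : α} (hS : ∀ t b, Run f t a b → b ∈ S) : Hits f F a ↔ Hits g F' a := by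
  constructor
  · rintro ⟨t, b, hb, hbF⟩
    exact ⟨t, b, hb.congr hfg hS, (hFF b (hS t b hb)).1 hbF⟩
  · rintro ⟨t, b, hb, hbF⟩
    have hb' := hb.congr_symm hfg hS
    exact ⟨t, b, hb', (hFF b (hS t b hb')).2 hbF⟩

theorem map_iff {β : Type*} {g : β → Option β} {F' : Set β} {φ : α → β}
    (h₁ : ∀ a b, f a = some b → g (φ a) = some (φ b))
    (h₂ : ∀ a y, g (φ a) = some y → ∃ b, f a = some b ∧ φ b = y)
    (hF : ∀ a, φ a ∈ F' ↔ a ∈ F) (a : α) : Hits g F' (φ a) ↔ Hits f F a := by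
  constructor
  · rintro ⟨t, y, hy, hyF⟩
    obtain ⟨b, hb, rfl⟩ := hy.comap h₂
    exact ⟨t, b, hb, (hF b).1 hyF⟩
  · rintro ⟨t, b, hb, hbF⟩
    exact ⟨t, _, hb.map h₁, (hF b).2 hbF⟩

/-- A run that returns to a configuration never visits a set of halting configurations. -/
theorem not_of_cycle (hF : ∀ a ∈ F, f a = none) {t : ℕ} {a : α} (ht : 0 < t)
    (h : Run f t a a) : ¬ Hits f F a := by
  rintro ⟨u, c, hc, hcF⟩
  have hk : ∀ k, Run f (k * t) a a := by
    intro k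
    induction k with
    | zero => rw [Nat.zero_mul]; rfl
    | succ k ih => rw [Nat.succ_mul]; exact ih.add h
  have := le_of_run hF (hk (u + 1)) hc hcF
  nlinarith

end Hits

/-! ### Graphs without the connectedness condition -/

/-- A graph over `S` that need not be connected. -/
structure PreGraph (S : Signature) where
  V : Type
  [finV : Fintype V]
  v0 : V
  step : V → S.Dir → Option V
  label : V → S.Label
  step_opp : ∀ v d w, step v d = some w → step w (S.opp d) = some v
  step_isSome_iff : ∀ v d, (step v d).isSome ↔ d ∈ S.dirs (label v)
  label_init_iff : ∀ v, label v ∈ S.init ↔ v = v0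

attribute [instance] PreGraph.finV

/-- Forget that a graph is connected. -/
def Graph.toPre {S : Signature} (G : Graph S) : PreGraph S where
  V := G.V
  v0 := G.v0
  step := G.step
  label := G.label
  step_opp := G.step_opp
  step_isSome_iff := G.step_isSome_iff
  label_init_iff := G.label_init_iff

namespace PreGraph

variable {S : Signature} (G : PreGraph S)

/-- The adjacency relation of a graph. -/
def Adj (x y : G.V) : Prop := ∃ d, G.step x d = some y

theorem adj_symm {x y : G.V} : G.Adj x y → G.Adj y x := by
  rintro ⟨d, hd⟩
  exact ⟨_, G.step_opp _ _ _ hd⟩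

/-- The nodes of the connected component of the initial node. -/
abbrev Comp : Type := {x : G.V // Relation.ReflTransGen G.Adj G.v0 x}

/-- The step operation on the connected component of the initial node. -/
def compStep (x : G.Comp) (d : S.Dir) : Option G.Comp :=
  (G.step x.1 d).pmap (fun y h => ⟨y, x.2.tail ⟨d, h⟩⟩) (fun _ h => h)

theorem compStep_eq_some {x y : G.Comp} {d : S.Dir} :
    G.compStep x d = some y ↔ G.step x.1 d = some y.1 := by
  rw [compStep, Option.pmap_eq_some_iff]
  constructor
  · rintro ⟨z, _, hz, hy⟩
    rw [hy]
    exact hz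
  · intro h
    exact ⟨y.1, h, h, rfl⟩

theorem compStep_isSome {x : G.Comp} {d : S.Dir} :
    (G.compStep x d).isSome ↔ (G.step x.1 d).isSome := by
  rw [compStep, Option.isSome_pmap]

theorem adj_comp {x y : G.V} (h : Relation.ReflTransGen G.Adj x y)
    (hx : Relation.ReflTransGen G.Adj G.v0 x) (hy : Relation.ReflTransGen G.Adj G.v0 y) :
    Relation.ReflTransGen (fun a b : G.Comp => ∃ d, G.compStep a d = some b) ⟨x, hx⟩ ⟨y, hy⟩ := by
  induction h with
  | refl => exact .refl
  | @tail b c hb hbc ih =>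
    refine (ih (hx.trans hb)).tail ?_
    obtain ⟨d, hd⟩ := hbc
    exact ⟨d, G.compStep_eq_some.2 hd⟩

open Classical in
/-- The connected component of the initial node. -/
noncomputable def graph : Graph S where
  V := G.Comp
  v0 := ⟨G.v0, .refl⟩
  step := G.compStep
  label x := G.label x.1
  step_opp x d y h := by
    rw [compStep_eq_some] at h ⊢
    exact G.step_opp _ _ _ h
  step_isSome_iff x d := by rw [compStep_isSome, G.step_isSome_iff]
  label_init_iff x := by rw [G.label_init_iff, Subtype.ext_iff]
  connected x y := by
    refine G.adj_comp ?_ x.2 y.2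
    have hsymm : ∀ a, Relation.ReflTransGen G.Adj G.v0 a → Relation.ReflTransGen G.Adj a G.v0 := by
      intro a h
      induction h with
      | refl => exact .refl
      | tail _ hbc ih => exact Relation.ReflTransGen.head (G.adj_symm hbc) ih
    exact (hsymm _ x.2).trans y.2

end PreGraph

namespace Automaton

variable {S : Signature}

/-- The partial map on configurations given by an automaton on a graph. -/
def next (B : Automaton S) (G : PreGraph S) (c : B.Q × G.V) : Option (B.Q × G.V) :=
  (B.δ c.1 (G.label c.2)).bind fun r => (G.step c.2 r.2).map fun y => (r.1, y)

theorem next_eq_some {B : Automaton S} {G : PreGraph S} {c c' : B.Q × G.V} :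
    B.next G c = some c' ↔
      ∃ d, B.δ c.1 (G.label c.2) = some (c'.1, d) ∧ G.step c.2 d = some c'.2 := by
  unfold next
  rw [Option.bind_eq_some_iff]
  constructor
  · rintro ⟨⟨s, d⟩, hs, h⟩
    rw [Option.map_eq_some_iff] at h
    obtain ⟨y, hy, rfl⟩ := h
    exact ⟨d, hs, hy⟩
  · rintro ⟨d, hs, hy⟩
    exact ⟨_, hs, by rw [hy]; rfl⟩

/-- The accepting configurations of an automaton on a graph. -/
def accepting (B : Automaton S) (G : PreGraph S) : Set (B.Q × G.V) :=
  {c | (c.1, G.label c.2) ∈ B.F}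

theorem next_of_accepting {B : Automaton S} {G : PreGraph S} :
    ∀ c ∈ B.accepting G, B.next G c = none := by
  intro c hc
  unfold next
  rw [B.δ_of_mem _ _ hc]
  rfl

theorem rtg_iff_run {α : Type*} {f : α → Option α} {a b : α} :
    Relation.ReflTransGen (fun x y => f x = some y) a b ↔ ∃ t, Run f t a b := by
  constructor
  · intro h
    induction h with
    | refl => exact ⟨0, rfl⟩
    | tail _ hbc ih =>
      obtain ⟨t, ht⟩ := ih
      exact ⟨t + 1, ht.add (.one hbc)⟩
  · rintro ⟨t, ht⟩
    induction t generalizing a with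
    | zero => cases ht; exact .refl
    | succ t ih =>
      obtain ⟨c, hc, ht⟩ := ht
      exact (ih ht).head hc

theorem accepts_iff_hits {B : Automaton S} {G : Graph S} :
    B.Accepts G ↔ Hits (B.next G.toPre) (B.accepting G.toPre) (B.q0, G.v0) := by
  have hst : ∀ c c' : B.Q × G.V, B.Step G c c' ↔ B.next G.toPre c = some c' :=
    fun c c' => (next_eq_some (G := G.toPre)).symm
  have hst' : B.Step G = fun c c' => B.next G.toPre c = some c' := by
    funext c c'
    exact propext (hst c c')
  unfold Accepts
  rw [hst']
  constructor
  · rintro ⟨q, v, h, hF⟩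
    obtain ⟨t, ht⟩ := rtg_iff_run.1 h
    exact ⟨t, _, ht, hF⟩
  · rintro ⟨t, c, hc, hF⟩
    exact ⟨c.1, c.2, rtg_iff_run.2 ⟨t, hc⟩, hF⟩

/-- Acceptance of the connected component of the initial node can be read off from the run on
the whole graph. -/
theorem accepts_graph_iff {B : Automaton S} {G : PreGraph S} :
    B.Accepts G.graph ↔ Hits (B.next G) (B.accepting G) (B.q0, G.v0) := by
  rw [accepts_iff_hits]
  refine (Hits.map_iff (f := B.next G.graph.toPre) (F := B.accepting G.graph.toPre)
    (φ := fun c : B.Q × G.Comp => (c.1, c.2.1)) ?_ ?_ (fun _ => Iff.rfl)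
    (B.q0, (⟨G.v0, .refl⟩ : G.Comp))).symm
  · intro c c' h
    obtain ⟨d, hd, h⟩ := next_eq_some.1 h
    exact next_eq_some.2 ⟨d, hd, G.compStep_eq_some.1 h⟩
  · rintro c ⟨q, y⟩ h
    obtain ⟨d, hd, h⟩ := next_eq_some.1 h
    have hy : Relation.ReflTransGen G.Adj G.v0 y := c.2.2.tail ⟨d, h⟩
    exact ⟨(q, ⟨y, hy⟩), next_eq_some.2 ⟨d, hd, G.compStep_eq_some.2 h⟩, rfl⟩

end Automaton

/-! ### The signature -/

/-- The directions: the four axis directions `a`, `-a`, `b`, `-b`, and `K` further directions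
that are their own opposites. The axis direction `(x, s)` belongs to the axis `a` if `x = false`
and to the axis `b` if `x = true`; it is positive if `s = true`. -/
abbrev Dr (K : ℕ) : Type := (Bool × Bool) ⊕ Fin K

namespace Dr

variable {K : ℕ}

/-- The opposite direction. -/
def opp : Dr K → Dr K
  | .inl (x, s) => .inl (x, !s)
  | .inr l => .inr l

@[simp] theorem opp_inl (x s : Bool) : opp (.inl (x, s) : Dr K) = .inl (x, !s) := rfl
@[simp] theorem opp_inr (l : Fin K) : opp (.inr l : Dr K) = .inr l := rfl

@[simp] theorem opp_opp (d : Dr K) : opp (opp d) = d := by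
  rcases d with ⟨x, s⟩ | l <;> simp [opp]

/-- The direction `a`. -/
abbrev fa : Dr K := .inl (false, true)
/-- The direction `-a`. -/
abbrev ba : Dr K := .inl (false, false)
/-- The direction `b`. -/
abbrev fb : Dr K := .inl (true, true)
/-- The direction `-b`. -/
abbrev bb : Dr K := .inl (true, false)

end Dr

open Dr

section Construction

/-- The kinds of node labels. A `cell` and a suitable `pair` are replaced by larger subgraphs, all
the other labels are left unchanged by the homomorphism; see `autδ` for the way the automaton treats
them. -/
inductive Tag
  | init | cell | dead | acc | inc | mv | set0 | set1 | branch | count | ent | rho | pair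
  deriving DecidableEq

instance : Fintype Tag :=
  ⟨{.init, .cell, .dead, .acc, .inc, .mv, .set0, .set1, .branch, .count, .ent, .rho, .pair}, by
    intro x; cases x <;> simp⟩

/-- A node label: its kind and four directions, which may coincide. The last two are those in which
the automaton leaves the node. -/
structure Lab (K : ℕ) where
  tag : Tag
  p1 : Dr K
  p2 : Dr K
  p3 : Dr K
  p4 : Dr K
  deriving DecidableEq

noncomputable instance (K : ℕ) : Fintype (Lab K) :=
  Fintype.ofInjective (fun a : Lab K => (a.tag, a.p1, a.p2, a.p3, a.p4)) (by
    rintro ⟨t, a, b, c, d⟩ ⟨t', a', b', c', d'⟩ h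
    simpa using h)

/-- The directions present at a label: all of them for the kinds `cell`, `ent` and `rho`, and the
four directions listed in the label for the other kinds. -/
def Lab.dirs {K : ℕ} (a : Lab K) : Set (Dr K) :=
  {d | a.tag = .cell ∨ a.tag = .ent ∨ a.tag = .rho ∨ d = a.p1 ∨ d = a.p2 ∨ d = a.p3 ∨ d = a.p4}

/-- The signature with `4 + K` directions. -/
noncomputable abbrev sig (K : ℕ) : Signature where
  Dir := Dr K
  opp := opp
  opp_opp := opp_opp
  Label := Lab K
  init := {a | a.tag = .init}
  init_nonempty := ⟨⟨.init, fa, fa, fa, fa⟩, rfl⟩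
  dirs := Lab.dirs

theorem card_sig (K : ℕ) : Fintype.card (sig K).Dir = 4 + K := by
  change Fintype.card ((Bool × Bool) ⊕ Fin K) = 4 + K
  simp

/-! ### The homomorphism -/

/-- The labels `pair d₁ d₂ e e` to which the homomorphism assigns a three-node subgraph. -/
def Lab.ValidPair {K : ℕ} (a : Lab K) : Prop :=
  a.tag = .pair ∧ a.p1 ≠ a.p2 ∧ a.p3 = a.p4 ∧ a.p4 ≠ a.p1 ∧ a.p4 ≠ a.p2 ∧ a.p4.isRight = true

instance {K : ℕ} (a : Lab K) : Decidable a.ValidPair := by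
  unfold Lab.ValidPair
  infer_instance

variable {K : ℕ}

/-- The positive axis direction joining the first node of a `pair` subgraph to its third node;
it differs from the external direction `d` of the first node. -/
def pairX (d : Dr K) : Dr K := if d = fa then fb else fa

/-- The negative axis direction joining the second node of a `pair` subgraph to its third node;
it differs from the external direction `d` of the second node. -/
def pairY (d : Dr K) : Dr K := if d = ba then bb else ba

theorem pairX_ne (d : Dr K) : d ≠ pairX d := by
  unfold pairX; split_ifs with h
  · subst h; simp
  · exact h

theorem pairY_ne (d : Dr K) : d ≠ pairY d := by
  unfold pairY; split_ifs with h
  · subst h; simp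
  · exact h

theorem exists_pairX (d : Dr K) : ∃ x, pairX d = .inl (x, true) := by
  unfold pairX; split_ifs <;> exact ⟨_, rfl⟩

theorem exists_pairY (d : Dr K) : ∃ x, pairY d = .inl (x, false) := by
  unfold pairY; split_ifs <;> exact ⟨_, rfl⟩

/-- The node set of the subgraph `h(a)`: one node for each direction if `a` is a `cell`, three
nodes for a valid `pair`, and the single node `none` otherwise. -/
def Lab.nodes (a : Lab K) : Set (Option (Dr K)) :=
  if a.tag = .cell then {w | w ≠ none}
  else if a.ValidPair then {some a.p1, some a.p2, some a.p4}
  else {none}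

open Classical in
/-- The node of `h(a)` with the external edge in the direction `d`. -/
noncomputable def Lab.port (a : Lab K) (d : Dr K) : Option (Dr K) :=
  if a.tag = .cell then some d
  else if a.ValidPair then if d ∈ a.dirs then some d else some a.p1
  else none

theorem Lab.port_mem (a : Lab K) (d : Dr K) : a.port d ∈ a.nodes := by
  unfold Lab.port Lab.nodes
  split_ifs with h1 h2 h3
  · simp
  · obtain ⟨h0, h3', h4, -⟩ := h2
    rcases h3 with h | h | h | h | h | h | h <;> simp_all
  · simp
  · simp

theorem Lab.nodes_of_trivial {a : Lab K} (h1 : a.tag ≠ .cell) (h2 : ¬ a.ValidPair) :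
    a.nodes = {none} := by
  rw [Lab.nodes, if_neg h1, if_neg h2]

theorem Lab.port_of_trivial {a : Lab K} (h1 : a.tag ≠ .cell) (h2 : ¬ a.ValidPair)
    (d : Dr K) : a.port d = none := by
  rw [Lab.port, if_neg h1, if_neg h2]

theorem Lab.not_validPair {a : Lab K} (h : a.tag ≠ .pair) : ¬ a.ValidPair := fun h' => h h'.1

section Fragments

variable [NeZero K]

/-- The edges inside the subgraph of a `cell`, whose node `d` has the external edge in the direction
`d`. An automaton that enters at the node `-a` or `-b` counts there, and then takes an edge to the
node `b`, or the path through all the nodes `inr l` to the node `a`. -/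
def cellStep : Dr K → Dr K → Option (Dr K)
  | .inl (false, false), d => if d = fa then some (.inr 0) else if d = fb then some fb else none
  | .inl (true, false), d => if d = fa then some fb else if d = fb then some (.inr 0) else none
  | .inl (true, true), d => if d = bb then some ba else if d = ba then some bb else none
  | .inl (false, true), d => if d = ba then some (.inr (-1)) else none
  | .inr l, d =>
    if d = fa then some (if l = -1 then fa else .inr (l + 1))
    else if d = ba then some (if l = 0 then ba else .inr (l - 1))
    else if d = bb ∧ l = 0 then some bb else none

/-- The node labels of the subgraph of a `cell`. -/
def cellLabel : Dr K → Lab K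
  | .inl (false, false) => ⟨.count, ba, ba, fa, fb⟩
  | .inl (true, false) => ⟨.count, bb, bb, fa, fb⟩
  | .inl (true, true) => ⟨.mv, bb, ba, ba, fb⟩
  | .inl (false, true) => ⟨.mv, ba, ba, ba, fa⟩
  | .inr l => ⟨.mv, .inr l, ba, if l = 0 then bb else ba, fa⟩

theorem cellStep_opp {w d w' : Dr K} (h : cellStep w d = some w') :
    cellStep w' (opp d) = some w := by
  rcases w with ⟨_ | _, _ | _⟩ | l <;> rcases d with ⟨_ | _, _ | _⟩ | l' <;>
    simp only [cellStep] at h <;> split_ifs at h <;> cases h <;>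
    simp_all [cellStep, eq_neg_iff_add_eq_zero, neg_eq_iff_add_eq_zero, add_comm]

theorem cellLabel_dirs (w d : Dr K) :
    d ∈ (cellLabel w).dirs ↔ (cellStep w d).isSome ∨ w = d := by
  rcases w with ⟨_ | _, _ | _⟩ | l <;> rcases d with ⟨_ | _, _ | _⟩ | l' <;>
    simp [cellStep, cellLabel, Lab.dirs] <;> by_cases h : l = 0 <;> simp [h, eq_comm]

theorem cellStep_self (d : Dr K) : cellStep d d = none := by
  rcases d with ⟨_ | _, _ | _⟩ | l <;> simp [cellStep]

/-- The edges inside the subgraph `h(a)`. -/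
def Lab.step (a : Lab K) (w : Option (Dr K)) (d : Dr K) : Option (Option (Dr K)) :=
  if a.tag = .cell then w.bind fun w => (cellStep w d).map some
  else if a.ValidPair then
    if w = some a.p1 ∧ d = pairX a.p1 then some (some a.p4)
    else if w = some a.p2 ∧ d = pairY a.p2 then some (some a.p4)
    else if w = some a.p4 ∧ d = opp (pairX a.p1) then some (some a.p1)
    else if w = some a.p4 ∧ d = opp (pairY a.p2) then some (some a.p2)
    else none
  else none

/-- The node labels of the subgraph `h(a)`. -/
def Lab.label (a : Lab K) (w : Option (Dr K)) : Lab K :=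
  if a.tag = .cell then w.elim a cellLabel
  else if a.ValidPair then
    if w = some a.p1 then ⟨.set0, a.p1, a.p1, pairX a.p1, pairX a.p1⟩
    else if w = some a.p2 then ⟨.set1, a.p2, a.p2, pairY a.p2, pairY a.p2⟩
    else ⟨.mv, opp (pairX a.p1), opp (pairY a.p2), a.p4, a.p4⟩
  else a

theorem Lab.step_mem {a : Lab K} {w w' : Option (Dr K)} {d : Dr K}
    (h : a.step w d = some w') : w' ∈ a.nodes := by
  unfold Lab.step at h
  unfold Lab.nodes
  split_ifs at h ⊢
  · rw [Option.bind_eq_some_iff] at h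
    obtain ⟨x, -, h⟩ := h
    rw [Option.map_eq_some_iff] at h
    obtain ⟨y, -, rfl⟩ := h
    simp
  all_goals cases h; simp

theorem Lab.step_symm {a : Lab K} {w w' : Option (Dr K)} {d : Dr K}
    (h : a.step w d = some w') : a.step w' (opp d) = some w := by
  unfold Lab.step at h ⊢
  by_cases h1 : a.tag = .cell
  · simp only [h1, if_true] at h ⊢
    rw [Option.bind_eq_some_iff] at h
    obtain ⟨x, rfl, h⟩ := h
    rw [Option.map_eq_some_iff] at h
    obtain ⟨y, hy, rfl⟩ := h
    simp [cellStep_opp hy]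
  by_cases h2 : a.ValidPair
  · simp only [h1, if_false, h2, if_true] at h ⊢
    obtain ⟨-, h12, -, h41, h42, h4⟩ := h2
    obtain ⟨x, hx⟩ := exists_pairX a.p1
    obtain ⟨y, hy⟩ := exists_pairY a.p2
    rw [hx, hy] at h ⊢
    split_ifs at h with h3 h5 h6 h7
    · cases h; simp [h3, h41, h42]
    · cases h; simp [h5, h41, h42]
    · cases h; simp [h6]
    · cases h; simp [h7, h12.symm]
  · simp only [h1, if_false, h2] at h
    cases h

open Classical in
theorem Lab.label_dirs {a : Lab K} {w : Option (Dr K)} (hw : w ∈ a.nodes) (d : Dr K) :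
    d ∈ (a.label w).dirs ↔ (a.step w d).isSome ∨ (d ∈ a.dirs ∧ a.port d = w) := by
  unfold Lab.nodes at hw
  unfold Lab.step Lab.label Lab.port
  by_cases h1 : a.tag = .cell
  · simp only [h1, if_true] at hw ⊢
    obtain ⟨w, rfl⟩ := Option.ne_none_iff_exists'.1 hw
    have hd : d ∈ a.dirs := Or.inl h1
    simp only [Option.elim_some, Option.bind_some, cellLabel_dirs, hd, true_and, Option.isSome_map,
      Option.some.injEq]
    rw [eq_comm (a := w)]
  by_cases h2 : a.ValidPair
  · simp only [h1, if_false, h2, if_true] at hw ⊢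
    obtain ⟨h0, h12, h34, h41, h42, h4⟩ := h2
    have hd : d ∈ a.dirs ↔ d = a.p1 ∨ d = a.p2 ∨ d = a.p4 := by
      simp [Lab.dirs, h0, h34]
    have hp : ∀ w : Option (Dr K), (d ∈ a.dirs ∧ (if d ∈ a.dirs then some d else some a.p1) = w) ↔
        ((d = a.p1 ∨ d = a.p2 ∨ d = a.p4) ∧ some d = w) := by
      intro w
      rw [← hd]
      exact and_congr_right fun h => by rw [if_pos h]
    have hX := pairX_ne a.p1
    have hY := pairY_ne a.p2
    obtain ⟨x, hx⟩ := exists_pairX a.p1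
    obtain ⟨y, hy⟩ := exists_pairY a.p2
    rw [hp]
    rcases hw with rfl | rfl | rfl
    · by_cases hdd : d = pairX a.p1
      · simp [hdd, Lab.dirs]
      · simp only [Lab.dirs, hdd, h12, h41.symm, if_true, if_false, and_false, false_and,
          Option.some.injEq, Option.isSome_none, Set.mem_ofPred_eq]
        simp
        tauto
    · by_cases hdd : d = pairY a.p2
      · simp [hdd, Lab.dirs, h12.symm]
      · simp only [Lab.dirs, hdd, h12.symm, h42.symm, if_true, if_false, and_false, false_and,
          Option.some.injEq, Option.isSome_none, Set.mem_ofPred_eq]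
        simp
        tauto
    · by_cases hdd : d = opp (pairX a.p1)
      · simp [hdd, Lab.dirs, h41, h42]
      · by_cases hdd' : d = opp (pairY a.p2)
        · have : opp (pairY a.p2) ≠ opp (pairX a.p1) := hdd' ▸ hdd
          simp [hdd', Lab.dirs, h41, h42, this]
        · simp only [Lab.dirs, hdd, hdd', h41, h42, if_false, and_false, false_and,
            Option.some.injEq, Option.isSome_none, Set.mem_ofPred_eq]
          simp
          tauto
  · simp only [h1, if_false, h2] at hw ⊢
    cases hw
    simp

theorem Lab.step_port {a : Lab K} {d : Dr K} (hd : d ∈ a.dirs) :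
    a.step (a.port d) d = none := by
  classical
  unfold Lab.step Lab.port
  by_cases h1 : a.tag = .cell
  · simp [h1, cellStep_self]
  by_cases h2 : a.ValidPair
  · simp only [h1, if_false, h2, if_true, hd]
    obtain ⟨h0, h12, h34, h41, h42, h4⟩ := h2
    have hX := pairX_ne a.p1
    have hY := pairY_ne a.p2
    have hX' : a.p4 ≠ opp (pairX a.p1) := by
      obtain ⟨x, hx⟩ := exists_pairX a.p1
      rintro h; rw [h, hx] at h4; simp at h4
    have hY' : a.p4 ≠ opp (pairY a.p2) := by
      obtain ⟨x, hx⟩ := exists_pairY a.p2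
      rintro h; rw [h, hx] at h4; simp at h4
    have : ∀ e f : Dr K, e ≠ f → ¬ (d = e ∧ d = f) := by
      rintro e f hef ⟨rfl, h'⟩
      exact hef h'
    simp [this _ _ hX, this _ _ hY, this _ _ hX', this _ _ hY']
  · simp [h1, h2]

/-- Two nodes of the subgraph `h(a)` are joined by a path inside it. -/
theorem Lab.connected (a : Lab K) {u v : Option (Dr K)} (hu : u ∈ a.nodes) (hv : v ∈ a.nodes) :
    Relation.ReflTransGen (fun x y => ∃ d, a.step x d = some y) u v := by
  have hsymm : ∀ x y, Relation.ReflTransGen (fun x y => ∃ d, a.step x d = some y) x y →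
      Relation.ReflTransGen (fun x y => ∃ d, a.step x d = some y) y x := by
    intro x y h
    induction h with
    | refl => exact .refl
    | tail _ hbc ih =>
      obtain ⟨d, hd⟩ := hbc
      exact ih.head ⟨_, Lab.step_symm hd⟩
  -- Every node is joined to one fixed node.
  suffices ∃ z, ∀ x ∈ a.nodes, Relation.ReflTransGen (fun x y => ∃ d, a.step x d = some y) x z by
    obtain ⟨z, hz⟩ := this
    exact (hz u hu).trans (hsymm _ _ (hz v hv))
  unfold Lab.nodes Lab.step
  by_cases h1 : a.tag = .cell
  · simp only [h1, if_true]
    have hl : ∀ m : ℕ, ∀ l : Fin K, l.val = m → Relation.ReflTransGen (fun x y => ∃ d,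
        (x.bind fun w => (cellStep w d).map some) = some y) (some (.inr l : Dr K))
          (some (.inr 0 : Dr K)) := by
      intro m
      induction m with
      | zero =>
        intro l hl
        rw [show l = 0 from Fin.ext hl]
      | succ m ih =>
        intro l hl
        have hl0 : l ≠ 0 := by rintro rfl; simp at hl
        refine .head (b := some (.inr (l - 1))) ⟨ba, by simp [cellStep, hl0]⟩ (ih _ ?_)
        rw [Fin.val_sub_one_of_ne_zero hl0, hl, Nat.add_sub_cancel]
    refine ⟨some (.inr 0), ?_⟩
    rintro w hw
    obtain ⟨w, rfl⟩ := Option.ne_none_iff_exists'.1 hw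
    rcases w with ⟨_ | _, _ | _⟩ | l
    · exact .single ⟨fa, by simp [cellStep]⟩
    · exact .head (b := some (.inr (-1))) ⟨ba, by simp [cellStep]⟩ (hl _ _ rfl)
    · exact .single ⟨fb, by simp [cellStep]⟩
    · refine .head (b := some ba) ⟨bb, by simp [cellStep]⟩ (.single ⟨fa, by simp [cellStep]⟩)
    · exact hl _ l rfl
  by_cases h2 : a.ValidPair
  · simp only [h1, if_false, h2, if_true]
    refine ⟨some a.p4, ?_⟩
    rintro w (rfl | rfl | rfl)
    · exact .single ⟨pairX a.p1, by simp⟩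
    · exact .single ⟨pairY a.p2, by simp [h2.2.1.symm]⟩
    · exact .refl
  · simp only [h1, if_false, h2]
    refine ⟨none, ?_⟩
    rintro w rfl
    exact .refl

/-- The subgraph `h(a)`. -/
noncomputable def frag (a : Lab K) : Fragment (sig K) a.dirs where
  V := a.nodes
  finV := Fintype.ofFinite _
  nonempty := ⟨⟨a.port fa, a.port_mem fa⟩⟩
  step w d := (a.step w.1 d).pmap (fun y h => ⟨y, Lab.step_mem h⟩) (fun _ h => h)
  label w := a.label w.1
  port d := ⟨a.port d, a.port_mem d⟩
  step_opp w d w' h := by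
    rw [Option.pmap_eq_some_iff] at h ⊢
    obtain ⟨y, hy, -, rfl⟩ := h
    exact ⟨w.1, Lab.step_symm hy, Lab.step_symm hy, rfl⟩
  step_port d hd := by
    rw [Option.pmap_eq_none_iff]
    exact Lab.step_port hd
  dirs_iff w d := by
    rw [Option.isSome_pmap]
    refine (Lab.label_dirs w.2 d).trans (or_congr Iff.rfl (and_congr Iff.rfl ?_))
    exact ⟨fun h => Subtype.ext h, fun h => congrArg Subtype.val h⟩
  connected u v := by
    have : ∀ x y, Relation.ReflTransGen (fun x y => ∃ d, a.step x d = some y) x y →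
        ∀ (hx : x ∈ a.nodes) (hy : y ∈ a.nodes), Relation.ReflTransGen (fun x y : a.nodes =>
          ∃ d, (a.step x.1 d).pmap (fun y h => (⟨y, Lab.step_mem h⟩ : a.nodes)) (fun _ h => h)
            = some y) ⟨x, hx⟩ ⟨y, hy⟩ := by
      intro x y h
      induction h with
      | refl => exact fun _ _ => .refl
      | tail _ hbc ih =>
        intro hx hy
        obtain ⟨d, hd⟩ := hbc
        refine (ih hx (Lab.step_mem (Lab.step_symm hd))).tail ⟨d, ?_⟩
        rw [Option.pmap_eq_some_iff]
        exact ⟨_, hd, hd, rfl⟩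
    exact this _ _ (a.connected u.2 v.2) u.2 v.2

theorem Lab.step_of_trivial {a : Lab K} (h1 : a.tag ≠ .cell) (h2 : ¬ a.ValidPair)
    (w : Option (Dr K)) (d : Dr K) : a.step w d = none := by
  rw [Lab.step, if_neg h1, if_neg h2]

theorem Lab.label_of_trivial {a : Lab K} (h1 : a.tag ≠ .cell) (h2 : ¬ a.ValidPair)
    (w : Option (Dr K)) : a.label w = a := by
  rw [Lab.label, if_neg h1, if_neg h2]

theorem Lab.label_tag_ne_init {a : Lab K} (ha : a.tag ≠ .init) {w : Option (Dr K)}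
    (hw : w ∈ a.nodes) : (a.label w).tag ≠ .init := by
  unfold Lab.label
  unfold Lab.nodes at hw
  by_cases h1 : a.tag = .cell
  · simp only [h1, if_true] at hw ⊢
    obtain ⟨w, rfl⟩ := Option.ne_none_iff_exists'.1 hw
    rcases w with ⟨_ | _, _ | _⟩ | l <;> simp [cellLabel]
  · rw [if_neg h1]
    split_ifs <;> simp [ha]

/-- The homomorphism. -/
noncomputable def hom (K : ℕ) [NeZero K] : Homomorphism (sig K) where
  frag := frag
  init_of_mem a ha := by
    have h1 : a.tag ≠ .cell := by rw [show a.tag = .init from ha]; simp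
    have h2 : ¬ a.ValidPair := Lab.not_validPair (by rw [show a.tag = .init from ha]; simp)
    refine ⟨⟨none, by rw [Lab.nodes_of_trivial h1 h2]; rfl⟩, ?_, ?_⟩
    · change (a.label none).tag = .init
      rw [Lab.label_of_trivial h1 h2]; exact ha
    · rintro ⟨y, hy⟩ -
      rw [Lab.nodes_of_trivial h1 h2] at hy
      exact Subtype.ext hy
  init_of_notMem a ha w := Lab.label_tag_ne_init ha w.2

end Fragments

/-! ### The automaton -/

/-- The transitions of the automaton. At `inc` and `count` it adds one to its state modulo `n`. At
`count` it chooses the direction `p4` instead of `p3` if the state becomes zero, that is, once in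
every `n` cells. At `branch` it tells whether the state is zero. -/
def autδ (n : ℕ) [NeZero n] (q : Fin n) (a : Lab K) : Option (Fin n × Dr K) :=
  match a.tag with
  | .init => some (q, a.p4)
  | .inc => some (q + 1, a.p4)
  | .mv => some (q, a.p4)
  | .set0 => some (0, a.p4)
  | .set1 => some (1, a.p4)
  | .branch => if q = 0 then some (0, a.p3) else some (q, a.p4)
  | .count => some (q + 1, if q + 1 = 0 then a.p4 else a.p3)
  | .ent => some (q, a.p4)
  | .rho => some (0, a.p4)
  | _ => none

theorem autδ_dir {n : ℕ} [NeZero n] {q q' : Fin n} {a : Lab K} {d : Dr K}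
    (h : autδ n q a = some (q', d)) : d ∈ a.dirs := by
  unfold autδ at h
  unfold Lab.dirs
  split at h <;> (try split_ifs at h) <;> cases h <;> simp

/-- The automaton with `n` states. -/
def aut (K n : ℕ) [NeZero n] : Automaton (sig K) where
  Q := Fin n
  q0 := 0
  F := {c | c.2.tag = .acc}
  δ := autδ n
  δ_of_mem q a h := by
    change autδ n q a = none
    unfold autδ
    rw [show a.tag = .acc from h]
  δ_dir q a q' d h := autδ_dir h

variable [NeZero K] {n : ℕ} [NeZero n]

/-- The configurations of the automaton on `h(G)`: a state, a node of `G`, and a node of the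
subgraph that replaces it. -/
abbrev Conf (n : ℕ) (G : PreGraph (sig K)) : Type := Fin n × G.V × Option (Dr K)

/-- The computation step of the automaton on `h(G)`. -/
noncomputable def autNext (n : ℕ) [NeZero n] (G : PreGraph (sig K)) (c : Conf n G) :
    Option (Conf n G) :=
  (autδ n c.1 (Lab.label (G.label c.2.1) c.2.2)).bind fun r =>
    match Lab.step (G.label c.2.1) c.2.2 r.2 with
    | some w => some (r.1, c.2.1, w)
    | none => (G.step c.2.1 r.2).map fun y => (r.1, y, Lab.port (G.label y) (opp r.2))

/-- The accepting configurations of the automaton on `h(G)`. -/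
def autAcc (n : ℕ) (G : PreGraph (sig K)) : Set (Conf n G) :=
  {c | (Lab.label (G.label c.2.1) c.2.2).tag = .acc}

theorem autNext_internal {G : PreGraph (sig K)} {q q' : Fin n} {v : G.V} {w w' : Option (Dr K)}
    {d : Dr K} (hd : autδ n q (Lab.label (G.label v) w) = some (q', d))
    (hs : Lab.step (G.label v) w d = some w') : autNext n G (q, v, w) = some (q', v, w') := by
  unfold autNext
  simp only [hd, Option.bind_some, hs]

theorem autNext_external {G : PreGraph (sig K)} {q q' : Fin n} {v y : G.V} {w : Option (Dr K)}
    {d : Dr K} (hd : autδ n q (Lab.label (G.label v) w) = some (q', d))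
    (hs : Lab.step (G.label v) w d = none) (hy : G.step v d = some y) :
    autNext n G (q, v, w) = some (q', y, Lab.port (G.label y) (opp d)) := by
  unfold autNext
  simp only [hd, Option.bind_some, hs, hy, Option.map_some]

theorem autNext_cases {G : PreGraph (sig K)} {q : Fin n} {v : G.V} {w : Option (Dr K)}
    {c : Conf n G} (h : autNext n G (q, v, w) = some c) :
    ∃ q' d, autδ n q (Lab.label (G.label v) w) = some (q', d) ∧
      ((∃ w', Lab.step (G.label v) w d = some w' ∧ c = (q', v, w')) ∨
        (Lab.step (G.label v) w d = none ∧
          ∃ y, G.step v d = some y ∧ c = (q', y, Lab.port (G.label y) (opp d)))) := by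
  unfold autNext at h
  rw [Option.bind_eq_some_iff] at h
  obtain ⟨⟨q', d⟩, hd, h⟩ := h
  refine ⟨q', d, hd, ?_⟩
  simp only at h
  cases hs : Lab.step (G.label v) w d with
  | some z =>
    rw [hs] at h
    cases h
    exact Or.inl ⟨z, rfl, rfl⟩
  | none =>
    rw [hs] at h
    simp only [Option.map_eq_some_iff] at h
    obtain ⟨y, hy, h⟩ := h
    exact Or.inr ⟨rfl, y, hy, h.symm⟩

theorem frag_step_eq_some {a : Lab K} {w w' : a.nodes} {d : Dr K} :
    (frag a).step w d = some w' ↔ a.step w.1 d = some w'.1 := by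
  change (a.step w.1 d).pmap (fun y h => (⟨y, Lab.step_mem h⟩ : a.nodes)) (fun _ h => h) =
    some w' ↔ _
  rw [Option.pmap_eq_some_iff]
  constructor
  · rintro ⟨z, _, hz, h⟩
    rw [h]
    exact hz
  · intro h
    exact ⟨w'.1, h, h, rfl⟩

theorem hom_v0 (G : PreGraph (sig K)) :
    ∃ w : Lab.nodes (G.label G.v0), w.1 = none ∧
      ((hom K).apply G.graph).v0 = ⟨⟨G.v0, .refl⟩, w⟩ := by
  refine ⟨((hom K).apply G.graph).v0.2, ?_, rfl⟩
  generalize ((hom K).apply G.graph).v0.2 = w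
  have hv : (G.label G.v0).tag = .init := (G.label_init_iff G.v0).2 rfl
  have hw : w.1 ∈ Lab.nodes (G.label G.v0) := w.2
  rw [Lab.nodes_of_trivial (by rw [hv]; simp) (Lab.not_validPair (by rw [hv]; simp))] at hw
  exact hw

theorem aut_accepts_iff (G : PreGraph (sig K)) :
    (aut K n).Accepts ((hom K).apply G.graph) ↔
      Hits (autNext n G) (autAcc n G) (0, G.v0, none) := by
  rw [Automaton.accepts_iff_hits]
  have hφ := Hits.map_iff (f := (aut K n).next ((hom K).apply G.graph).toPre)
    (F := (aut K n).accepting ((hom K).apply G.graph).toPre)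
    (g := autNext n G) (F' := autAcc n G)
    (φ := fun c : (aut K n).Q × (hom K).Node G.graph =>
      ((c.1, c.2.1.1, c.2.2.1) : Conf n G)) ?_ ?_ (fun _ => Iff.rfl)
    ((aut K n).q0, ((hom K).apply G.graph).v0)
  · rw [← hφ]
    obtain ⟨w, hw, h⟩ := hom_v0 G
    rw [h, ← hw]
    rfl
  · rintro ⟨q, v, w⟩ ⟨q', v', w'⟩ h
    obtain ⟨d, hd, h⟩ := Automaton.next_eq_some.1 h
    have h := ((hom K).step_eq_some_iff G.graph ⟨v, w⟩ ⟨v', w'⟩ d).1 h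
    rcases h with ⟨y, hy, h⟩ | ⟨hp, u, hu, h⟩
    · cases h
      exact autNext_internal hd (frag_step_eq_some.1 hy)
    · cases h
      have hu' : G.step v.1 d = some v'.1 := G.compStep_eq_some.1 hu
      have hp' : Lab.port (G.label v.1) d = w.1 := congrArg Subtype.val hp
      have hs : Lab.step (G.label v.1) w.1 d = none := by
        rw [← hp']
        exact Lab.step_port ((G.step_isSome_iff v.1 d).1 (by rw [hu']; rfl))
      exact autNext_external hd hs hu'
  · rintro ⟨q, v, w⟩ c h
    obtain ⟨q', d, hd, ⟨w', hs, rfl⟩ | ⟨hs, y, hy, rfl⟩⟩ := autNext_cases h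
    · refine ⟨(q', ⟨v, ⟨w', Lab.step_mem hs⟩⟩), ?_, rfl⟩
      rw [Automaton.next_eq_some]
      exact ⟨d, hd, ((hom K).step_eq_some_iff G.graph ⟨v, w⟩ _ d).2
        (Or.inl ⟨⟨w', Lab.step_mem hs⟩, frag_step_eq_some.2 hs, rfl⟩)⟩
    · have hx : Relation.ReflTransGen G.Adj G.v0 y := v.2.tail ⟨d, hy⟩
      refine ⟨(q', ⟨⟨y, hx⟩, ⟨_, Lab.port_mem _ _⟩⟩), ?_, rfl⟩
      rw [Automaton.next_eq_some]
      refine ⟨d, hd, ((hom K).step_eq_some_iff G.graph ⟨v, w⟩ _ d).2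
        (Or.inr ⟨Subtype.ext ?_, ⟨y, hx⟩, G.compStep_eq_some.2 hy, rfl⟩)⟩
      rcases (Lab.label_dirs w.2 d).1 (autδ_dir hd) with h | h
      · have hs' : Lab.step (G.label v.1) w.1 d = none := hs
        have h' : (Lab.step (G.label v.1) w.1 d).isSome := h
        rw [hs'] at h'
        cases h'
      · exact h.2

theorem autNext_of_acc {G : PreGraph (sig K)} :
    ∀ c ∈ autAcc n G, autNext n G c = none := by
  intro c hc
  have hc' : (Lab.label (G.label c.2.1) c.2.2).tag = .acc := hc
  unfold autNext autδ
  rw [hc']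
  rfl

end Construction

/-! ### Walks over the cells

The cells of a large array have bases in `ZMod (2 * n)`, and all of them look alike. A device
walking over them is given by its state set `P` and a map `mst`, which gives the next state and the
axis direction of the move, or `none` if the device stays in the cell. -/

section Region

/-- The effect of a move on the base coordinate: a positive move adds one, a negative move
subtracts one. -/
def sh {H : ℕ} : Option (Bool × Bool) → ZMod H
  | none => 0
  | some (_, true) => 1
  | some (_, false) => -1

/-- The displacement of a move at the base `i`: the coordinate `none` counts all moves, the
coordinate `some j` counts the moves along the axis `b` between the bases `j` and `j + 1`. -/
def disp {H : ℕ} : Option (Bool × Bool) → ZMod H → Option (ZMod H) → ℤ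
  | none, _, _ => 0
  | some (_, true), _, none => 1
  | some (_, false), _, none => -1
  | some (x, true), i, some j => if x = true ∧ j = i then 1 else 0
  | some (x, false), i, some j => if x = true ∧ j + 1 = i then -1 else 0

theorem abs_disp_le {H : ℕ} (d : Option (Bool × Bool)) (i : ZMod H) (x : Option (ZMod H)) :
    |disp d i x| ≤ 1 := by
  rcases d with _ | ⟨y, _ | _⟩ <;> rcases x with _ | j <;> simp only [disp] <;>
    (try split_ifs) <;> simp

theorem disp_opp {H : ℕ} (y s : Bool) (i : ZMod H) (x : Option (ZMod H)) :
    disp (some (y, !s)) (i + sh (some (y, s))) x = - disp (some (y, s)) i x := by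
  rcases s with _ | _ <;> rcases x with _ | j <;> simp [disp, sh] <;> split_ifs <;>
    simp_all [eq_add_neg_iff_add_eq]

variable {P : Type*} {n : ℕ} (mst : P → P × Option (Bool × Bool))

/-- One move of a device with state set `P`, with only the base coordinate of the position. -/
def baseStep (c : P × ZMod (2 * n)) : P × ZMod (2 * n) :=
  ((mst c.1).1, c.2 + sh (mst c.1).2)

/-- The displacement after `t` moves. -/
def displacement : ℕ → P × ZMod (2 * n) → Option (ZMod (2 * n)) → ℤ
  | 0, _, _ => 0
  | t + 1, c, x => disp (mst c.1).2 c.2 x + displacement t (baseStep mst c) x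

variable {mst}

local notation "β" => baseStep mst
local notation "D" => displacement mst

theorem displacement_add (s t : ℕ) (c : P × ZMod (2 * n)) (x : Option (ZMod (2 * n))) :
    D (s + t) c x = D s c x + D t (β^[s] c) x := by
  induction s generalizing c with
  | zero => simp [displacement]
  | succ s ih =>
    rw [Nat.add_right_comm]
    simp only [displacement, Function.iterate_succ_apply]
    rw [ih, add_assoc]

theorem abs_displacement_le (t : ℕ) (c : P × ZMod (2 * n)) (x : Option (ZMod (2 * n))) :
    |D t c x| ≤ t := by
  induction t generalizing c with
  | zero => simp [displacement]
  | succ t ih =>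
    simp only [displacement]
    refine (abs_add_le _ _).trans ?_
    have := abs_disp_le (mst c.1).2 c.2 x
    have := ih (β c)
    push_cast
    linarith

theorem iterate_mul_period {T : ℕ} {c : P × ZMod (2 * n)} (h : β^[T] c = c) (m : ℕ) :
    β^[m * T] c = c := by
  induction m with
  | zero => simp
  | succ m ih => rw [Nat.succ_mul m T, Function.iterate_add_apply, h, ih]

theorem displacement_mul_period {T : ℕ} {c : P × ZMod (2 * n)} (h : β^[T] c = c) (m : ℕ)
    (x : Option (ZMod (2 * n))) : D (m * T) c x = m * D T c x := by
  induction m with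
  | zero => simp [displacement]
  | succ m ih =>
    rw [Nat.succ_mul m T, displacement_add, ih, iterate_mul_period h]
    push_cast
    ring

theorem displacement_shift (t : ℕ) (s : P) (i k : ZMod (2 * n)) (x : Option (ZMod (2 * n))) :
    D t (s, i + k) (x.map (· + k)) = D t (s, i) x := by
  induction t generalizing s i with
  | zero => rfl
  | succ t ih =>
    simp only [displacement, baseStep]
    rw [add_right_comm, ih]
    congr 1
    rcases (mst s).2 with _ | ⟨y, _ | _⟩ <;> rcases x with _ | j <;>
      simp [disp, add_right_comm _ k 1]

/-- The displacement of one lap of the walk that moves along the axis `a` from the bases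
`0, …, n - 1` and along the axis `b` from the bases `n, …, 2n - 1`. -/
def lap (n : ℕ) : Option (ZMod (2 * n)) → ℤ
  | none => 2 * n
  | some j => if n ≤ j.val then 1 else 0

variable (mst) in
/-- The pairs of a state and a base from which the device moves periodically, with a displacement
that is a nonzero multiple of a lap. -/
def Cyclic : Set (P × ZMod (2 * n)) :=
  {c | ∃ T > 0, ∃ α : ℤ, α ≠ 0 ∧ β^[T] c = c ∧ ∀ x, D T c x = α * lap n x}

variable [NeZero n]

instance : NeZero (2 * n) := ⟨mul_ne_zero two_ne_zero (NeZero.ne n)⟩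

/-- A lap has no rotational symmetry. -/
theorem lap_shift {k : ZMod (2 * n)} (h : ∀ j, lap n (some (j + k)) = lap n (some j)) :
    k = 0 := by
  have hn : 0 < n := Nat.pos_of_ne_zero (NeZero.ne n)
  have hk := ZMod.val_lt k
  by_contra hk0
  have hk1 : k.val ≠ 0 := by rwa [Ne, ZMod.val_eq_zero]
  have h0 := h 0
  simp only [lap, zero_add, ZMod.val_zero] at h0
  rw [if_neg (show ¬ n ≤ 0 by omega)] at h0
  have hkn : ¬ n ≤ k.val := by
    intro h'
    rw [if_pos h'] at h0
    simp at h0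
  have h1 := h ((n - 1 : ℕ) : ZMod (2 * n))
  have e1 : ((n - 1 : ℕ) : ZMod (2 * n)).val = n - 1 := ZMod.val_cast_of_lt (by omega)
  have e2 : (((n - 1 : ℕ) : ZMod (2 * n)) + k).val = n - 1 + k.val := by
    rw [ZMod.val_add_of_lt, e1]
    rw [e1]; omega
  simp only [lap, e1, e2] at h1
  rw [if_pos (by omega), if_neg (by omega)] at h1
  simp at h1

/-- A state is cyclic at one base only: shifting the base rotates the displacement, and a lap has no
rotational symmetry. -/
theorem Cyclic.unique {s : P} {i i' : ZMod (2 * n)} (h : (s, i) ∈ Cyclic mst)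
    (h' : (s, i') ∈ Cyclic mst) : i = i' := by
  obtain ⟨k, rfl⟩ : ∃ k, i' = i + k := ⟨i' - i, by ring⟩
  obtain ⟨T, hT, α, hα, hper, hD⟩ := h
  obtain ⟨T', hT', α', hα', hper', hD'⟩ := h'
  have key : ∀ x, (T : ℤ) * (α' * lap n (x.map (· + k))) = T' * (α * lap n x) := by
    intro x
    rw [← hD, ← hD', ← displacement_mul_period hper, ← displacement_mul_period hper',
      ← displacement_shift _ s i k, Nat.mul_comm]
  have h0 := key none
  have hn : (0 : ℤ) < n := by exact_mod_cast Nat.pos_of_ne_zero (NeZero.ne n)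
  have hTα : (T : ℤ) * α' = T' * α := by
    have : ((T : ℤ) * α' - T' * α) * (2 * n) = 0 := by
      simp only [lap, Option.map_none] at h0
      linarith
    rcases mul_eq_zero.1 this with h | h
    · linarith
    · omega
  have hne : (T' : ℤ) * α ≠ 0 := mul_ne_zero (by omega) hα
  have : k = 0 := by
    apply lap_shift
    intro j
    have := key (some j)
    rw [← mul_assoc, ← mul_assoc, hTα] at this
    exact mul_left_cancel₀ hne this
  rw [this, add_zero]

variable (mst) in
/-- The states of cyclic pairs at the base `i` that are entered by a proper move from a cyclic
pair. -/
def Arrivals (i : ZMod (2 * n)) : Set P :=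
  {s | ∃ c ∈ Cyclic (n := n) mst, (mst c.1).2.isSome ∧ β c = (s, i) ∧ (s, i) ∈ Cyclic mst}

/-- A device with fewer than `n (4 + K)` states has a base with at most one arrival state, or it
fails to use some direction `l` in all the cyclic states of some base. Here `lst s` is the
direction `l` used in the state `s`, if any. -/
theorem few_states [Fintype P] {K : ℕ} (lst : P → Option (Fin K))
    (hl : ∀ s l, lst s = some l → (mst s).2 = none) (hP : Fintype.card P < n * (4 + K)) :
    (∃ i : ZMod (2 * n), (Arrivals mst i).Subsingleton) ∨
      ∃ (l : Fin K) (q : Fin n), ∀ s,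
        (s, ((q.val : ℕ) : ZMod (2 * n))) ∈ Cyclic mst → lst s ≠ some l := by
  by_contra hcon
  push Not at hcon
  obtain ⟨h1, h2⟩ := hcon
  have h1' : ∀ i : ZMod (2 * n), ∃ f : Bool → P × ZMod (2 * n),
      (β (f false)).1 ≠ (β (f true)).1 ∧ ∀ b, f b ∈ Cyclic mst ∧ (mst (f b).1).2.isSome ∧
        (β (f b)).2 = i := by
    intro i
    obtain ⟨s, hs, s', hs', hne⟩ := h1 i
    obtain ⟨c, hc, hm, hb, -⟩ := hs
    obtain ⟨c', hc', hm', hb', -⟩ := hs'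
    refine ⟨fun b => if b then c' else c, by simpa [hb, hb'] using hne, ?_⟩
    rintro (_ | _)
    · exact ⟨hc, hm, by simp [hb]⟩
    · exact ⟨hc', hm', by simp [hb']⟩
  choose f hf hf' using h1'
  choose g hg hg' using h2
  -- The two cyclic states before the arrivals at each base, and the states that visit the leaves,
  -- are pairwise different, because a cyclic state determines its base.
  let F : (ZMod (2 * n) × Bool) ⊕ (Fin K × Fin n) → P :=
    Sum.elim (fun x => (f x.1 x.2).1) (fun x => g x.1 x.2)
  have hF : Function.Injective F := by
    rintro (⟨i, b⟩ | ⟨l, q⟩) (⟨i', b'⟩ | ⟨l', q'⟩) h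
    · have h : (f i b).1 = (f i' b').1 := h
      have hc := (hf' i b).1
      have hc' := (hf' i' b').1
      have h2 : (f i b).2 = (f i' b').2 := by
        refine Cyclic.unique (s := (f i b).1) hc ?_
        rw [h]
        exact hc'
      have hff : f i b = f i' b' := Prod.ext h h2
      have hi : i = i' := by rw [← (hf' i b).2.2, hff, (hf' i' b').2.2]
      subst hi
      have hb : b = b' := by
        by_contra hne
        rcases b with _ | _ <;> rcases b' with _ | _ <;> simp at hne
        · exact hf i (by rw [hff])
        · exact hf i (by rw [hff])
      rw [hb]
    · have h : (f i b).1 = g l' q' := h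
      have := (hf' i b).2.1
      rw [h, hl _ _ (hg' l' q')] at this
      cases this
    · have h : g l q = (f i' b').1 := h
      have := (hf' i' b').2.1
      rw [← h, hl _ _ (hg' l q)] at this
      cases this
    · have h : g l q = g l' q' := h
      have h3 := hg' l q
      rw [h, hg' l' q'] at h3
      cases h3
      have h4 := hg l q
      rw [h] at h4
      have h5 := congrArg ZMod.val (Cyclic.unique h4 (hg l q'))
      rw [ZMod.val_cast_of_lt (by omega), ZMod.val_cast_of_lt (by omega)] at h5
      rw [Fin.ext h5]
  have hcard := Fintype.card_le_of_injective F hF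
  simp only [Fintype.card_sum, Fintype.card_prod, ZMod.card, Fintype.card_bool,
    Fintype.card_fin] at hcard
  nlinarith

/-- Among the first iterates of a self-map of a finite type there is a repetition. -/
theorem exists_iterate_period {α : Type*} [Fintype α] (f : α → α) (c : α) :
    ∃ t l, 0 < l ∧ t + l ≤ Fintype.card α ∧ f^[l] (f^[t] c) = f^[t] c := by
  obtain ⟨x, y, hxy, h⟩ := Fintype.exists_ne_map_eq_of_card_lt
    (fun m : Fin (Fintype.card α + 1) => f^[m.val] c) (by simp)
  rcases Nat.lt_or_gt_of_ne (Fin.val_ne_of_ne hxy) with hlt | hlt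
  · refine ⟨x.val, y.val - x.val, by omega, by omega, ?_⟩
    rw [← Function.iterate_add_apply, Nat.sub_add_cancel hlt.le]
    exact h.symm
  · refine ⟨y.val, x.val - y.val, by omega, by omega, ?_⟩
    rw [← Function.iterate_add_apply, Nat.sub_add_cancel hlt.le]
    exact h

/-- The number of configurations of a device on the bases. -/
abbrev baseCard (P : Type*) [Fintype P] (n : ℕ) [NeZero n] : ℕ :=
  Fintype.card (P × ZMod (2 * n))

/-- The case of a walk that consists of `j` periods. -/
theorem mem_cyclic_of_period {M N L : ℕ}
    (hL : 2 * M * (2 * M + 2) + (2 * M + 2) < L)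
    (hN : 2 * M * (L * (2 * n) + 2 * M + 2) + L + 2 * M + 2 < N)
    {c : P × ZMod (2 * n)} {l : ℕ} (hl0 : 0 < l) (hl : l ≤ M) (hper : β^[l] c = c)
    {η j : ℤ} (hη : η = 1 ∨ η = -1) {ε : Option (ZMod (2 * n)) → ℤ}
    (hε : ∀ x, |ε x| ≤ 2 * M + 2)
    (hD : ∀ x, (N : ℤ) ∣ j * D l c x - (η * L * lap n x + ε x)) : c ∈ Cyclic mst := by
  have hn : 0 < n := Nat.pos_of_ne_zero (NeZero.ne n)
  have hlap : ∀ x, 0 ≤ lap n x ∧ lap n x ≤ 2 * n := by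
    rintro (_ | j)
    · simp [lap]
    · simp only [lap]; split_ifs <;> constructor <;> omega
  -- The base `n` is the first one where a lap moves along the axis `b`.
  set x₀ : Option (ZMod (2 * n)) := some ((n : ℕ) : ZMod (2 * n)) with hx₀
  have h₀ : lap n x₀ = 1 := by
    rw [hx₀]
    simp only [lap]
    rw [ZMod.val_cast_of_lt (by omega), if_pos le_rfl]
  set ω := D l c with hω
  have hωl : ∀ x, |ω x| ≤ M := fun x => (abs_displacement_le l c x).trans (by exact_mod_cast hl)
  have hη1 : |η| = 1 := by rcases hη with rfl | rfl <;> simp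
  have hLn : (0 : ℤ) ≤ L := by positivity
  -- Eliminating `j` gives a congruence between numbers that are small compared with `N`.
  have hcross : ∀ x, ω x₀ * (η * L * lap n x + ε x) = ω x * (η * L + ε x₀) := by
    intro x
    have hdvd : (N : ℤ) ∣ ω x₀ * (η * L * lap n x + ε x) - ω x * (η * L + ε x₀) := by
      obtain ⟨a, ha⟩ := hD x₀
      obtain ⟨b, hb⟩ := hD x
      rw [h₀] at ha
      exact ⟨ω x * a - ω x₀ * b, by linear_combination ω x * ha - ω x₀ * hb⟩
    have hb : ∀ x, |η * L * lap n x + ε x| ≤ L * (2 * n) + (2 * M + 2) := by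
      intro x
      refine (abs_add_le _ _).trans (add_le_add ?_ (hε x))
      rw [abs_mul, abs_mul, hη1, one_mul, abs_of_nonneg hLn, abs_of_nonneg (hlap x).1]
      exact mul_le_mul_of_nonneg_left (hlap x).2 hLn
    have hb₀ := hb x₀
    rw [h₀, mul_one] at hb₀
    have hlt : |ω x₀ * (η * L * lap n x + ε x) - ω x * (η * L + ε x₀)| < N := by
      refine (abs_sub _ _).trans_lt ?_
      rw [abs_mul, abs_mul]
      have h1 := mul_le_mul (hωl x₀) (hb x) (abs_nonneg _) (by positivity)
      have h2 := mul_le_mul (hωl x) hb₀ (abs_nonneg _) (by positivity)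
      have hN' : (2 * M * (L * (2 * n) + 2 * M + 2) + L + 2 * M + 2 : ℤ) < N := by
        exact_mod_cast hN
      nlinarith
    have := Int.eq_zero_of_abs_lt_dvd hdvd hlt
    linarith
  -- The part of the equation that contains `L` dominates, so it vanishes.
  have hω : ∀ x, ω x = ω x₀ * lap n x := by
    intro x
    by_contra hne
    have h1 : η * L * (ω x - ω x₀ * lap n x) = ω x₀ * ε x - ω x * ε x₀ := by
      have := hcross x
      linarith
    have h2 : (L : ℤ) ≤ |η * L * (ω x - ω x₀ * lap n x)| := by
      rw [abs_mul, abs_mul, hη1, one_mul, abs_of_nonneg hLn]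
      have : 1 ≤ |ω x - ω x₀ * lap n x| := Int.one_le_abs (sub_ne_zero.2 hne)
      nlinarith
    have h3 : |ω x₀ * ε x - ω x * ε x₀| ≤ M * (2 * M + 2) + M * (2 * M + 2) := by
      refine (abs_sub _ _).trans ?_
      rw [abs_mul, abs_mul]
      exact add_le_add (mul_le_mul (hωl x₀) (hε x) (abs_nonneg _) (by positivity))
        (mul_le_mul (hωl x) (hε x₀) (abs_nonneg _) (by positivity))
    rw [h1] at h2
    have hL' : (2 * M * (2 * M + 2) + (2 * M + 2) : ℤ) < L := by exact_mod_cast hL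
    linarith
  refine ⟨l, hl0, ω x₀, ?_, hper, hω⟩
  intro h0
  have h1 := hD x₀
  rw [h0, h₀, mul_zero, zero_sub, mul_one, dvd_neg] at h1
  have hL' : (2 * M * (2 * M + 2) + (2 * M + 2) : ℤ) < L := by exact_mod_cast hL
  have hN' : (2 * M * (L * (2 * n) + 2 * M + 2) + L + 2 * M + 2 : ℤ) < N := by exact_mod_cast hN
  have hε₀ := abs_le.1 (hε x₀)
  have hpos : (0 : ℤ) ≤ 2 * M * (2 * M + 2) := by positivity
  have hpos' : (0 : ℤ) ≤ 2 * M * (L * (2 * n) + 2 * M + 2) := by positivity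
  have := Int.eq_zero_of_abs_lt_dvd h1 (abs_lt.2 (by
    rcases hη with rfl | rfl <;> constructor <;> linarith))
  rcases hη with rfl | rfl <;> linarith

/-- If the displacement of a long walk is, up to a small error, a large multiple of a lap modulo
`N`, then the walk has become periodic and the displacement over a period is a multiple of a
lap. -/
theorem mem_cyclic_of_displacement [Fintype P] {M N L τ : ℕ} (hM : M = baseCard P n)
    (hL : 2 * M * (2 * M + 2) + (2 * M + 2) < L)
    (hN : 2 * M * (L * (2 * n) + 2 * M + 2) + L * (2 * n) + 2 * M + 2 < N)
    {c : P × ZMod (2 * n)} {η : ℤ} (hη : η = 1 ∨ η = -1) {ε : Option (ZMod (2 * n)) → ℤ}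
    (hε : ∀ x, |ε x| ≤ 2)
    (hD : ∀ x, (N : ℤ) ∣ D τ c x - (η * L * lap n x + ε x)) :
    0 < τ ∧ β^[τ] c ∈ Cyclic mst := by
  have hn : 0 < n := Nat.pos_of_ne_zero (NeZero.ne n)
  have hLn : L ≤ L * (2 * n) := Nat.le_mul_of_pos_right _ (by omega)
  -- A short walk cannot have a displacement as large as `L`.
  have hτ : M < τ := by
    by_contra hle
    have h1 := abs_le.1 ((abs_displacement_le (mst := mst) τ c none).trans
      (show (τ : ℤ) ≤ M by exact_mod_cast not_lt.1 hle))
    have h2 := hD none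
    have hε₀ := abs_le.1 (hε none)
    have hL' : (2 * M * (2 * M + 2) + (2 * M + 2) : ℤ) < L := by exact_mod_cast hL
    have hN' : (2 * M * (L * (2 * n) + 2 * M + 2) + L * (2 * n) + 2 * M + 2 : ℤ) < N := by
      exact_mod_cast hN
    have hLn' : (L : ℤ) ≤ L * (2 * n) := by exact_mod_cast hLn
    have hpos : (0 : ℤ) ≤ 2 * M * (2 * M + 2) := by positivity
    have hpos' : (0 : ℤ) ≤ 2 * M * (L * (2 * n) + 2 * M + 2) := by positivity
    simp only [lap] at h2
    have := Int.eq_zero_of_abs_lt_dvd h2 (abs_lt.2 (by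
      rcases hη with rfl | rfl <;> constructor <;> linarith))
    rcases hη with rfl | rfl <;> linarith
  refine ⟨by omega, ?_⟩
  obtain ⟨t, l, hl0, hl, hper⟩ := exists_iterate_period (baseStep (n := n) mst) c
  have hl : t + l ≤ M := by rw [hM]; exact hl
  -- Position in the cycle: `τ = t + r + j * l` with `r < l`.
  set r := (τ - t) % l with hr
  set j := (τ - t) / l with hj
  have hrl : r < l := Nat.mod_lt _ hl0
  have hτ' : τ = (t + r) + j * l := by
    have := Nat.mod_add_div (τ - t) l
    rw [← hr, ← hj, Nat.mul_comm l j] at this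
    omega
  have hper' : β^[l] (β^[t + r] c) = β^[t + r] c := by
    rw [Nat.add_comm t r, Function.iterate_add_apply, ← Function.iterate_add_apply _ l r,
      Nat.add_comm l r, Function.iterate_add_apply, hper]
  have hcτ : β^[τ] c = β^[t + r] c := by
    rw [hτ', Nat.add_comm, Function.iterate_add_apply, iterate_mul_period hper']
  rw [hcτ]
  refine mem_cyclic_of_period (M := M) (N := N) (L := L) (η := η) (j := j)
    (ε := fun x => ε x - D (t + r) c x) hL (by omega) hl0 (by omega) hper' hη ?_ ?_
  · intro x
    refine (abs_sub _ _).trans ?_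
    have h1 := abs_displacement_le (mst := mst) (t + r) c x
    have h2 : ((t + r : ℕ) : ℤ) ≤ 2 * M := by exact_mod_cast (by omega : t + r ≤ 2 * M)
    linarith [hε x]
  · intro x
    have := hD x
    rw [hτ', displacement_add, displacement_mul_period hper'] at this
    convert this using 1
    ring

end Region

open Dr

/-! ### Positions of a device walking over cells -/

section Positions

variable {P : Type*} {n N : ℕ}

/-- The positions in a large array of cells: the base modulo `2n`, and step counters
modulo `N`. -/
abbrev Pos (n N : ℕ) : Type := ZMod (2 * n) × (Option (ZMod (2 * n)) → ZMod N)

/-- The position after a move. -/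
def Pos.move (d : Option (Bool × Bool)) (p : Pos n N) : Pos n N :=
  (p.1 + sh d, fun x => p.2 x + (disp d p.1 x : ZMod N))

theorem Pos.move_none (p : Pos n N) : p.move none = p := by
  simp [Pos.move, sh, disp]

theorem Pos.move_opp (y s : Bool) (p : Pos n N) :
    (p.move (some (y, s))).move (some (y, !s)) = p := by
  refine Prod.ext ?_ (funext fun x => ?_)
  · rcases s with _ | _ <;> simp [Pos.move, sh]
  · simp [Pos.move, disp_opp]

variable (mst : P → P × Option (Bool × Bool))

/-- One move of a device over the cells. -/
def posStep (c : P × Pos n N) : P × Pos n N := ((mst c.1).1, c.2.move (mst c.1).2)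

theorem posStep_iterate (t : ℕ) (s : P) (p : Pos n N) :
    (posStep mst)^[t] (s, p) = (((baseStep mst)^[t] (s, p.1)).1, ((baseStep mst)^[t] (s, p.1)).2,
      fun x => p.2 x + (displacement mst t (s, p.1) x : ZMod N)) := by
  induction t generalizing s p with
  | zero => simp [displacement]
  | succ t ih =>
    rw [Function.iterate_succ_apply, Function.iterate_succ_apply]
    unfold posStep at ih ⊢
    rw [ih]
    simp only [Pos.move, displacement, baseStep]
    refine Prod.ext rfl (Prod.ext rfl (funext fun x => ?_))
    push_cast
    ring

/-- The configurations over the cells that a device may attain after leaving the cell `x` by a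
proper move. -/
def Reached (x : Pos n N) (c : P × Pos n N) : Prop :=
  ∃ s d t, (posStep mst)^[t] (s, x.move (some d)) = c

variable {mst}

theorem Reached.of_move (x : Pos n N) (s : P) (d : Bool × Bool) :
    Reached mst x (s, x.move (some d)) := ⟨s, d, 0, rfl⟩

theorem Reached.next {x : Pos n N} {c : P × Pos n N} (h : Reached mst x c) :
    Reached mst x (posStep mst c) := by
  obtain ⟨s, d, t, rfl⟩ := h
  exact ⟨s, d, t + 1, Function.iterate_succ_apply' _ _ _⟩

/-- The position of the entrance to a large array of cells. -/
def entrance (κ : ZMod (2 * n)) (N : ℕ) : Pos n N := (κ, 0)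

/-- The position of the far end of the array, `L` laps away from the entrance. -/
def farEnd (κ : ZMod (2 * n)) (L N : ℕ) : Pos n N := (κ, fun x => ((L * lap n x : ℤ) : ZMod N))

/-- The numbers `L` and `N` are large for a device with state set `P`. -/
def Large (P : Type*) [Fintype P] (n : ℕ) [NeZero n] (L N : ℕ) : Prop :=
  2 * baseCard P n * (2 * baseCard P n + 2) + (2 * baseCard P n + 2) < L ∧
    2 * baseCard P n * (L * (2 * n) + 2 * baseCard P n + 2) + L * (2 * n) +
      2 * baseCard P n + 2 < N

/-- The positions `x` and `y` are the two ends of the array of cells, in some order. -/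
def Ends (κ : ZMod (2 * n)) (L N : ℕ) (x y : Pos n N) : Prop :=
  (x = entrance κ N ∧ y = farEnd κ L N) ∨ (x = farEnd κ L N ∧ y = entrance κ N)

variable [NeZero n] [Fintype P] {κ : ZMod (2 * n)} {L : ℕ} {x y : Pos n N}

/-- A device that comes from one end of the array to a position next to the other end is in a cyclic
state there. The first move and the missing last one are the error terms in
`mem_cyclic_of_displacement`. -/
theorem cyclic_of_close (hLN : Large P n L N) (hxy : Ends κ L N x y) {d : Bool × Bool} {t : ℕ}
    {s s' : P} {p : Pos n N} (h : (posStep mst)^[t] (s, x.move (some d)) = (s', p))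
    {δ : Option (ZMod (2 * n)) → ℤ} (hδ : ∀ z, |δ z| ≤ 1)
    (hp : ∀ z, y.2 z = p.2 z + (δ z : ZMod N)) : 0 < t ∧ (s', p.1) ∈ Cyclic mst := by
  rw [posStep_iterate] at h
  have h1 : ((baseStep mst)^[t] (s, (x.move (some d)).1)) = (s', p.1) := by
    have h2 := congrArg Prod.fst h
    have h3 := congrArg (fun c => c.2.1) h
    exact Prod.ext h2 h3
  have h4 : ∀ z, p.2 z = x.2 z + (disp (some d) x.1 z : ZMod N) +
      (displacement mst t (s, (x.move (some d)).1) z : ZMod N) :=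
    fun z => (congrFun (congrArg (fun c => c.2.2) h) z).symm
  rw [← h1]
  obtain ⟨η, hη, hηd⟩ : ∃ η : ℤ, (η = 1 ∨ η = -1) ∧
      ∀ z, y.2 z = x.2 z + ((η * L * lap n z : ℤ) : ZMod N) := by
    rcases hxy with ⟨rfl, rfl⟩ | ⟨rfl, rfl⟩
    · exact ⟨1, Or.inl rfl, fun z => by simp [entrance, farEnd]⟩
    · exact ⟨-1, Or.inr rfl, fun z => by simp [entrance, farEnd]⟩
  refine mem_cyclic_of_displacement rfl hLN.1 hLN.2 hη
    (ε := fun z => - disp (some d) x.1 z - δ z) ?_ ?_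
  · intro z
    refine (abs_sub _ _).trans ?_
    rw [abs_neg]
    have := abs_disp_le (some d) x.1 z
    linarith [hδ z]
  · intro z
    rw [← ZMod.intCast_eq_intCast_iff_dvd_sub]
    have h5 := hp z
    rw [h4, hηd] at h5
    push_cast at h5 ⊢
    linear_combination h5

/-- A device that walks from one end of the array to the other is in a cyclic state there. -/
theorem Reached.cyclic (hLN : Large P n L N) (hxy : Ends κ L N x y) {s : P}
    (h : Reached mst x (s, y)) : (s, y.1) ∈ Cyclic mst := by
  obtain ⟨s₁, d, t, h⟩ := h
  exact (cyclic_of_close hLN hxy h (δ := 0) (by simp) (by simp)).2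

/-- The two ends of the array are not adjacent. -/
theorem Ends.ne_move (hLN : Large P n L N) (hxy : Ends κ L N x y) (d : Bool × Bool) [Nonempty P] :
    x.move (some d) ≠ y := by
  intro h
  obtain ⟨s⟩ := ‹Nonempty P›
  have := (cyclic_of_close (P := P) (mst := fun s => (s, none)) hLN hxy (t := 0) (s := s) (s' := s)
    (p := y) (d := d) (by rw [h]; rfl) (δ := 0) (by simp) (by simp)).1
  omega

/-- A device that arrives at one end of the array coming from the other end does so in an
arrival state. -/
theorem Reached.arrival (hLN : Large P n L N) (hxy : Ends κ L N x y) {s : P} {p : Pos n N}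
    (h : Reached mst x (s, p)) {d : Bool × Bool} (hd : (mst s).2 = some d)
    (hp : p.move (some d) = y) : (mst s).1 ∈ Arrivals mst κ := by
  have hy : y.1 = κ := by rcases hxy with ⟨rfl, rfl⟩ | ⟨rfl, rfl⟩ <;> rfl
  have h1 := h.next
  have hstep : posStep mst (s, p) = ((mst s).1, y) := by
    unfold posStep
    simp only
    rw [hd, hp]
  rw [hstep] at h1
  have h2 := h1.cyclic hLN hxy
  rw [hy] at h2
  refine ⟨(s, p.1), ?_, by simp [hd], ?_, h2⟩
  · obtain ⟨s₁, d₁, t, h⟩ := h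
    refine (cyclic_of_close hLN hxy h (δ := disp (some d) p.1) (abs_disp_le _ _) ?_).2
    intro z
    rw [← hp]
    rfl
  · unfold baseStep
    simp only
    rw [hd, ← hy, ← hp]
    rfl

end Positions

/-! ### The diodes -/

/-- The parameters of a diode: an array of cells with modulus `N` and two distinguished cells,
the entrance at the base `base` and the far end, `L` laps away, both with an external edge in the
direction `l`. If `guarded` is false, then the entrance looks like every other cell; the automaton
then has to leave the entrance along the axis `a`, which `base_lt` ensures. -/
structure Spec (n K : ℕ) where
  base : ZMod (2 * n)
  l : Fin K
  guarded : Bool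
  L : ℕ
  N : ℕ
  L_pos : 0 < L
  lt_N : L * (2 * n) < N
  base_lt : guarded = false → base.val < n

variable {n K : ℕ}

namespace Spec

variable (σ : Spec n K)

instance : NeZero σ.N := ⟨(Nat.pos_of_ne_zero (fun h => by have := σ.lt_N; omega)).ne'⟩

/-- The number of nodes before the gate that count the state up to the phase of the base. -/
def q : ℕ := σ.base.val % n

/-- The entrance. -/
def E : Pos n σ.N := entrance σ.base σ.N

/-- The far end. -/
def R : Pos n σ.N := farEnd σ.base σ.L σ.N

theorem ne [NeZero n] : σ.E ≠ σ.R := by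
  intro h
  have h1 : (0 : ZMod σ.N) = ((σ.L * lap n none : ℤ) : ZMod σ.N) :=
    congrFun (congrArg Prod.snd h) none
  have h2 : ((σ.L * (2 * n) : ℕ) : ZMod σ.N) = 0 := by
    rw [h1]; simp [lap]
  rw [ZMod.natCast_eq_zero_iff] at h2
  have hn : 0 < n := Nat.pos_of_ne_zero (NeZero.ne n)
  have := Nat.le_of_dvd (Nat.mul_pos σ.L_pos (by omega)) h2
  have := σ.lt_N
  omega

end Spec

/-- The nodes of a diode: a path of `q + 1` nodes leading to the gate, the cells, and a leaf at
every cell in each of the directions that are their own opposites. The gate is the leaf of the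
entrance in the direction `l`. -/
inductive UNd (σ : Spec n K)
  | lead (j : Fin (σ.q + 1))
  | ring (p : Pos n σ.N)
  | leaf (p : Pos n σ.N) (l : Fin K)

namespace UNd

variable {σ : Spec n K}

noncomputable instance [NeZero n] : Fintype (UNd σ) :=
  Fintype.ofInjective (β := Fin (σ.q + 1) ⊕ Pos n σ.N ⊕ (Pos n σ.N × Fin K))
    (fun u => match u with
      | lead j => .inl j
      | ring p => .inr (.inl p)
      | leaf p l => .inr (.inr (p, l)))
    (by rintro (j | p | ⟨p, l⟩) (j' | p' | ⟨p', l'⟩) h <;> simp_all)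

open Classical in
/-- The edges inside a diode. -/
noncomputable def step : UNd σ → Dr K → Option (UNd σ)
  | lead j, d =>
    if d = fa then some (if h : j.val + 1 < σ.q + 1 then lead ⟨j + 1, h⟩ else leaf σ.E σ.l)
    else if d = ba then
      if j.val = 0 then none else some (lead ⟨j - 1, by omega⟩)
    else none
  | ring p, .inl d => some (ring (p.move (some d)))
  | ring p, .inr l => some (leaf p l)
  | leaf p l, d =>
    if d = .inr l then some (ring p)
    else if d = ba ∧ p = σ.E ∧ l = σ.l then some (lead (Fin.last _)) else none

/-- The label of the cells. -/
def cellLab : Lab K := ⟨.cell, fa, fa, fa, fa⟩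

/-- The label of a node of degree one. -/
def deadLab (d : Dr K) : Lab K := ⟨.dead, d, d, d, d⟩

/-- The direction in which the automaton leaves the entrance. -/
def outDir (i : ZMod (2 * n)) : Dr K := .inl (decide (n ≤ i.val), true)

open Classical in
/-- The labels in a diode whose first node is labelled `st` and whose last node, the leaf of the
far end in the direction `l`, is labelled `rt`. -/
noncomputable def label (st rt : Lab K) : UNd σ → Lab K
  | lead j => if j.val = 0 then st else ⟨.inc, ba, ba, fa, fa⟩
  | ring p =>
    if p = σ.E then if σ.guarded then ⟨.ent, fa, fa, fa, outDir σ.base⟩ else cellLab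
    else if p = σ.R then ⟨.rho, fa, fa, fa, .inr σ.l⟩ else cellLab
  | leaf p l =>
    if p = σ.E ∧ l = σ.l then ⟨.mv, ba, ba, .inr l, .inr l⟩
    else if p = σ.R ∧ l = σ.l then rt else deadLab (.inr l)

variable (σ) in
/-- The first node of a diode. -/
def start : UNd σ := lead 0

variable (σ) in
/-- The last node of a diode. -/
def finish : UNd σ := leaf σ.R σ.l

theorem step_opp {u u' : UNd σ} {d : Dr K} (h : u.step d = some u') :
    u'.step (opp d) = some u := by
  rcases u with j | p | ⟨p, l⟩
  · simp only [step] at h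
    split_ifs at h with h1 h2 h3
    · cases h; simp [step, h1]
    · cases h
      have : j = Fin.last _ := Fin.ext (by simp; omega)
      simp [step, h1, this]
    · cases h
      have : j.val - 1 + 1 < σ.q + 1 := by omega
      have h4 : j.val - 1 + 1 = j.val := by omega
      subst h3
      have h5 : j.val ≤ σ.q := by omega
      simp [step, h4, h5]
  · rcases d with ⟨y, s⟩ | l
    · cases h
      simp [step, Pos.move_opp]
    · cases h
      simp [step]
  · simp only [step] at h
    split_ifs at h with h1 h2
    · cases h; subst h1; simp [step]
    · cases h
      obtain ⟨rfl, rfl, rfl⟩ := h2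
      simp [step]

/-- The edges of a diode are those prescribed by the labels, if its first and last node are taken to
have no external edges. -/
theorem step_isSome_iff [NeZero n] {u : UNd σ} {d : Dr K} :
    (u.step d).isSome ↔ d ∈ (u.label (deadLab fa) (deadLab (.inr σ.l))).dirs := by
  rcases u with j | p | ⟨p, l⟩
  · simp only [step, label]
    split_ifs <;> simp_all [Lab.dirs, deadLab]
  · have : d ∈ ((ring p : UNd σ).label (deadLab fa) (deadLab (.inr σ.l))).dirs := by
      simp only [label]
      split_ifs <;> simp [Lab.dirs, cellLab]
    simp only [this, iff_true]
    rcases d with ⟨y, s⟩ | l <;> rfl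
  · simp only [step, label]
    by_cases h1 : p = σ.E ∧ l = σ.l
    · simp only [h1, and_self, if_true, and_true]
      split_ifs <;> simp_all [Lab.dirs]
    · simp only [h1, and_false, if_false]
      split_ifs <;> simp_all [Lab.dirs, deadLab]

theorem label_congr {st rt st' rt' : Lab K} {u : UNd σ} (h1 : u ≠ start σ) (h2 : u ≠ finish σ) :
    u.label st rt = u.label st' rt' := by
  rcases u with j | p | ⟨p, l⟩
  · have : j.val ≠ 0 := fun h => h1 (congrArg lead (Fin.ext h))
    simp [label, this]
  · rfl
  · have : ¬ (p = σ.R ∧ l = σ.l) := by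
      rintro ⟨rfl, rfl⟩
      exact h2 rfl
    simp [label, this]

end UNd

open Dr

/-! ### Automata in diodes -/

section Diodes

variable {n K : ℕ} {σ : Spec n K} (B : Automaton (sig K))

/-- The moves of an automaton over the cells, where a detour to a leaf counts as no move. An
automaton that halts is regarded as staying in the same state forever. -/
def walk (s : B.Q) : B.Q × Option (Bool × Bool) :=
  match B.δ s UNd.cellLab with
  | none => (s, none)
  | some (s', .inl d) => (s', some d)
  | some (s', .inr l) =>
    match B.δ s' (UNd.deadLab (.inr l)) with
    | none => (s, none)
    | some (s'', _) => (s'', none)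

/-- The leaf that an automaton visits from a cell in the state `s`, if any. -/
def visit (s : B.Q) : Option (Fin K) :=
  match B.δ s UNd.cellLab with
  | some (_, .inr l) => some l
  | _ => none

variable {B}

theorem walk_of_visit {s : B.Q} {l : Fin K} (h : visit B s = some l) : (walk B s).2 = none := by
  unfold visit at h
  unfold walk
  split at h
  · rename_i s' l' hδ
    rw [hδ]
    simp only
    split <;> rfl
  · cases h

theorem walk_of_move {s s' : B.Q} {d : Bool × Bool} (h : B.δ s UNd.cellLab = some (s', .inl d)) :
    walk B s = (s', some d) := by
  unfold walk
  rw [h]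

theorem walk_of_leaf {s s' s'' : B.Q} {l : Fin K} {d : Dr K}
    (h : B.δ s UNd.cellLab = some (s', .inr l))
    (h' : B.δ s' (UNd.deadLab (.inr l)) = some (s'', d)) : walk B s = (s'', none) := by
  unfold walk
  rw [h]
  simp only
  rw [h']

theorem visit_of_leaf {s s' : B.Q} {l : Fin K}
    (h : B.δ s UNd.cellLab = some (s', .inr l)) : visit B s = some l := by
  unfold visit
  rw [h]

/-- A configuration in a leaf that is attained by walking over the cells from `x`. -/
def ReachedLeaf (B : Automaton (sig K)) (x : Pos n σ.N) (s : B.Q) (p : Pos n σ.N) (l : Fin K) :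
    Prop :=
  ∃ s₀, Reached (walk B) x (s₀, p) ∧ B.δ s₀ UNd.cellLab = some (s, .inr l)

/-- The configurations on one side of a diode: those in the parts of the diode that are
attached to its end `x`, and those attained by walking over the cells from `x` before
reaching the other end `y`. -/
def Side (B : Automaton (sig K)) (x y : Pos n σ.N) : Set (B.Q × UNd σ) :=
  {c | match c.2 with
    | .lead _ => x = σ.E
    | .ring p => p = x ∨ (p ≠ y ∧ Reached (walk B) x (c.1, p))
    | .leaf p l => p = x ∨ (p ≠ y ∧ ReachedLeaf B x c.1 p l)}

/-- The configurations in a diode with unguarded entrance that are attained from its far end. -/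
def Closed (B : Automaton (sig K)) : Set (B.Q × UNd σ) :=
  {c | match c.2 with
    | .lead _ => False
    | .ring p => p = σ.R ∨ Reached (walk B) σ.R (c.1, p)
    | .leaf p l => ¬ (p = σ.E ∧ l = σ.l) ∧ (p = σ.R ∨ ReachedLeaf B σ.R c.1 p l)}

variable {st rt : Lab K}

theorem label_ring {p : Pos n σ.N} (hE : p ≠ σ.E) (hR : p ≠ σ.R) :
    UNd.label st rt (.ring p) = UNd.cellLab := by
  simp [UNd.label, hE, hR]

variable [NeZero n] {x y : Pos n σ.N}

/-- A side of a diode is left only over the other end, in an arrival state. -/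
theorem Side.step (hLN : Large B.Q n σ.L σ.N) (hxy : Ends σ.base σ.L σ.N x y)
    {c : B.Q × UNd σ} (hc : c ∈ Side B x y) {s' : B.Q} {d : Dr K}
    (hδ : B.δ c.1 (c.2.label st rt) = some (s', d)) {u' : UNd σ} (hu : c.2.step d = some u') :
    (s', u') ∈ Side B x y ∨ (u' = .ring y ∧ s' ∈ Arrivals (walk B) σ.base) := by
  have hne : Nonempty B.Q := ⟨B.q0⟩
  have hxy' : ∀ p : Pos n σ.N, p ≠ x → p ≠ y → p ≠ σ.E ∧ p ≠ σ.R := by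
    rintro p h1 h2
    rcases hxy with ⟨rfl, rfl⟩ | ⟨rfl, rfl⟩
    · exact ⟨h1, h2⟩
    · exact ⟨h2, h1⟩
  obtain ⟨s, u⟩ := c
  rcases u with j | p | ⟨p, l⟩
  · have hx : x = σ.E := hc
    left
    simp only [UNd.step] at hu
    split_ifs at hu with h1 h2 h3 h4
    · cases hu; exact hx
    · cases hu; exact Or.inl hx.symm
    · cases hu; exact hx
  · rcases d with d | l
    · cases hu
      by_cases hpx : p = x
      · subst hpx
        exact Or.inl (Or.inr ⟨hxy.ne_move hLN d, .of_move _ _ _⟩)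
      · obtain ⟨hpy, hr⟩ :=
          (show p = x ∨ (p ≠ y ∧ Reached (walk B) x (s, p)) from hc).resolve_left hpx
        obtain ⟨hE, hR⟩ := hxy' p hpx hpy
        simp only [label_ring hE hR] at hδ
        have hw := walk_of_move hδ
        by_cases hy : p.move (some d) = y
        · right
          refine ⟨by rw [hy], ?_⟩
          have := hr.arrival hLN hxy (by rw [hw]) hy
          rwa [hw] at this
        · left
          refine Or.inr ⟨hy, ?_⟩
          have := hr.next
          unfold posStep at this
          simp only at this
          rwa [hw] at this
    · cases hu
      left
      by_cases hpx : p = x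
      · exact Or.inl hpx
      · obtain ⟨hpy, hr⟩ :=
          (show p = x ∨ (p ≠ y ∧ Reached (walk B) x (s, p)) from hc).resolve_left hpx
        obtain ⟨hE, hR⟩ := hxy' p hpx hpy
        simp only [label_ring hE hR] at hδ
        exact Or.inr ⟨hpy, s, hr, hδ⟩
  · left
    by_cases hpx : p = x
    · simp only [UNd.step] at hu
      split_ifs at hu with h1 h2
      · cases hu; exact Or.inl hpx
      · cases hu
        exact hpx.symm.trans h2.2.1
    · obtain ⟨hpy, s₀, hr, hs₀⟩ :=
        (show p = x ∨ (p ≠ y ∧ ReachedLeaf B x s p l) from hc).resolve_left hpx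
      obtain ⟨hE, hR⟩ := hxy' p hpx hpy
      simp only [UNd.step, hE, false_and, and_false, if_false] at hu
      split_ifs at hu with h1
      cases hu
      simp only [UNd.label, hE, hR, false_and, if_false] at hδ
      refine Or.inr ⟨hpy, ?_⟩
      have := hr.next
      unfold posStep at this
      simp only at this
      rwa [walk_of_leaf hs₀ hδ, Pos.move_none] at this

/-- In a diode with unguarded entrance, an automaton that does not use the direction of the gate
in the cyclic states of the base of the entrance never reaches the gate from the far end. -/
theorem Closed.step (hLN : Large B.Q n σ.L σ.N) (hg : σ.guarded = false)
    (hl : ∀ s, (s, σ.base) ∈ Cyclic (walk B) → visit B s ≠ some σ.l)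
    {c : B.Q × UNd σ} (hc : c ∈ Closed B) {s' : B.Q} {d : Dr K}
    (hδ : B.δ c.1 (c.2.label st rt) = some (s', d)) {u' : UNd σ} (hu : c.2.step d = some u') :
    (s', u') ∈ Closed B := by
  have hcell : ∀ p, p ≠ σ.R → UNd.label st rt (.ring p) = UNd.cellLab := by
    intro p hp
    simp [UNd.label, hp, hg]
  obtain ⟨s, u⟩ := c
  rcases u with j | p | ⟨p, l⟩
  · exact hc.elim
  · have hc : p = σ.R ∨ Reached (walk B) σ.R (s, p) := hc
    rcases d with d | l
    · cases hu
      by_cases hpx : p = σ.R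
      · subst hpx
        exact Or.inr (.of_move _ _ _)
      · have hr := hc.resolve_left hpx
        simp only [hcell p hpx] at hδ
        refine Or.inr ?_
        have := hr.next
        unfold posStep at this
        simp only at this
        rwa [walk_of_move hδ] at this
    · cases hu
      by_cases hpx : p = σ.R
      · refine ⟨?_, Or.inl hpx⟩
        rintro ⟨h, -⟩
        exact σ.ne (h.symm.trans hpx)
      · have hr := hc.resolve_left hpx
        simp only [hcell p hpx] at hδ
        refine ⟨?_, Or.inr ⟨s, hr, hδ⟩⟩
        rintro ⟨rfl, rfl⟩
        exact hl s (hr.cyclic hLN (Or.inr ⟨rfl, rfl⟩)) (visit_of_leaf hδ)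
  · obtain ⟨hgate, hc⟩ : ¬ (p = σ.E ∧ l = σ.l) ∧ (p = σ.R ∨ ReachedLeaf B σ.R s p l) := hc
    simp only [UNd.step, hgate, and_false, if_false] at hu
    split_ifs at hu with h1
    cases hu
    by_cases hpx : p = σ.R
    · exact Or.inl hpx
    · obtain ⟨s₀, hr, hs₀⟩ := hc.resolve_left hpx
      simp only [UNd.label, hgate, hpx, false_and, if_false] at hδ
      refine Or.inr ?_
      have := hr.next
      unfold posStep at this
      simp only at this
      rwa [walk_of_leaf hs₀ hδ, Pos.move_none] at this

end Diodes

open Dr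

/-! ### The test graphs -/

section TestGraphs

variable {n K : ℕ} {σ : Spec n K}

theorem UNd.start_ne_finish : UNd.start σ ≠ UNd.finish σ := by
  intro h; cases h

/-- The edges prescribed by the labels of a diode whose first and last node have the labels `st` and
`rt`: those inside the diode, and those at its first and last node. -/
theorem UNd.mem_dirs_label [NeZero n] {st rt : Lab K} (hst : fa ∈ st.dirs)
    (hrt : .inr σ.l ∈ rt.dirs) {u : UNd σ} {x : Dr K} :
    x ∈ (u.label st rt).dirs ↔ (u.step x).isSome ∨ (u = start σ ∧ x ∈ st.dirs) ∨
      (u = finish σ ∧ x ∈ rt.dirs) := by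
  rw [UNd.step_isSome_iff]
  by_cases h1 : u = start σ
  · subst h1
    have : ∀ st rt, (start σ).label st rt = st := fun st rt => by simp [start, label]
    simp only [this, start_ne_finish, false_and, true_and, or_false]
    constructor
    · exact Or.inr
    · rintro (h | h)
      · rcases h with h | h | h | h | h | h | h <;>
          first | (simp [deadLab] at h; done) | (rw [h]; exact hst)
      · exact h
  by_cases h2 : u = finish σ
  · subst h2
    have : ∀ st rt, (finish σ).label st rt = rt := fun st rt => by
      simp [finish, label, σ.ne.symm]
    simp only [this, h1, false_and, true_and, false_or]
    constructor
    · exact Or.inr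
    · rintro (h | h)
      · rcases h with h | h | h | h | h | h | h <;>
          first | (simp [deadLab] at h; done) | (rw [h]; exact hrt)
      · exact h
  rw [UNd.label_congr (st' := deadLab fa) (rt' := deadLab (.inr σ.l)) h1 h2]
  simp [h1, h2]

theorem UNd.label_start (st rt : Lab K) : (start σ).label st rt = st := by simp [start, label]

theorem UNd.label_finish [NeZero n] (st rt : Lab K) : (finish σ).label st rt = rt := by
  simp [finish, label, σ.ne.symm]

theorem UNd.step_finish [NeZero n] {x : Dr K} (hx : x ≠ .inr σ.l) : (finish σ).step x = none := by
  simp [finish, step, hx, σ.ne.symm]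

theorem UNd.step_start {x : Dr K} (hx : x ≠ fa) : (start σ).step x = none := by
  simp [start, step, hx]

theorem UNd.label_tag_ne_init {st rt : Lab K} {u : UNd σ} (h1 : u ≠ start σ)
    (h2 : u ≠ finish σ) : (u.label st rt).tag ≠ .init := by
  rcases u with j | p | ⟨p, l⟩
  · have : j.val ≠ 0 := fun h => h1 (congrArg UNd.lead (Fin.ext h))
    simp [label, this]
  · simp only [label]
    split_ifs <;> simp [cellLab]
  · have : ¬ (p = σ.R ∧ l = σ.l) := by
      rintro ⟨rfl, rfl⟩
      exact h2 rfl
    simp only [label, if_neg this]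
    split_ifs <;> simp [deadLab]

/-- For any four directions there is a further one that is its own opposite. -/
theorem exists_avoid (hK : 5 ≤ K) (d : Fin 4 → Dr K) : ∃ l : Fin K, ∀ i, d i ≠ .inr l := by
  by_contra h
  push Not at h
  choose f hf using h
  have : Function.Injective f := by
    intro l l' h
    have h1 := hf l
    rw [h, hf l'] at h1
    exact (Sum.inr.inj h1).symm
  have := Fintype.card_le_of_injective f this
  simp at this
  omega

/-- The nodes of an arm of a test graph: `n` diodes, called teeth, whose last nodes form a path,
and a joint after this path. -/
inductive ANd (σ : Spec n K)
  | tooth (t : Fin n) (u : UNd σ)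
  | joint

noncomputable instance [NeZero n] : Fintype (ANd σ) :=
  Fintype.ofInjective (β := Option (Fin n × UNd σ))
    (fun u => match u with
      | .tooth t u => some (t, u)
      | .joint => none)
    (by rintro (⟨t, u⟩ | _) (⟨t', u'⟩ | _) h <;> simp_all)

/-- The data of the arms: an arm ends in the direction `-d`, and its joint is attached to the path
in the direction `j d`. -/
structure Joints (σ : Spec n K) where
  j : Dr K → Fin K
  ne_l : ∀ d, j d ≠ σ.l
  ne_opp : ∀ d, opp d ≠ .inr (j d)

theorem exists_joints (hK : 5 ≤ K) (σ : Spec n K) : Nonempty (Joints σ) := by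
  have h : ∀ d : Dr K, ∃ l : Fin K, l ≠ σ.l ∧ opp d ≠ .inr l := by
    intro d
    obtain ⟨l, hl⟩ := exists_avoid hK ![opp d, .inr σ.l, .inr σ.l, .inr σ.l]
    refine ⟨l, ?_, hl 0⟩
    rintro rfl
    exact hl 1 rfl
  choose f hf hf' using h
  exact ⟨⟨f, hf, hf'⟩⟩

namespace ANd

variable (J : Joints σ) (d : Dr K)

/-- The edges of the path formed by the last nodes of the teeth. -/
def combStep (t : Fin n) (x : Dr K) : Option (ANd σ) :=
  if h : x = ba ∧ t.val ≠ 0 then some (tooth ⟨t - 1, by omega⟩ (.finish σ))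
  else if h : x = fa ∧ t.val + 1 < n then some (tooth ⟨t + 1, h.2⟩ (.finish σ))
  else if x = .inr (J.j d) ∧ ¬ t.val + 1 < n then some joint
  else none

open Classical in
/-- The edges of an arm; the value `some none` stands for the external edge. -/
noncomputable def step [NeZero n] : ANd σ → Dr K → Option (Option (ANd σ))
  | tooth t u, x =>
    match u.step x with
    | some u' => some (some (tooth t u'))
    | none => if u = .finish σ then (combStep J d t x).map some else none
  | joint, x =>
    if x = .inr (J.j d) then
      some (some (tooth ⟨n - 1, Nat.sub_lt (Nat.pos_of_ne_zero (NeZero.ne n)) one_pos⟩ (.finish σ)))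
    else if x = opp d then some none
    else none

/-- The labels on the path formed by the last nodes of the teeth. The automaton walks along this
path in the direction `a`, counting the nodes, and leaves it towards the joint. -/
def combLab (t : Fin n) : Lab K :=
  ⟨.inc, .inr σ.l, if t.val = 0 then .inr σ.l else ba,
    if t.val + 1 < n then fa else .inr (J.j d), if t.val + 1 < n then fa else .inr (J.j d)⟩

/-- The labels of an arm. The first node of the tooth `real`, if any, is an initial node. -/
noncomputable def label (real : Option (Fin n)) : ANd σ → Lab K
  | tooth t u =>
    u.label (if real = some t then ⟨.init, fa, fa, fa, fa⟩ else UNd.deadLab fa) (combLab J d t)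
  | joint => ⟨.mv, .inr (J.j d), .inr (J.j d), opp d, opp d⟩

variable {J d} [NeZero n]

theorem step_internal {t : Fin n} {u u' : UNd σ} {x : Dr K} (h : u.step x = some u') :
    step J d (tooth t u) x = some (some (tooth t u')) := by
  simp only [step, h]

theorem step_comb {t : Fin n} {x : Dr K} (h : x ≠ .inr σ.l) :
    step J d (tooth t (.finish σ)) x = (combStep J d t x).map some := by
  simp only [step, UNd.step_finish h, if_true]

theorem step_cases {t : Fin n} {u : UNd σ} {x : Dr K} {o : Option (ANd σ)}
    (h : step J d (tooth t u) x = some o) :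
    (∃ u', u.step x = some u' ∧ o = some (tooth t u')) ∨
      (u = .finish σ ∧ x ≠ .inr σ.l ∧ ∃ w, combStep J d t x = some w ∧ o = some w) := by
  simp only [step] at h
  cases hu : u.step x with
  | some u' =>
    rw [hu] at h
    cases h
    exact Or.inl ⟨u', rfl, rfl⟩
  | none =>
    rw [hu] at h
    simp only at h
    split_ifs at h with h1
    rw [Option.map_eq_some_iff] at h
    obtain ⟨w, hw, rfl⟩ := h
    refine Or.inr ⟨h1, ?_, w, hw, rfl⟩
    rintro rfl
    rw [h1] at hu
    simp [UNd.step, UNd.finish] at hu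

theorem step_opp {u u' : ANd σ} {x : Dr K} (h : step J d u x = some (some u')) :
    step J d u' (opp x) = some (some u) := by
  rcases u with ⟨t, u⟩ | _
  · rcases step_cases h with ⟨u', hu, h⟩ | ⟨rfl, hx, w, hw, h⟩
    · cases h
      exact step_internal (UNd.step_opp hu)
    · cases h
      have ht := t.2
      simp only [combStep] at hw
      split_ifs at hw with h1 h2 h3
      · cases hw
        rw [h1.1]
        rw [step_comb (by simp)]
        have e1 : t.val - 1 + 1 = t.val := by omega
        simp [combStep, e1]
      · cases hw
        obtain ⟨rfl, h2⟩ := h2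
        rw [step_comb (by simp)]
        simp [combStep]
      · cases hw
        rw [h3.1]
        have e1 : n - 1 = t.val := by omega
        simp [step, e1]
  · simp only [step] at h
    split_ifs at h with h1 h2 <;> cases h
    have hn := NeZero.ne n
    subst h1
    rw [step_comb (by simp [J.ne_l])]
    simp [combStep]
    omega

theorem step_eq_none_iff {u : ANd σ} {x : Dr K} :
    step J d u x = some none ↔ u = joint ∧ x = opp d := by
  constructor
  · intro h
    rcases u with ⟨t, u⟩ | _
    · rcases step_cases h with ⟨_, _, h⟩ | ⟨_, _, _, _, h⟩ <;> cases h
    · simp only [step] at h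
      split_ifs at h with h1 h2 <;> cases h
      exact ⟨rfl, h2⟩
  · rintro ⟨rfl, rfl⟩
    simp [step, J.ne_opp]

theorem step_isSome_iff {real : Option (Fin n)} {u : ANd σ} {x : Dr K} :
    (step J d u x).isSome ↔ x ∈ (label J d real u).dirs := by
  rcases u with ⟨t, u⟩ | _
  · simp only [label]
    rw [UNd.mem_dirs_label (by split_ifs <;> simp [Lab.dirs, UNd.deadLab])
      (by simp [Lab.dirs, combLab])]
    by_cases h2 : u = .finish σ
    · subst h2
      simp only [UNd.start_ne_finish.symm, false_and, false_or, true_and]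
      by_cases hx : x = .inr σ.l
      · subst hx
        have : (UNd.finish σ).step (.inr σ.l) = some (.ring σ.R) := by simp [UNd.step, UNd.finish]
        rw [step_internal this]
        simp [this]
      · rw [step_comb hx, UNd.step_finish hx]
        have hc : ((combStep J d t x).map some).isSome ↔ (x = ba ∧ ¬ t.val = 0) ∨
            (x = fa ∧ t.val + 1 < n) ∨ (x = .inr (J.j d) ∧ ¬ t.val + 1 < n) := by
          simp only [combStep]
          split_ifs <;> simp only [Option.map_some, Option.map_none, Option.isSome_some,
            Option.isSome_none, true_iff, Bool.false_eq_true, false_iff] <;> tauto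
        rw [hc]
        simp only [Lab.dirs, combLab, Set.mem_ofPred_eq, reduceCtorEq, false_or]
        split_ifs <;> tauto
    · have hu : ∀ x, (step J d (tooth t u) x).isSome ↔ (u.step x).isSome := by
        intro x
        simp only [step, h2]
        cases u.step x <;> simp
      rw [hu]
      simp only [h2, false_and, or_false]
      constructor
      · exact Or.inl
      · rintro (h | ⟨rfl, h⟩)
        · exact h
        · have : x = fa := by split_ifs at h <;> simpa [Lab.dirs, UNd.deadLab] using h
          subst this
          simp [UNd.step, UNd.start]
  · simp only [step, label]
    split_ifs <;> simp_all [Lab.dirs]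

theorem label_init_iff {real : Option (Fin n)} {u : ANd σ} :
    (label J d real u).tag = .init ↔ ∃ t, real = some t ∧ u = tooth t (.start σ) := by
  rcases u with ⟨t, u⟩ | _
  · simp only [label]
    by_cases h1 : u = .start σ
    · subst h1
      rw [UNd.label_start]
      split_ifs with h <;> simp [h, UNd.deadLab]
    by_cases h2 : u = .finish σ
    · subst h2
      rw [UNd.label_finish]
      simp [combLab, UNd.start_ne_finish.symm]
    · simp [UNd.label_tag_ne_init h1 h2, h1]
  · simp [label]

end ANd

/-- The data of a test graph apart from the place of the initial node and the marks of the exits: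
the directions of the two arms, the direction `e` in which the hub is left, the kind of the hub, and
the number `m` of nodes behind the hub that increase the state. -/
structure Frame (σ : Spec n K) extends Joints σ where
  d : Bool → Dr K
  d_ne : d false ≠ d true
  e : Fin K
  e_ne : ∀ b, d b ≠ .inr e
  kind : Tag
  kind_eq : kind = .pair ∨ kind = .mv
  m : ℕ

/-- The nodes of a test graph: two arms, the hub to which they are attached, a chain leading from
the hub to a node where the automaton branches, and two diodes at the exits. -/
inductive Nd (F : Frame σ)
  | arm (b : Bool) (u : ANd σ)
  | hub
  | chain (j : Fin (F.m + 1))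
  | exit (b : Bool) (u : UNd σ)

noncomputable instance [NeZero n] (F : Frame σ) : Fintype (Nd F) :=
  Fintype.ofInjective
    (β := (Bool × ANd σ) ⊕ Unit ⊕ Fin (F.m + 1) ⊕ (Bool × UNd σ))
    (fun u => match u with
      | .arm b u => .inl (b, u)
      | .hub => .inr (.inl ())
      | .chain j => .inr (.inr (.inl j))
      | .exit b u => .inr (.inr (.inr (b, u))))
    (by rintro (⟨b, u⟩ | _ | j | ⟨b, u⟩) (⟨b', u'⟩ | _ | j' | ⟨b', u'⟩) h <;> simp_all)

namespace Nd

variable {F : Frame σ}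

/-- The direction in which a node of the chain is joined to its predecessor. -/
def inDir (F : Frame σ) (j : Fin (F.m + 1)) : Dr K := if j.val = 0 then .inr F.e else ba

/-- The direction in which the last node of the chain is joined to an exit. -/
def toExit (b : Bool) : Dr K := .inl (true, !b)

open Classical in
/-- The edges of a test graph. -/
noncomputable def step [NeZero n] : Nd F → Dr K → Option (Nd F)
  | arm b u, x => (u.step F.toJoints (F.d b) x).map fun o => o.elim hub (arm b)
  | hub, x =>
    if x = F.d false then some (arm false .joint)
    else if x = F.d true then some (arm true .joint)
    else if x = .inr F.e then some (chain 0)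
    else none
  | chain j, x =>
    if x = inDir F j then some (if j.val = 0 then hub else chain ⟨j - 1, by omega⟩)
    else if h : j.val < F.m then if x = fa then some (chain ⟨j + 1, by omega⟩) else none
    else if x = toExit false then some (exit false (.start σ))
    else if x = toExit true then some (exit true (.start σ))
    else none
  | exit b u, x =>
    match u.step x with
    | some u' => some (exit b u')
    | none => if u = .start σ ∧ x = opp (toExit b) then some (chain (Fin.last _)) else none

/-- The labels of a test graph with the initial node at the tooth `src` and with the exits marked
by `bit`. -/
noncomputable def label (src : Bool × Fin n) (bit : Bool → Bool) : Nd F → Lab K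
  | arm b u => u.label F.toJoints (F.d b) (if src.1 = b then some src.2 else none)
  | hub => ⟨F.kind, F.d false, F.d true, .inr F.e, .inr F.e⟩
  | chain j =>
    if j.val < F.m then ⟨.inc, inDir F j, inDir F j, fa, fa⟩
    else ⟨.branch, inDir F j, inDir F j, toExit false, toExit true⟩
  | exit b u =>
    u.label ⟨.set0, opp (toExit b), opp (toExit b), fa, fa⟩
      (if bit b then ⟨.acc, .inr σ.l, .inr σ.l, .inr σ.l, .inr σ.l⟩ else UNd.deadLab (.inr σ.l))

variable [NeZero n]

theorem step_arm {b : Bool} {u u' : ANd σ} {x : Dr K}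
    (h : u.step F.toJoints (F.d b) x = some (some u')) :
    step (F := F) (arm b u) x = some (arm b u') := by
  simp [step, h]

theorem step_joint (b : Bool) : step (F := F) (arm b .joint) (opp (F.d b)) = some hub := by
  simp [step, ANd.step_eq_none_iff.2 ⟨rfl, rfl⟩]

theorem step_exit {b : Bool} {u u' : UNd σ} {x : Dr K} (h : u.step x = some u') :
    step (F := F) (exit b u) x = some (exit b u') := by
  simp [step, h]

theorem step_hub (b : Bool) : step (F := F) hub (F.d b) = some (arm b .joint) := by
  rcases b with _ | _
  · simp [step]
  · simp [step, F.d_ne.symm]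

theorem step_hub_chain : step (F := F) hub (.inr F.e) = some (chain 0) := by
  simp [step, (F.e_ne _).symm]

theorem step_start (b : Bool) :
    step (F := F) (exit b (.start σ)) (opp (toExit b)) = some (chain (Fin.last _)) := by
  simp only [step, UNd.step_start (σ := σ) (x := opp (toExit b)) (by simp [toExit])]
  simp

theorem step_last (b : Bool) :
    step (F := F) (chain (Fin.last _)) (toExit b) = some (exit b (.start σ)) := by
  have : toExit b ≠ inDir F (Fin.last _) := by
    unfold inDir toExit
    split_ifs <;> simp
  simp only [step, if_neg this]
  rcases b with _ | _ <;> simp [toExit]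

theorem step_cases {v w : Nd F} {x : Dr K} (h : step v x = some w) :
    (∃ b u u', v = arm b u ∧ u.step F.toJoints (F.d b) x = some (some u') ∧ w = arm b u') ∨
    (∃ b, v = arm b .joint ∧ x = opp (F.d b) ∧ w = hub) ∨
    (∃ b, v = hub ∧ x = F.d b ∧ w = arm b .joint) ∨
    (v = hub ∧ x = .inr F.e ∧ w = chain 0) ∨
    (v = chain 0 ∧ x = .inr F.e ∧ w = hub) ∨
    (∃ j j' : Fin (F.m + 1), j'.val = j.val + 1 ∧ v = chain j ∧ x = fa ∧ w = chain j') ∨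
    (∃ j j' : Fin (F.m + 1), j'.val = j.val + 1 ∧ v = chain j' ∧ x = ba ∧ w = chain j) ∨
    (∃ b, v = chain (Fin.last _) ∧ x = toExit b ∧ w = exit b (.start σ)) ∨
    (∃ b, v = exit b (.start σ) ∧ x = opp (toExit b) ∧ w = chain (Fin.last _)) ∨
    (∃ b u u', v = exit b u ∧ u.step x = some u' ∧ w = exit b u') := by
  rcases v with ⟨b, u⟩ | _ | j | ⟨b, u⟩
  · simp only [step, Option.map_eq_some_iff] at h
    obtain ⟨o, ho, rfl⟩ := h
    rcases o with _ | u'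
    · obtain ⟨rfl, rfl⟩ := ANd.step_eq_none_iff.1 ho
      exact Or.inr (Or.inl ⟨b, rfl, rfl, rfl⟩)
    · exact Or.inl ⟨b, u, u', rfl, ho, rfl⟩
  · simp only [step] at h
    split_ifs at h with h1 h2 h3 <;> cases h
    · exact Or.inr (Or.inr (Or.inl ⟨false, rfl, h1, rfl⟩))
    · exact Or.inr (Or.inr (Or.inl ⟨true, rfl, h2, rfl⟩))
    · exact Or.inr (Or.inr (Or.inr (Or.inl ⟨rfl, h3, rfl⟩)))
  · have hj := j.2
    simp only [step] at h
    split_ifs at h with h1 h2 h3 h4 h5 h6 <;> cases h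
    · have hj0 : j = 0 := Fin.ext h2
      refine Or.inr (Or.inr (Or.inr (Or.inr (Or.inl ⟨by rw [hj0], ?_, rfl⟩))))
      rw [h1, inDir, if_pos h2]
    · refine Or.inr (Or.inr (Or.inr (Or.inr (Or.inr (Or.inr (Or.inl
        ⟨⟨j - 1, by omega⟩, j, ?_, rfl, ?_, rfl⟩))))))
      · simp only; omega
      · rw [h1, inDir, if_neg h2]
    · exact Or.inr (Or.inr (Or.inr (Or.inr (Or.inr (Or.inl ⟨j, _, rfl, rfl, h4, rfl⟩)))))
    all_goals
      have hl : j = Fin.last _ := Fin.ext (by rw [Fin.val_last]; omega)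
      subst hl
      refine Or.inr (Or.inr (Or.inr (Or.inr (Or.inr (Or.inr (Or.inr (Or.inl ⟨_, rfl, ?_, rfl⟩)))))))
      assumption
  · simp only [step] at h
    cases hu : u.step x with
    | some u' =>
      rw [hu] at h
      cases h
      iterate 9 right
      exact ⟨b, u, u', rfl, hu, rfl⟩
    | none =>
      rw [hu] at h
      simp only at h
      split_ifs at h with h1
      cases h
      obtain ⟨rfl, rfl⟩ := h1
      iterate 8 right
      exact Or.inl ⟨b, rfl, rfl, rfl⟩

theorem step_chain_fa {j j' : Fin (F.m + 1)} (h : j'.val = j.val + 1) :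
    step (F := F) (chain j) fa = some (chain j') := by
  have h1 : (fa : Dr K) ≠ inDir F j := by unfold inDir; split_ifs <;> simp
  have h2 : j.val < F.m := by omega
  simp only [step, if_neg h1, dif_pos h2, if_true]
  exact congrArg _ (congrArg _ (Fin.ext h.symm))

theorem step_chain_ba {j j' : Fin (F.m + 1)} (h : j'.val = j.val + 1) :
    step (F := F) (chain j') ba = some (chain j) := by
  have h1 : (ba : Dr K) = inDir F j' := by unfold inDir; rw [if_neg (by omega)]
  simp only [step, if_pos h1, if_neg (show ¬ j'.val = 0 by omega)]
  exact congrArg _ (congrArg _ (Fin.ext (by simp only; omega)))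

theorem step_chain_zero : step (F := F) (chain 0) (.inr F.e) = some hub := by
  simp [step, inDir]

theorem step_opp {v w : Nd F} {x : Dr K} (h : step v x = some w) : step w (opp x) = some v := by
  rcases step_cases h with ⟨b, u, u', rfl, hu, rfl⟩ | ⟨b, rfl, rfl, rfl⟩ | ⟨b, rfl, rfl, rfl⟩ |
    ⟨rfl, rfl, rfl⟩ | ⟨rfl, rfl, rfl⟩ | ⟨j, j', hj, rfl, rfl, rfl⟩ | ⟨j, j', hj, rfl, rfl, rfl⟩ |
    ⟨b, rfl, rfl, rfl⟩ | ⟨b, rfl, rfl, rfl⟩ | ⟨b, u, u', rfl, hu, rfl⟩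
  · exact step_arm (ANd.step_opp hu)
  · rw [Dr.opp_opp]; exact step_hub b
  · exact step_joint b
  · exact step_chain_zero
  · exact step_hub_chain
  · exact step_chain_ba hj
  · exact step_chain_fa hj
  · exact step_start b
  · rw [Dr.opp_opp]; exact step_last b
  · exact step_exit (UNd.step_opp hu)

variable {src : Bool × Fin n} {bit : Bool → Bool}

theorem step_isSome_iff {v : Nd F} {x : Dr K} :
    (step v x).isSome ↔ x ∈ (label src bit v).dirs := by
  rcases v with ⟨b, u⟩ | _ | j | ⟨b, u⟩
  · simp only [step, label, Option.isSome_map]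
    exact ANd.step_isSome_iff
  · have : F.kind ≠ .cell ∧ F.kind ≠ .ent ∧ F.kind ≠ .rho := by
      rcases F.kind_eq with h | h <;> simp [h]
    simp only [step, label]
    split_ifs <;> simp_all [Lab.dirs]
  · simp only [step, label]
    by_cases h1 : x = inDir F j
    · simp only [if_pos h1]
      split_ifs <;> simp [Lab.dirs, h1]
    · simp only [if_neg h1]
      by_cases h2 : j.val < F.m
      · simp only [dif_pos h2, if_pos h2]
        split_ifs <;> simp_all [Lab.dirs]
      · simp only [dif_neg h2, if_neg h2]
        split_ifs <;> simp_all [Lab.dirs]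
  · simp only [label]
    rw [UNd.mem_dirs_label (by simp [Lab.dirs]) (by split_ifs <;> simp [Lab.dirs, UNd.deadLab])]
    by_cases h1 : u = .start σ
    · subst h1
      simp only [UNd.start_ne_finish, false_and, true_and, or_false]
      by_cases hx : x = fa
      · subst hx
        have : ((UNd.start σ).step fa).isSome := by simp [UNd.step, UNd.start]
        obtain ⟨u', hu⟩ := Option.isSome_iff_exists.1 this
        rw [step_exit hu]
        simp [this]
      · simp only [step, UNd.step_start hx, true_and]
        split_ifs <;> simp_all [Lab.dirs]
    · have hu : (step (F := F) (exit b u) x).isSome ↔ (u.step x).isSome := by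
        simp only [step, h1]
        cases u.step x <;> simp
      rw [hu]
      simp only [h1, false_and, false_or]
      constructor
      · exact Or.inl
      · rintro (h | ⟨rfl, h⟩)
        · exact h
        · have : x = .inr σ.l := by split_ifs at h <;> simpa [Lab.dirs, UNd.deadLab] using h
          subst this
          simp [UNd.step, UNd.finish]

theorem label_init_iff {v : Nd F} :
    (label src bit v).tag = .init ↔ v = arm src.1 (.tooth src.2 (.start σ)) := by
  rcases v with ⟨b, u⟩ | _ | j | ⟨b, u⟩
  · simp only [label]
    rw [ANd.label_init_iff]
    by_cases hb : src.1 = b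
    · simp [hb]
    · simp [hb, Ne.symm hb]
  · rcases F.kind_eq with h | h <;> simp [label, h]
  · simp only [label]
    split_ifs <;> simp
  · simp only [label]
    by_cases h1 : u = .start σ
    · subst h1
      rw [UNd.label_start]
      simp
    by_cases h2 : u = .finish σ
    · subst h2
      rw [UNd.label_finish]
      split_ifs <;> simp [UNd.deadLab]
    · simp [UNd.label_tag_ne_init h1 h2]

end Nd

/-- The test graph with the initial node at the tooth `src` and with the exits marked by `bit`. -/
noncomputable def Frame.graph [NeZero n] (F : Frame σ) (src : Bool × Fin n)
    (bit : Bool → Bool) : PreGraph (sig K) where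
  V := Nd F
  v0 := .arm src.1 (.tooth src.2 (.start σ))
  step := Nd.step
  label := Nd.label src bit
  step_opp _ _ _ := Nd.step_opp
  step_isSome_iff _ _ := Nd.step_isSome_iff
  label_init_iff _ := Nd.label_init_iff

end TestGraphs

open Dr

/-! ### The automaton on the test graphs -/

/-- The labels that the homomorphism leaves unchanged. -/
def Lab.Plain {K : ℕ} (a : Lab K) : Prop := a.tag ≠ .cell ∧ a.tag ≠ .pair

theorem Lab.Plain.port {K : ℕ} {a : Lab K} (h : a.Plain) (d : Dr K) : a.port d = none :=
  Lab.port_of_trivial h.1 (Lab.not_validPair h.2) d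

section AutomatonRun

variable {n K : ℕ} [NeZero n] [NeZero K] {G : PreGraph (sig K)}

/-- The automaton gets from one configuration on `h(G)` to another one. -/
def AR (n : ℕ) [NeZero n] (G : PreGraph (sig K)) (c c' : Conf n G) : Prop :=
  ∃ t, Run (autNext n G) t c c'

theorem AR.refl (c : Conf n G) : AR n G c c := ⟨0, rfl⟩

theorem AR.trans {c₁ c₂ c₃ : Conf n G} : AR n G c₁ c₂ → AR n G c₂ c₃ → AR n G c₁ c₃ := by
  rintro ⟨t, h⟩ ⟨t', h'⟩
  exact ⟨t + t', h.add h'⟩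

theorem AR.single {c c' : Conf n G} (h : autNext n G c = some c') : AR n G c c' := ⟨1, .one h⟩

/-- A step at a node that the homomorphism leaves unchanged. -/
theorem AR.plain {q q' : Fin n} {v y : G.V} {d : Dr K}
    (hp : (G.label v).Plain)
    (hδ : autδ n q (G.label v) = some (q', d)) (hy : G.step v d = some y) :
    AR n G (q, v, none) (q', y, Lab.port (G.label y) (opp d)) := by
  have h2 := Lab.not_validPair hp.2
  refine .single (autNext_external ?_ (Lab.step_of_trivial hp.1 h2 _ _) hy)
  rwa [Lab.label_of_trivial hp.1 h2]

/-- The state of the automaton in which it leaves a cell in a given phase. -/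
def phaseState (i : ZMod (2 * n)) : Fin n := Fin.ofNat n i.val

theorem ofNat_add_one (m : ℕ) : Fin.ofNat n m + 1 = Fin.ofNat n (m + 1) := by
  apply Fin.ext
  simp [Fin.val_add]

theorem val_add_one_cases (i : ZMod (2 * n)) :
    (i.val + 1 < 2 * n ∧ (i + 1).val = i.val + 1) ∨ (i.val + 1 = 2 * n ∧ (i + 1).val = 0) := by
  have hn : 0 < n := Nat.pos_of_ne_zero (NeZero.ne n)
  have hi := ZMod.val_lt i
  have h1 : (1 : ZMod (2 * n)).val = 1 := by
    have := ZMod.val_natCast_of_lt (n := 2 * n) (a := 1) (by omega)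
    simpa using this
  by_cases h : i.val + 1 < 2 * n
  · left
    refine ⟨h, ?_⟩
    rw [ZMod.val_add_of_lt, h1]
    rw [h1]; exact h
  · right
    have h2 : i.val + 1 = 2 * n := by omega
    refine ⟨h2, ?_⟩
    rw [ZMod.val_add, h1, h2, Nat.mod_self]

theorem phaseState_add_one (i : ZMod (2 * n)) : phaseState (i + 1) = phaseState i + 1 := by
  unfold phaseState
  rw [ofNat_add_one]
  rcases val_add_one_cases i with ⟨-, h⟩ | ⟨h, h'⟩
  · rw [h]
  · rw [h', h]
    apply Fin.ext
    simp

/-- The axis changes between two phases exactly if the state becomes zero in between. -/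
theorem outDir_add_one (i : ZMod (2 * n)) :
    (n ≤ (i + 1).val ↔ ¬ (n ≤ i.val ↔ phaseState i + 1 = 0)) := by
  have hn : 0 < n := Nat.pos_of_ne_zero (NeZero.ne n)
  have hi := ZMod.val_lt i
  have h0 : phaseState i + 1 = 0 ↔ i.val + 1 = n ∨ i.val + 1 = 2 * n := by
    unfold phaseState
    rw [ofNat_add_one, Fin.ext_iff]
    simp only [Fin.val_ofNat, Fin.val_zero]
    constructor
    · intro h
      obtain ⟨c, hc⟩ := Nat.dvd_of_mod_eq_zero h
      have : c < 3 := by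
        by_contra h3
        have := Nat.mul_le_mul_left n (not_lt.1 h3)
        omega
      interval_cases c
      · omega
      · left; omega
      · right; omega
    · rintro (h | h) <;> simp [h]
  rw [h0]
  rcases val_add_one_cases i with ⟨h, h'⟩ | ⟨h, h'⟩ <;> rw [h'] <;> omega

theorem cell_internal {v : G.V} (hv : G.label v = UNd.cellLab) {q q' : Fin n} {w w' d : Dr K}
    (hδ : autδ n q (cellLabel w) = some (q', d)) (hs : cellStep w d = some w') :
    AR n G (q, v, some w) (q', v, some w') := by
  refine .single (autNext_internal (d := d) ?_ ?_)
  · rw [hv]; exact hδ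
  · rw [hv]; simp [Lab.step, UNd.cellLab, hs]

theorem cell_external {v y : G.V} (hv : G.label v = UNd.cellLab) {q q' : Fin n} {d : Dr K}
    (hδ : autδ n q (cellLabel d) = some (q', d)) (hy : G.step v d = some y) :
    AR n G (q, v, some d) (q', y, Lab.port (G.label y) (opp d)) := by
  refine .single (autNext_external (d := d) ?_ ?_ hy)
  · rw [hv]; exact hδ
  · rw [hv]; simp [Lab.step, UNd.cellLab, cellStep_self]

/-- The automaton traverses the nodes of a cell with ports that are their own opposites. -/
theorem cell_chain {v : G.V} (hv : G.label v = UNd.cellLab) (q : Fin n) (l : Fin K) :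
    AR n G (q, v, some (.inr l)) (q, v, some fa) := by
  have key : ∀ m : ℕ, ∀ l : Fin K, K - 1 - l.val = m →
      AR n G (q, v, some (.inr l)) (q, v, some fa) := by
    intro m
    induction m with
    | zero =>
      intro l hl
      have hl1 : l = -1 := by
        rw [eq_neg_iff_add_eq_zero]
        apply Fin.ext
        have : (l.val + 1) = K := by omega
        rcases Nat.lt_or_ge 1 K with hK | hK
        · rw [Fin.val_add, Fin.val_one', Nat.mod_eq_of_lt hK, this]
          simp
        · have : K = 1 := by have := l.2; omega
          subst this
          simp
      exact cell_internal hv (d := fa) (w' := fa) (by simp [autδ, cellLabel])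
        (by simp [cellStep, hl1])
    | succ m ih =>
      intro l hl
      have h1 : (l + 1).val = l.val + 1 := by
        rw [Fin.val_add, Fin.val_one', Nat.mod_eq_of_lt (by omega : 1 < K), Nat.mod_eq_of_lt]
        omega
      have h2 : l ≠ -1 := by
        rw [Ne, eq_neg_iff_add_eq_zero]
        intro h
        rw [h] at h1
        simp at h1
      exact (cell_internal hv (d := fa) (w' := .inr (l + 1)) (by simp [autδ, cellLabel])
        (by simp [cellStep, h2])).trans (ih _ (by omega))
  exact key _ l rfl

theorem cell_enter {v y : G.V} (hv : G.label v = UNd.cellLab) (q : Fin n) (l : Fin K)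
    (hy : G.step v fa = some y) :
    AR n G (q, v, some (.inr l)) (q, y, Lab.port (G.label y) ba) :=
  (cell_chain hv q l).trans (cell_external hv (by simp [autδ, cellLabel]) hy)

/-- The axis of the move in a given phase. -/
def axis (i : ZMod (2 * n)) : Bool := decide (n ≤ i.val)

/-- The automaton traverses a cell. -/
theorem cell_cross {v y : G.V} (hv : G.label v = UNd.cellLab) (i : ZMod (2 * n))
    (hy : G.step v (.inl (axis (i + 1), true)) = some y) :
    AR n G (phaseState i, v, some (.inl (axis i, false)))
      (phaseState (i + 1), y, Lab.port (G.label y) (.inl (axis (i + 1), false))) := by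
  rw [phaseState_add_one]
  have hax : axis (i + 1) = (axis i ^^ decide (phaseState i + 1 = 0)) := by
    simp only [axis, outDir_add_one i]
    by_cases h1 : n ≤ i.val <;> by_cases h2 : phaseState i + 1 = 0 <;> simp [h1, h2]
  generalize axis (i + 1) = x' at *
  subst hax
  generalize axis i = x at *
  rcases x with _ | _ <;> by_cases h : phaseState i + 1 = 0
  · simp only [h, decide_true, Bool.xor_true, Bool.not_false] at hy ⊢
    exact (cell_internal hv (d := fb) (w' := fb) (q' := 0) (by simp [autδ, cellLabel, h])
      (by simp [cellStep])).trans (cell_external hv (by simp [autδ, cellLabel]) hy)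
  · simp only [h, decide_false, Bool.xor_false] at hy ⊢
    exact (cell_internal hv (d := fa) (w' := .inr 0) (q' := phaseState i + 1)
      (by simp [autδ, cellLabel, h]) (by simp [cellStep])).trans (cell_enter hv _ _ hy)
  · simp only [h, decide_true, Bool.xor_true, Bool.not_true] at hy ⊢
    exact (cell_internal hv (d := fb) (w' := .inr 0) (q' := 0)
      (by simp [autδ, cellLabel, h]) (by simp [cellStep])).trans (cell_enter hv _ _ hy)
  · simp only [h, decide_false, Bool.xor_false] at hy ⊢
    exact (cell_internal hv (d := fa) (w' := fb) (q' := phaseState i + 1)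
      (by simp [autδ, cellLabel, h]) (by simp [cellStep])).trans
      (cell_external hv (by simp [autδ, cellLabel]) hy)

end AutomatonRun

/-! ### The walk of the automaton through a diode -/

section DiodeRun

variable {n K : ℕ} (σ : Spec n K)

/-- The moves of the automaton over the cells: the state is the phase. -/
def lapWalk (i : ZMod (2 * n)) : ZMod (2 * n) × Option (Bool × Bool) :=
  (i + 1, some (axis i, true))

theorem lapWalk_iterate (t : ℕ) (i : ZMod (2 * n)) :
    (baseStep lapWalk)^[t] (i, i) = (i + t, i + t) := by
  induction t with
  | zero => simp
  | succ t ih =>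
    rw [Function.iterate_succ_apply', ih]
    simp [baseStep, lapWalk, sh, add_assoc]

theorem displacement_lapWalk (t : ℕ) (i : ZMod (2 * n)) (x : Option (ZMod (2 * n))) :
    displacement lapWalk t (i, i) x =
      ∑ r ∈ Finset.range t,
        disp (some (axis (i + (r : ZMod (2 * n))), true)) (i + (r : ZMod (2 * n))) x := by
  induction t with
  | zero => simp [displacement]
  | succ t ih =>
    rw [displacement_add, ih, lapWalk_iterate, Finset.sum_range_succ]
    simp [displacement, lapWalk]

theorem displacement_lapWalk_none (t : ℕ) (i : ZMod (2 * n)) :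
    displacement lapWalk t (i, i) none = t := by
  rw [displacement_lapWalk]
  simp [disp]

/-- The position of the automaton after `t` moves from the entrance. -/
def lapPos (t : ℕ) : Pos n σ.N := ((posStep lapWalk)^[t] (σ.base, σ.E)).2

theorem lapPos_zero : lapPos σ 0 = σ.E := rfl

theorem lapPos_iterate (t : ℕ) :
    (posStep lapWalk)^[t] (σ.base, σ.E) = (σ.base + t, lapPos σ t) := by
  refine Prod.ext ?_ rfl
  rw [posStep_iterate]
  simp only [Spec.E, entrance]
  rw [lapWalk_iterate]

theorem lapPos_succ (t : ℕ) :
    lapPos σ (t + 1) = (lapPos σ t).move (some (axis (σ.base + (t : ZMod (2 * n))), true)) := by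
  have : lapPos σ (t + 1) = (posStep lapWalk ((posStep lapWalk)^[t] (σ.base, σ.E))).2 := by
    rw [lapPos, Function.iterate_succ_apply']
  rw [this, lapPos_iterate]
  rfl

theorem lapPos_none (t : ℕ) : (lapPos σ t).2 none = t := by
  rw [lapPos, posStep_iterate]
  simp only [Spec.E, entrance]
  rw [displacement_lapWalk_none]
  simp

variable [NeZero n]

theorem displacement_lap (i : ZMod (2 * n)) (x : Option (ZMod (2 * n))) :
    displacement lapWalk (2 * n) (i, i) x = lap n x := by
  rcases x with _ | j
  · rw [displacement_lapWalk_none]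
    simp [lap]
  · rw [displacement_lapWalk]
    have : ∑ r ∈ Finset.range (2 * n),
          disp (some (axis (i + (r : ZMod (2 * n))), true)) (i + (r : ZMod (2 * n))) (some j) =
        ∑ k : ZMod (2 * n), disp (some (axis k, true)) k (some j) := by
      refine Finset.sum_bij' (fun r _ => i + (r : ZMod (2 * n))) (fun k _ => (k - i).val)
        (by simp) ?_ ?_ ?_ (by simp)
      · intro k _
        simpa using ZMod.val_lt (k - i)
      · intro r hr
        simpa using ZMod.val_cast_of_lt (Finset.mem_range.1 hr)
      · intro k _
        simp
    rw [this, Finset.sum_eq_single j]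
    · simp [disp, lap, axis]
    · intro k _ hk
      simp [disp, hk.symm]
    · simp

theorem lapPos_last : lapPos σ (σ.L * (2 * n)) = σ.R := by
  have hper : (baseStep lapWalk)^[2 * n] (σ.base, σ.base) = (σ.base, σ.base) := by
    rw [lapWalk_iterate]
    simp
  rw [lapPos, posStep_iterate]
  simp only [Spec.E, entrance]
  rw [iterate_mul_period hper]
  refine Prod.ext rfl (funext fun x => ?_)
  simp only
  rw [displacement_mul_period hper, displacement_lap]
  simp [Spec.R, farEnd]

theorem lapPos_ne {t : ℕ} (h0 : 0 < t) (ht : t < σ.L * (2 * n)) :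
    lapPos σ t ≠ σ.E ∧ lapPos σ t ≠ σ.R := by
  have hN := σ.lt_N
  have key : ∀ a b : ℕ, a < σ.N → b < σ.N → (a : ZMod σ.N) = b → a = b := by
    intro a b ha hb h
    rw [ZMod.natCast_eq_natCast_iff'] at h
    rwa [Nat.mod_eq_of_lt ha, Nat.mod_eq_of_lt hb] at h
  constructor
  · intro h
    have h1 := lapPos_none σ t
    rw [h] at h1
    have := key t 0 (by omega) (by omega) (by rw [← h1]; simp [Spec.E, entrance])
    omega
  · intro h
    have h1 := lapPos_none σ t
    rw [h, ← lapPos_last, lapPos_none] at h1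
    have := key _ _ (by omega) (by omega) h1
    omega

variable [NeZero K] {G : PreGraph (sig K)}

/-- A diode inside a graph: `emb` preserves the edges inside the diode and the labels. -/
structure DiodeIn (G : PreGraph (sig K)) (emb : UNd σ → G.V) (st rt : Lab K) : Prop where
  step : ∀ u u' d, u.step d = some u' → G.step (emb u) d = some (emb u')
  label : ∀ u, G.label (emb u) = u.label st rt

variable {σ} {emb : UNd σ → G.V} {st rt : Lab K}

theorem DiodeIn.lead (h : DiodeIn σ G emb st rt) (hst : st.Plain) {q₀ : Fin n}
    (hδ : autδ n q₀ st = some (0, fa)) (j : ℕ) (hj : j < σ.q + 1) :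
    AR n G (q₀, emb (.start σ), none) (Fin.ofNat n j, emb (if h : j + 1 < σ.q + 1 then
      .lead ⟨j + 1, h⟩ else .leaf σ.E σ.l), none) := by
  have hstep : ∀ j (hj : j < σ.q + 1), (UNd.lead ⟨j, hj⟩ : UNd σ).step fa =
      some (if h : j + 1 < σ.q + 1 then .lead ⟨j + 1, h⟩ else .leaf σ.E σ.l) := by
    intro j hj
    simp [UNd.step]
  have hport : ∀ j d, Lab.port (G.label (emb (if h : j + 1 < σ.q + 1 then
      .lead ⟨j + 1, h⟩ else .leaf σ.E σ.l))) d = none := by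
    intro j d
    rw [h.label]
    split_ifs
    · exact Lab.Plain.port (by simp [UNd.label, Lab.Plain]) d
    · exact Lab.Plain.port (by simp [UNd.label, Lab.Plain]) d
  induction j with
  | zero =>
    have hl : G.label (emb (.lead ⟨0, hj⟩)) = st := by rw [h.label]; simp [UNd.label]
    have := AR.plain (n := n) (by rw [hl]; exact hst) (by rw [hl]; exact hδ)
      (h.step _ _ _ (hstep 0 hj))
    rw [hport] at this
    exact this
  | succ j ih =>
    refine (ih (by omega)).trans ?_
    rw [dif_pos hj]
    have hl : G.label (emb (.lead ⟨j + 1, hj⟩)) = ⟨.inc, ba, ba, fa, fa⟩ := by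
      rw [h.label]; simp [UNd.label]
    have := AR.plain (n := n) (q := Fin.ofNat n j) (q' := Fin.ofNat n (j + 1)) (d := fa)
      (by rw [hl]; simp [Lab.Plain]) (by rw [hl]; simp only [autδ, ofNat_add_one])
      (h.step _ _ _ (hstep (j + 1) hj))
    rw [hport] at this
    exact this

/-- The automaton leaves the entrance in the phase of its base. -/
theorem DiodeIn.entrance (h : DiodeIn σ G emb st rt) (hst : st.Plain) {q₀ : Fin n}
    (hδ : autδ n q₀ st = some (0, fa)) :
    AR n G (q₀, emb (.start σ), none) (phaseState σ.base, emb (.ring (lapPos σ 1)),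
      Lab.port (G.label (emb (.ring (lapPos σ 1)))) (.inl (axis σ.base, false))) := by
  refine (h.lead hst hδ σ.q (by omega)).trans ?_
  rw [dif_neg (by omega)]
  have hq : Fin.ofNat n σ.q = phaseState σ.base := by
    apply Fin.ext
    simp [phaseState, Spec.q]
  rw [hq]
  have hl : G.label (emb (.leaf σ.E σ.l)) = ⟨.mv, ba, ba, .inr σ.l, .inr σ.l⟩ := by
    rw [h.label]; simp [UNd.label]
  have hs : (UNd.leaf σ.E σ.l).step (.inr σ.l) = some (.ring σ.E) := by simp [UNd.step]
  refine (AR.plain (n := n) (q' := phaseState σ.base) (d := .inr σ.l)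
    (by rw [hl]; simp [Lab.Plain]) (by rw [hl]; simp [autδ]) (h.step _ _ _ hs)).trans ?_
  have hs1 : (UNd.ring σ.E).step (.inl (axis σ.base, true)) = some (.ring (lapPos σ 1)) := by
    have := lapPos_succ σ 0
    rw [lapPos_zero] at this
    simp [UNd.step, this]
  have hs2 := h.step _ _ _ hs1
  cases hg : σ.guarded with
  | true =>
    have hl : G.label (emb (.ring σ.E)) = ⟨.ent, fa, fa, fa, .inl (axis σ.base, true)⟩ := by
      rw [h.label]; simp [UNd.label, hg, UNd.outDir, axis]
    have hp : (G.label (emb (.ring σ.E))).Plain := by rw [hl]; simp [Lab.Plain]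
    rw [hp.port]
    exact AR.plain (n := n) hp (by rw [hl]; simp [autδ]) hs2
  | false =>
    have hl : G.label (emb (.ring σ.E)) = UNd.cellLab := by
      rw [h.label]; simp [UNd.label, hg]
    have hax : axis σ.base = false := by simp [axis, σ.base_lt hg]
    rw [hax] at hs2 ⊢
    have hp : Lab.port (G.label (emb (.ring σ.E))) (opp (.inr σ.l)) = some (.inr σ.l) := by
      rw [hl]; simp [Lab.port, UNd.cellLab]
    rw [hp]
    exact cell_enter hl _ _ hs2

/-- The automaton walks over the cells of a diode in phases. -/
theorem DiodeIn.walk (h : DiodeIn σ G emb st rt) (t : ℕ) (ht : t < σ.L * (2 * n)) :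
    AR n G (phaseState σ.base, emb (.ring (lapPos σ 1)),
      Lab.port (G.label (emb (.ring (lapPos σ 1)))) (.inl (axis σ.base, false)))
      (phaseState (σ.base + (t : ZMod (2 * n))), emb (.ring (lapPos σ (t + 1))),
      Lab.port (G.label (emb (.ring (lapPos σ (t + 1)))))
        (.inl (axis (σ.base + (t : ZMod (2 * n))), false))) := by
  induction t with
  | zero => simpa using AR.refl _
  | succ t ih =>
    refine (ih (by omega)).trans ?_
    obtain ⟨hE, hR⟩ := lapPos_ne σ (t := t + 1) (by omega) ht
    have hl : G.label (emb (.ring (lapPos σ (t + 1)))) = UNd.cellLab := by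
      rw [h.label, label_ring hE hR]
    have hp : ∀ d, Lab.port (G.label (emb (.ring (lapPos σ (t + 1))))) d = some d := by
      intro d
      rw [hl]; simp [Lab.port, UNd.cellLab]
    rw [hp]
    have hs : (UNd.ring (lapPos σ (t + 1))).step
          (.inl (axis (σ.base + ((t + 1 : ℕ) : ZMod (2 * n))), true)) =
        some (.ring (lapPos σ (t + 1 + 1))) := by
      rw [lapPos_succ σ (t + 1)]
      rfl
    have he : σ.base + ((t + 1 : ℕ) : ZMod (2 * n)) = σ.base + (t : ZMod (2 * n)) + 1 := by
      push_cast; ring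
    rw [he] at hs ⊢
    exact cell_cross hl _ (h.step _ _ _ hs)

/-- The automaton traverses a diode from its first to its last node. -/
theorem DiodeIn.traverse (h : DiodeIn σ G emb st rt) (hst : st.Plain) (hrt : rt.Plain)
    {q₀ : Fin n} (hδ : autδ n q₀ st = some (0, fa)) :
    AR n G (q₀, emb (.start σ), none) (0, emb (.finish σ), none) := by
  have hn : 0 < n := Nat.pos_of_ne_zero (NeZero.ne n)
  have hL : 0 < σ.L * (2 * n) := Nat.mul_pos σ.L_pos (by omega)
  refine (h.entrance hst hδ).trans ((h.walk (σ.L * (2 * n) - 1) (by omega)).trans ?_)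
  rw [Nat.sub_add_cancel hL, lapPos_last]
  have hl : G.label (emb (.ring σ.R)) = ⟨.rho, fa, fa, fa, .inr σ.l⟩ := by
    rw [h.label]; simp [UNd.label, σ.ne.symm]
  have hp : (G.label (emb (.ring σ.R))).Plain := by rw [hl]; simp [Lab.Plain]
  rw [hp.port]
  have hs : (UNd.ring σ.R).step (.inr σ.l) = some (.finish σ) := rfl
  have hlf : G.label (emb (.finish σ)) = rt := by rw [h.label, UNd.label_finish]
  have := AR.plain (n := n) (q := phaseState (σ.base + ((σ.L * (2 * n) - 1 : ℕ) : ZMod (2 * n))))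
    (q' := 0) (d := .inr σ.l) hp (by rw [hl]; simp [autδ]) (h.step _ _ _ hs)
  rwa [hlf, hrt.port] at this

end DiodeRun

/-! ### The exit that the automaton takes -/

section Exits

variable {n K : ℕ} [NeZero n] {σ : Spec n K} (F : Frame σ) (src : Bool × Fin n)
  (bit : Bool → Bool)

theorem Frame.diode_arm (b : Bool) (t : Fin n) :
    DiodeIn σ (F.graph src bit) (fun u => Nd.arm b (.tooth t u))
      (if (if src.1 = b then some src.2 else none) = some t then ⟨.init, fa, fa, fa, fa⟩
        else UNd.deadLab fa) (ANd.combLab F.toJoints (F.d b) t) where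
  step _ _ _ h := Nd.step_arm (ANd.step_internal h)
  label _ := rfl

theorem Frame.diode_exit (b : Bool) :
    DiodeIn σ (F.graph src bit) (fun u => Nd.exit b u)
      ⟨.set0, opp (Nd.toExit b), opp (Nd.toExit b), fa, fa⟩
      (if bit b then ⟨.acc, .inr σ.l, .inr σ.l, .inr σ.l, .inr σ.l⟩
        else UNd.deadLab (.inr σ.l)) where
  step _ _ _ h := Nd.step_exit h
  label _ := rfl

variable {F src bit}

theorem Frame.plain_comb (b : Bool) (t : Fin n) : (ANd.combLab F.toJoints (F.d b) t).Plain := by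
  simp [Lab.Plain, ANd.combLab]

theorem Frame.plain_chain (j : Fin (F.m + 1)) : Lab.Plain ((F.graph src bit).label (.chain j)) := by
  change Lab.Plain (Nd.label src bit (.chain j))
  simp only [Nd.label]
  split_ifs <;> simp [Lab.Plain]

variable [NeZero K]

/-- The automaton counts the nodes of the path from the last node of a tooth to the last node of the
last tooth. -/
theorem Frame.comb (b : Bool) (m : ℕ) (t : Fin n) (ht : t.val + m + 1 = n) :
    AR n (F.graph src bit) (0, .arm b (.tooth t (.finish σ)), none)
      (Fin.ofNat n m, .arm b (.tooth ⟨t + m, by omega⟩ (.finish σ)), none) := by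
  have key : ∀ m (hm : t.val + m < n),
      AR n (F.graph src bit) (0, .arm b (.tooth t (.finish σ)), none)
        (Fin.ofNat n m, .arm b (.tooth ⟨t + m, hm⟩ (.finish σ)), none) := by
    intro m
    induction m with
    | zero => exact fun _ => AR.refl _
    | succ m ih =>
      intro hm
      have hm' : t.val + m < n := by omega
      refine (ih hm').trans ?_
      have hl : (F.graph src bit).label (.arm b (.tooth ⟨t + m, hm'⟩ (.finish σ))) =
          ANd.combLab F.toJoints (F.d b) ⟨t + m, hm'⟩ :=
        ((F.diode_arm src bit b _).label _).trans (UNd.label_finish _ _)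
      have hl' : (F.graph src bit).label (.arm b (.tooth ⟨t + (m + 1), hm⟩ (.finish σ))) =
          ANd.combLab F.toJoints (F.d b) ⟨t + (m + 1), hm⟩ :=
        ((F.diode_arm src bit b _).label _).trans (UNd.label_finish _ _)
      have hs : (F.graph src bit).step (.arm b (.tooth ⟨t + m, hm'⟩ (.finish σ))) fa =
          some (.arm b (.tooth ⟨t + (m + 1), hm⟩ (.finish σ))) := by
        refine Nd.step_arm ?_
        rw [ANd.step_comb (by simp)]
        have : t.val + m + 1 < n := by omega
        simp [ANd.combStep, this, ← add_assoc]
      have := AR.plain (n := n) (q := Fin.ofNat n m) (q' := Fin.ofNat n (m + 1))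
        (by rw [hl]; exact F.plain_comb b _)
        (by
          rw [hl]
          have : t.val + m + 1 < n := by omega
          simp only [autδ, ANd.combLab, ofNat_add_one, this, if_true]) hs
      rwa [hl', (F.plain_comb b _).port] at this
  exact key m (by omega)

/-- The state in which the automaton leaves an arm depends on the tooth it starts from. -/
theorem Frame.toHub (t : Fin n) (b : Bool) :
    AR n (F.graph (b, t) bit) (0, .arm b (.tooth t (.start σ)), none)
      (Fin.ofNat n (n - t), .hub, Lab.port ((F.graph (b, t) bit).label .hub) (F.d b)) := by
  have ht := t.2
  obtain ⟨m, hm⟩ : ∃ m, t.val + m + 1 = n := ⟨n - 1 - t.val, by omega⟩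
  refine ((F.diode_arm (b, t) bit b t).traverse (by simp [Lab.Plain]) (F.plain_comb b t)
    (q₀ := 0) (by simp [autδ])).trans ?_
  refine (F.comb b m t hm).trans ?_
  have hm' : t.val + m < n := by omega
  have hl : (F.graph (b, t) bit).label (.arm b (.tooth ⟨t + m, hm'⟩ (.finish σ))) =
      ANd.combLab F.toJoints (F.d b) ⟨t + m, hm'⟩ :=
    ((F.diode_arm (b, t) bit b _).label _).trans (UNd.label_finish _ _)
  have hl' : (F.graph (b, t) bit).label (.arm b .joint) =
      ⟨.mv, .inr (F.j (F.d b)), .inr (F.j (F.d b)), opp (F.d b), opp (F.d b)⟩ := rfl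
  have hs : (F.graph (b, t) bit).step (.arm b (.tooth ⟨t + m, hm'⟩ (.finish σ)))
      (.inr (F.j (F.d b))) = some (.arm b .joint) := by
    refine Nd.step_arm ?_
    rw [ANd.step_comb (by simp [F.ne_l])]
    simp [ANd.combStep, hm]
  have h1 := AR.plain (n := n) (q := Fin.ofNat n m) (q' := Fin.ofNat n (n - t))
    (by rw [hl]; exact F.plain_comb b _)
    (by
      rw [hl]
      have h2 : n - t.val = m + 1 := by omega
      simp only [autδ, ANd.combLab, ofNat_add_one, hm, lt_irrefl, if_false, h2]) hs
  have hp : Lab.Plain ((F.graph (b, t) bit).label (.arm b .joint)) := by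
    rw [hl']; simp [Lab.Plain]
  rw [hp.port] at h1
  refine h1.trans ?_
  have h2 := AR.plain (n := n) (q := Fin.ofNat n (n - t)) (q' := Fin.ofNat n (n - t)) hp
    (by rw [hl']; simp only [autδ]) (Nd.step_joint (F := F) b)
  rwa [Dr.opp_opp] at h2

/-- At a hub of the kind `mv` the automaton keeps its state. -/
theorem Frame.hub_mv (hF : F.kind = .mv) (q : Fin n) (d : Dr K) :
    AR n (F.graph src bit) (q, .hub, Lab.port ((F.graph src bit).label .hub) d)
      (q, .chain 0, none) := by
  have hl : (F.graph src bit).label .hub = ⟨F.kind, F.d false, F.d true, .inr F.e, .inr F.e⟩ := rfl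
  have hp : Lab.Plain ((F.graph src bit).label .hub) := by
    rw [hl, hF]; simp [Lab.Plain]
  rw [hp.port]
  have := AR.plain (n := n) (q := q) (q' := q) hp (by rw [hl, hF]; simp only [autδ])
    (Nd.step_hub_chain (F := F))
  rwa [(F.plain_chain 0).port] at this

/-- At a hub of the kind `pair` the state of the automaton is replaced by the arm from which it
comes. -/
theorem Frame.hub_pair (hF : F.kind = .pair) (q : Fin n) (b : Bool) :
    AR n (F.graph src bit) (q, .hub, Lab.port ((F.graph src bit).label .hub) (F.d b))
      (if b then 1 else 0, .chain 0, none) := by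
  have hl : (F.graph src bit).label .hub = ⟨F.kind, F.d false, F.d true, .inr F.e, .inr F.e⟩ := rfl
  rw [hF] at hl
  have h1 : ¬ (Tag.pair = Tag.cell) := by simp
  have hv : Lab.ValidPair (⟨.pair, F.d false, F.d true, .inr F.e, .inr F.e⟩ : Lab K) :=
    ⟨rfl, F.d_ne, rfl, (F.e_ne _).symm, (F.e_ne _).symm, rfl⟩
  have hne := F.e_ne
  have hport : Lab.port ((F.graph src bit).label .hub) (F.d b) = some (F.d b) := by
    rw [hl]
    unfold Lab.port
    rw [if_neg h1, if_pos hv, if_pos]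
    rcases b with _ | _ <;> simp [Lab.dirs]
  rw [hport]
  refine AR.trans (c₂ :=
    ((if b then 1 else 0, Nd.hub, some (.inr F.e)) : Conf n (F.graph src bit))) ?_ ?_
  · rcases b with _ | _
    · refine .single (autNext_internal (d := pairX (F.d false)) ?_ ?_)
      · rw [hl]; simp [Lab.label, hv, autδ]
      · rw [hl]; simp [Lab.step, hv]
    · refine .single (autNext_internal (d := pairY (F.d true)) ?_ ?_)
      · rw [hl]; simp [Lab.label, hv, autδ, F.d_ne.symm]
      · rw [hl]; simp [Lab.step, hv, F.d_ne.symm]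
  · have := autNext_external (n := n) (G := F.graph src bit) (v := .hub) (y := .chain 0)
      (q := if b then 1 else 0) (q' := if b then 1 else 0) (w := some (.inr F.e)) (d := .inr F.e)
      (by rw [hl]; simp [Lab.label, hv, autδ, (F.e_ne _).symm])
      (by
        rw [hl]
        obtain ⟨x, hx⟩ := exists_pairX (F.d false)
        obtain ⟨y, hy⟩ := exists_pairY (F.d true)
        simp [Lab.step, hv, (F.e_ne _).symm, hx, hy])
      (Nd.step_hub_chain (F := F))
    rw [(F.plain_chain 0).port] at this
    exact .single this

/-- The automaton counts the nodes of the chain and branches at its end. -/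
theorem Frame.chain (m : ℕ) :
    AR n (F.graph src bit) (Fin.ofNat n m, .chain 0, none)
      (0, .exit (decide (¬ (m + F.m) % n = 0)) (.finish σ), none) := by
  have key : ∀ j (hj : j < F.m + 1), AR n (F.graph src bit) (Fin.ofNat n m, .chain 0, none)
      (Fin.ofNat n (m + j), .chain ⟨j, hj⟩, none) := by
    intro j
    induction j with
    | zero => exact fun _ => AR.refl _
    | succ j ih =>
      intro hj
      have hj' : j < F.m + 1 := by omega
      refine (ih hj').trans ?_
      have hjm : j < F.m := by omega
      have := AR.plain (n := n) (G := F.graph src bit) (q := Fin.ofNat n (m + j))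
        (q' := Fin.ofNat n (m + (j + 1))) (F.plain_chain ⟨j, hj'⟩)
        (by
          change autδ n _ (Nd.label src bit (.chain ⟨j, hj'⟩)) = _
          simp only [Nd.label, hjm, if_true, autδ, ofNat_add_one]
          rfl)
        (Nd.step_chain_fa (F := F) (j := ⟨j, hj'⟩) (j' := ⟨j + 1, hj⟩) rfl)
      rwa [(F.plain_chain _).port] at this
  refine (key F.m (by omega)).trans ?_
  set e := decide (¬ (m + F.m) % n = 0) with he
  have hx : Lab.Plain ((F.graph src bit).label (.exit e (.start σ))) := by
    rw [(F.diode_exit src bit e).label, UNd.label_start]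
    simp [Lab.Plain]
  have h1 := AR.plain (n := n) (G := F.graph src bit) (q := Fin.ofNat n (m + F.m))
    (q' := Fin.ofNat n (m + F.m)) (d := Nd.toExit e) (F.plain_chain (Fin.last _))
    (by
      change autδ n _ (Nd.label src bit (.chain (Fin.last _))) = _
      have h0 : Fin.ofNat n (m + F.m) = 0 ↔ (m + F.m) % n = 0 := by
        rw [Fin.ext_iff]
        simp
      simp only [Nd.label, Fin.val_last, lt_irrefl, if_false, autδ]
      by_cases h : (m + F.m) % n = 0
      · rw [if_pos (h0.2 h), he, h0.2 h]
        simp [h]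
      · rw [if_neg (fun h' => h (h0.1 h')), he]
        simp [h])
    (Nd.step_last (F := F) e)
  rw [hx.port] at h1
  refine h1.trans ?_
  refine (F.diode_exit src bit e).traverse (by simp [Lab.Plain]) ?_ (by simp [autδ])
  split_ifs <;> simp [Lab.Plain, UNd.deadLab]

/-- The automaton accepts according to the mark of the exit that it reaches. -/
theorem Frame.accepts_of_exit {e : Bool}
    (h : AR n (F.graph src bit) (0, .arm src.1 (.tooth src.2 (.start σ)), none)
      (0, .exit e (.finish σ), none)) :
    (aut K n).Accepts ((hom K).apply (F.graph src bit).graph) ↔ bit e = true := by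
  rw [aut_accepts_iff]
  obtain ⟨t, ht⟩ := h
  refine (Hits.run_iff autNext_of_acc ht).trans ?_
  have hl : (F.graph src bit).label (.exit e (.finish σ)) = if bit e then
      ⟨.acc, .inr σ.l, .inr σ.l, .inr σ.l, .inr σ.l⟩ else UNd.deadLab (.inr σ.l) := by
    rw [(F.diode_exit src bit e).label, UNd.label_finish]
  have hp : Lab.Plain ((F.graph src bit).label (.exit e (.finish σ))) := by
    rw [hl]; split_ifs <;> simp [Lab.Plain, UNd.deadLab]
  have hl' : Lab.label ((F.graph src bit).label (.exit e (.finish σ))) none = if bit e then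
      ⟨.acc, .inr σ.l, .inr σ.l, .inr σ.l, .inr σ.l⟩ else UNd.deadLab (.inr σ.l) := by
    rw [Lab.label_of_trivial hp.1 (Lab.not_validPair hp.2), hl]
  have hmem : (((0 : Fin n), Nd.exit e (.finish σ), none) : Conf n (F.graph src bit)) ∈
      autAcc n (F.graph src bit) ↔ bit e = true := by
    change (Lab.label ((F.graph src bit).label (.exit e (.finish σ))) none).tag = .acc ↔ _
    rw [hl']
    split_ifs with h <;> simp [h, UNd.deadLab]
  rw [← hmem]
  constructor
  · rintro ⟨u, c, hc, hF⟩
    rcases u with _ | u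
    · cases hc; exact hF
    · obtain ⟨c', hc', -⟩ := hc
      exfalso
      unfold autNext at hc'
      simp only [hl'] at hc'
      split_ifs at hc' <;> simp [autδ, UNd.deadLab] at hc'
  · exact fun h => ⟨0, _, rfl, h⟩

/-- Two teeth of the same arm are told apart by the state of the automaton. -/
theorem Frame.accepts_mv (hF : F.kind = .mv) (b : Bool) (t : Fin n) :
    (aut K n).Accepts ((hom K).apply (F.graph (b, t) bit).graph) ↔
      bit (decide (¬ (n - t.val + F.m) % n = 0)) = true :=
  F.accepts_of_exit (((F.toHub t b).trans (F.hub_mv hF _ _)).trans (F.chain _))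

/-- Two teeth of different arms are told apart by the hub. -/
theorem Frame.accepts_pair (hn : 1 < n) (hF : F.kind = .pair) (hm : F.m = 0) (b : Bool)
    (t : Fin n) :
    (aut K n).Accepts ((hom K).apply (F.graph (b, t) bit).graph) ↔ bit b = true := by
  refine F.accepts_of_exit (((F.toHub t b).trans (F.hub_pair hF _ _)).trans ?_)
  have h1 : (if b then 1 else 0 : Fin n) = Fin.ofNat n (if b then 1 else 0) := by
    apply Fin.ext
    rcases b with _ | _ <;> simp
  have h2 : b = decide (¬ ((if b then 1 else 0) + F.m) % n = 0) := by
    rw [hm]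
    rcases b with _ | _ <;> simp [Nat.mod_eq_of_lt hn]
  rw [h1]
  conv_rhs => rw [h2]
  exact F.chain _

end Exits

open Dr

/-! ### Automata on the test graphs -/

section Main

variable {n K : ℕ} [NeZero n] {σ : Spec n K} {F : Frame σ} {B : Automaton (sig K)}

namespace Frame

/-- The partial map on configurations given by an automaton on a test graph. -/
noncomputable def bnext (F : Frame σ) (B : Automaton (sig K)) (src : Bool × Fin n)
    (bit : Bool → Bool) : B.Q × Nd F → Option (B.Q × Nd F) :=
  B.next (F.graph src bit)

/-- The accepting configurations of an automaton on a test graph. -/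
def bacc (F : Frame σ) (B : Automaton (sig K)) (src : Bool × Fin n) (bit : Bool → Bool) :
    Set (B.Q × Nd F) :=
  B.accepting (F.graph src bit)

variable {src src' : Bool × Fin n} {bit bit' : Bool → Bool}

theorem bnext_eq_some {c c' : B.Q × Nd F} : F.bnext B src bit c = some c' ↔
    ∃ d, B.δ c.1 (Nd.label src bit c.2) = some (c'.1, d) ∧ Nd.step c.2 d = some c'.2 :=
  Automaton.next_eq_some

theorem bnext_of_bacc : ∀ c ∈ F.bacc B src bit, F.bnext B src bit c = none :=
  Automaton.next_of_accepting (B := B) (G := F.graph src bit)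

theorem bnext_congr {c : B.Q × Nd F} (h : Nd.label src bit c.2 = Nd.label src' bit' c.2) :
    F.bnext B src bit c = F.bnext B src' bit' c := by
  refine Option.ext fun c' => ?_
  rw [bnext_eq_some, bnext_eq_some, h]

theorem bacc_congr {c : B.Q × Nd F} (h : Nd.label src bit c.2 = Nd.label src' bit' c.2) :
    c ∈ F.bacc B src bit ↔ c ∈ F.bacc B src' bit' := by
  change (c.1, Nd.label src bit c.2) ∈ B.F ↔ (c.1, Nd.label src' bit' c.2) ∈ B.F
  rw [h]

/-- The first node of a tooth. -/
def root (F : Frame σ) (src : Bool × Fin n) : Nd F := .arm src.1 (.tooth src.2 (.start σ))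

/-- The labels of test graphs differ only at the initial nodes and at the exits. -/
theorem label_congr {v : Nd F} (h : v ≠ F.root src) (h' : v ≠ F.root src')
    (hb : ∀ x, v = .exit x (.finish σ) → bit x = bit' x) :
    Nd.label src bit v = Nd.label src' bit' v := by
  rcases v with ⟨b, ⟨t, u⟩ | _⟩ | _ | j | ⟨b, u⟩
  · simp only [Nd.label, ANd.label]
    by_cases hu : u = .start σ
    · subst hu
      have key : ∀ src : Bool × Fin n, (Nd.arm b (.tooth t (.start σ)) : Nd F) ≠ F.root src →
          (if src.1 = b then some src.2 else none) ≠ some t := by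
        rintro ⟨b', t'⟩ h1 h2
        simp only at h2
        split_ifs at h2 with h3
        cases h2
        subst h3
        exact h1 rfl
      rw [if_neg (key src h), if_neg (key src' h')]
    by_cases hu' : u = .finish σ
    · subst hu'
      rw [UNd.label_finish, UNd.label_finish]
    · exact UNd.label_congr hu hu'
  · rfl
  · rfl
  · rfl
  · simp only [Nd.label]
    by_cases hu' : u = .finish σ
    · subst hu'
      rw [hb b rfl]
    by_cases hu : u = .start σ
    · subst hu
      rw [UNd.label_start, UNd.label_start]
    · exact UNd.label_congr hu hu'

/-- The run of an automaton in an arm; `none` stands for the hub. -/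
noncomputable def armNext (J : Joints σ) (B : Automaton (sig K)) (t : Fin n) (d : Dr K)
    (c : B.Q × Option (ANd σ)) : Option (B.Q × Option (ANd σ)) :=
  c.2.bind fun u => (B.δ c.1 (ANd.label J d (some t) u)).bind fun r =>
    (ANd.step J d u r.2).map fun o => (r.1, o)

/-- The configuration on a test graph that corresponds to one in an arm. -/
def ofArm (F : Frame σ) (b : Bool) (c : B.Q × Option (ANd σ)) : B.Q × Nd F :=
  (c.1, c.2.elim .hub (.arm b))

theorem bnext_arm (b : Bool) (t : Fin n) (s : B.Q) (u : ANd σ) :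
    F.bnext B (b, t) bit (s, .arm b u) =
      (armNext F.toJoints B t (F.d b) (s, some u)).map (F.ofArm b) := by
  refine Option.ext fun c' => ?_
  rw [bnext_eq_some]
  have hl : Nd.label (F := F) (b, t) bit (.arm b u) =
      ANd.label F.toJoints (F.d b) (some t) u := by simp [Nd.label]
  simp only [hl, Nd.step, armNext, Option.bind_some, Option.map_eq_some_iff,
    Option.bind_eq_some_iff]
  constructor
  · rintro ⟨d, hd, o, ho, h⟩
    exact ⟨_, ⟨_, hd, o, ho, rfl⟩, Prod.ext rfl h⟩
  · rintro ⟨_, ⟨r, hr, o, ho, rfl⟩, rfl⟩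
    exact ⟨r.2, hr, o, ho, rfl⟩

/-- The automaton leaves an arm with the initial node at the tooth `t` in the state `p`. -/
def ArmOut (J : Joints σ) (B : Automaton (sig K)) (t : Fin n) (d : Dr K) (p : B.Q) : Prop :=
  ∃ T, Run (armNext J B t d) T (B.q0, some (.tooth t (.start σ))) (p, none)

theorem ArmOut.run {b : Bool} {t : Fin n} {p : B.Q} (h : ArmOut F.toJoints B t (F.d b) p)
    (bit : Bool → Bool) :
    ∃ T, Run (F.bnext B (b, t) bit) T (B.q0, F.root (b, t)) (p, .hub) := by
  obtain ⟨T, hT⟩ := h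
  refine ⟨T, hT.map (φ := F.ofArm b) ?_⟩
  rintro ⟨s, o⟩ c' h
  rcases o with _ | u
  · simp [armNext] at h
  · have := bnext_arm (F := F) (bit := bit) b t s u
    rw [h] at this
    exact this

/-- An automaton that does not leave the arm with the initial node stays in it forever. -/
theorem stays_of_not_armOut {b : Bool} {t : Fin n}
    (h : ∀ p, ¬ ArmOut F.toJoints B t (F.d b) p) (T : ℕ) (c : B.Q × Nd F)
    (hc : Run (F.bnext B (b, t) bit) T (B.q0, F.root (b, t)) c) : ∃ u, c.2 = .arm b u := by
  have key : ∀ T (a : B.Q × Option (ANd σ)), (∀ T p, ¬ Run (armNext F.toJoints B t (F.d b)) T a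
      (p, none)) → ∀ c, Run (F.bnext B (b, t) bit) T (F.ofArm b a) c → ∃ u, c.2 = .arm b u := by
    intro T
    induction T with
    | zero =>
      rintro ⟨s, o⟩ ha c rfl
      rcases o with _ | u
      · exact (ha 0 s rfl).elim
      · exact ⟨u, rfl⟩
    | succ T ih =>
      rintro ⟨s, o⟩ ha c ⟨c', hc', hc⟩
      rcases o with _ | u
      · exact (ha 0 s rfl).elim
      · have h1 := bnext_arm (F := F) (bit := bit) b t s u
        have h2 : F.bnext B (b, t) bit (s, .arm b u) = some c' := hc'
        rw [h2, eq_comm, Option.map_eq_some_iff] at h1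
        obtain ⟨a', ha', rfl⟩ := h1
        exact ih a' (fun T p hT => ha (T + 1) p ⟨a', ha', hT⟩) c hc
  exact key T _ (fun T p hT => h p ⟨T, hT⟩) c hc

end Frame

variable (B σ) in
/-- An automaton is blocked by a diode if it can traverse the cells only in one arrival state, or
if it cannot traverse the cells from the far end to the gate at all, because it never looks in the
direction of the gate in the cyclic states of its base. -/
def Blocked : Prop :=
  (∃ x, ∀ s ∈ Arrivals (walk B) σ.base, s = x) ∨
    (σ.guarded = false ∧ ∀ s, (s, σ.base) ∈ Cyclic (walk B) → visit B s ≠ some σ.l)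

/-- Two teeth of a test graph whose arms an automaton leaves in the same state `p`, although the
automaton has to accept according to the mark of the exit `e` if the initial node is at the
tooth `src e`. -/
structure Confusion (F : Frame σ) (B : Automaton (sig K)) (src : Bool → Bool × Fin n)
    (p : B.Q) : Prop where
  large : Large B.Q n σ.L σ.N
  accepts : ∀ e bit, Hits (F.bnext B (src e) bit) (F.bacc B (src e) bit)
    (B.q0, F.root (src e)) ↔ bit e = true
  run : ∀ e bit, ∃ T, Run (F.bnext B (src e) bit) T (B.q0, F.root (src e)) (p, .hub)

namespace Confusion

variable {src : Bool → Bool × Fin n} {p : B.Q}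

variable (F B src p) in
/-- A configuration that is attained from the hub in all the test graphs with initial nodes at
the two teeth. -/
def Common (c : B.Q × Nd F) : Prop :=
  ∀ e bit, ∃ T, Run (F.bnext B (src e) bit) T (p, .hub) c

theorem hits_iff (h : Confusion F B src p) {c : B.Q × Nd F} (hc : Common F B src p c) (e : Bool)
    (bit : Bool → Bool) : Hits (F.bnext B (src e) bit) (F.bacc B (src e) bit) c ↔ bit e = true := by
  obtain ⟨T, hT⟩ := hc e bit
  obtain ⟨T', hT'⟩ := h.run e bit
  rw [← h.accepts e bit, Hits.run_iff Frame.bnext_of_bacc (hT'.add hT)]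

/-- After a common configuration the automaton does not stay forever at one exit. -/
theorem not_stays_exit (h : Confusion F B src p) {c : B.Q × Nd F} (hc : Common F B src p c)
    (e x : Bool) (bit : Bool → Bool)
    (hS : ∀ T c', Run (F.bnext B (src e) bit) T c c' → ∃ u, c'.2 = .exit x u) : False := by
  -- The mark of the other exit does not influence the run.
  have key : ∀ y, Hits (F.bnext B (src e) bit) (F.bacc B (src e) bit) c ↔ y = true := by
    intro y
    set bit' : Bool → Bool := fun z => if z = x then bit x else y with hbit'
    have hlab : ∀ c' : B.Q × Nd F, (∃ u, c'.2 = .exit x u) →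
        Nd.label (src e) bit c'.2 = Nd.label (src (!x)) bit' c'.2 := by
      rintro ⟨s, v⟩ ⟨u, rfl⟩
      refine Frame.label_congr (by simp [Frame.root]) (by simp [Frame.root]) ?_
      rintro z hz
      cases hz
      simp [hbit']
    have h1 := h.hits_iff hc (!x) bit'
    have h2 : bit' (!x) = y := by
      rw [hbit']
      cases x <;> rfl
    rw [h2] at h1
    rw [← h1]
    exact Hits.congr (S := {c' : B.Q × Nd F | ∃ u, c'.2 = .exit x u})
      (fun c' hc' => Frame.bnext_congr (hlab c' hc'))
      (fun c' hc' => Frame.bacc_congr (hlab c' hc')) hS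
  have h1 := (key true).2 rfl
  have h2 := (key false).1 h1
  cases h2

/-- After a common configuration the automaton does not stay forever in one arm. -/
theorem not_stays_arm (h : Confusion F B src p) {c : B.Q × Nd F} (hc : Common F B src p c)
    (e b : Bool) (hS : ∀ T c', Run (F.bnext B (src e) fun _ => true) T c c' →
      ∃ u, c'.2 = .arm b u) : False := by
  have h1 := (h.hits_iff hc e (fun _ => true)).2 rfl
  have h2 := h.hits_iff hc e (fun _ => false)
  have hlab : ∀ c' : B.Q × Nd F, (∃ u, c'.2 = .arm b u) →
      Nd.label (src e) (fun _ => true) c'.2 = Nd.label (src e) (fun _ => false) c'.2 := by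
    rintro ⟨s, v⟩ ⟨u, rfl⟩
    rfl
  rw [Hits.congr (S := {c' : B.Q × Nd F | ∃ u, c'.2 = .arm b u})
    (fun c' hc' => Frame.bnext_congr (hlab c' hc'))
    (fun c' hc' => Frame.bacc_congr (hlab c' hc')) hS] at h1
  cases h2.1 h1

/-- The configurations with the node in one diode, given by its embedding `emb` into a test
graph, that lie on one side of the diode. -/
def onSide (F : Frame σ) (B : Automaton (sig K)) (emb : UNd σ → Nd F) (x y : Pos n σ.N) :
    Set (B.Q × Nd F) :=
  {c | ∃ u, c.2 = emb u ∧ (c.1, u) ∈ Side B x y}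

/-- At an exit the far side of the diode is left only over the entrance, in a fixed state. -/
theorem onSide_exit (hL : Large B.Q n σ.L σ.N) {x₀ : B.Q}
    (hx₀ : ∀ s ∈ Arrivals (walk B) σ.base, s = x₀) (x : Bool) (src : Bool × Fin n)
    (bit : Bool → Bool) :
    ∀ c ∈ onSide F B (.exit x) σ.R σ.E, ∀ c', F.bnext B src bit c = some c' →
      c' ∈ onSide F B (.exit x) σ.R σ.E ∨ c' = (x₀, .exit x (.ring σ.E)) := by
  rintro ⟨s, v⟩ ⟨u, rfl, hu⟩ ⟨s', v'⟩ hc'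
  obtain ⟨d, hδ, hstep⟩ := Frame.bnext_eq_some.1 hc'
  have hns : u ≠ .start σ := by
    rintro rfl
    exact σ.ne.symm hu
  have hstep' : ∃ u', u.step d = some u' ∧ v' = .exit x u' := by
    rcases Nd.step_cases hstep with ⟨b, u, u', h, -⟩ | ⟨b, h, -⟩ | ⟨b, h, -⟩ |
      ⟨h, -⟩ | ⟨h, -⟩ | ⟨j, j', -, h, -⟩ | ⟨j, j', -, h, -⟩ |
      ⟨b, h, -⟩ | ⟨b, h, -⟩ | ⟨b, u, u', h, hu', h'⟩ <;> cases h
    · exact (hns rfl).elim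
    · exact ⟨u', hu', h'⟩
  obtain ⟨u', hu', rfl⟩ := hstep'
  rcases Side.step hL (Or.inr ⟨rfl, rfl⟩) hu hδ hu' with h | ⟨rfl, h⟩
  · exact Or.inl ⟨u', rfl, h⟩
  · exact Or.inr (Prod.ext (hx₀ _ h) rfl)

/-- At a tooth the near side of the diode is left only over the far end, in a fixed state. -/
theorem onSide_tooth (hL : Large B.Q n σ.L σ.N) {x₀ : B.Q}
    (hx₀ : ∀ s ∈ Arrivals (walk B) σ.base, s = x₀) (b : Bool) (t : Fin n) (src : Bool × Fin n)
    (bit : Bool → Bool) :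
    ∀ c ∈ onSide F B (fun u => .arm b (.tooth t u)) σ.E σ.R, ∀ c',
      F.bnext B src bit c = some c' →
      c' ∈ onSide F B (fun u => .arm b (.tooth t u)) σ.E σ.R ∨
        c' = (x₀, .arm b (.tooth t (.ring σ.R))) := by
  rintro ⟨s, v⟩ ⟨u, rfl, hu⟩ ⟨s', v'⟩ hc'
  obtain ⟨d, hδ, hstep⟩ := Frame.bnext_eq_some.1 hc'
  have hnf : u ≠ .finish σ := by
    rintro rfl
    rcases hu with h | h
    · exact σ.ne.symm h
    · exact h.1 rfl
  have hstep' : ∃ u', u.step d = some u' ∧ v' = .arm b (.tooth t u') := by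
    rcases Nd.step_cases hstep with ⟨b, u, u', h, hu', h'⟩ | ⟨b, h, -⟩ | ⟨b, h, -⟩ |
      ⟨h, -⟩ | ⟨h, -⟩ | ⟨j, j', -, h, -⟩ | ⟨j, j', -, h, -⟩ |
      ⟨b, h, -⟩ | ⟨b, h, -⟩ | ⟨b, u, u', h, -⟩ <;> cases h
    rcases ANd.step_cases hu' with ⟨w, hw, h⟩ | ⟨h, -⟩
    · cases h
      exact ⟨w, hw, h'⟩
    · exact (hnf h).elim
  obtain ⟨u', hu', rfl⟩ := hstep'
  rcases Side.step hL (Or.inl ⟨rfl, rfl⟩) hu hδ hu' with h | ⟨rfl, h⟩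
  · exact Or.inl ⟨u', rfl, h⟩
  · exact Or.inr (Prod.ext (hx₀ _ h) rfl)

/-- The configurations that are not in the arms, or in the part of a tooth that can be attained from
its far end. -/
def behindHub (F : Frame σ) (B : Automaton (sig K)) : Set (B.Q × Nd F) :=
  {c | ∀ b t u, c.2 = .arm b (.tooth t u) → (c.1, u) ∈ Closed B}

/-- The teeth are entered from outside only at their last nodes. -/
theorem behindHub_step (hL : Large B.Q n σ.L σ.N) (hg : σ.guarded = false)
    (hl : ∀ s, (s, σ.base) ∈ Cyclic (walk B) → visit B s ≠ some σ.l) (src : Bool × Fin n)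
    (bit : Bool → Bool) :
    ∀ c ∈ behindHub F B, ∀ c', F.bnext B src bit c = some c' → c' ∈ behindHub F B := by
  have hfin : ∀ s, (s, UNd.finish σ) ∈ Closed B :=
    fun s => ⟨fun h => σ.ne h.1.symm, Or.inl rfl⟩
  rintro ⟨s, v⟩ hc ⟨s', v'⟩ hc' b t u' hv'
  obtain ⟨d, hδ, hstep⟩ := Frame.bnext_eq_some.1 hc'
  simp only at hv'
  subst hv'
  rcases Nd.step_cases hstep with ⟨b', u, w, rfl, hu', h'⟩ | ⟨b, -, -, h⟩ | ⟨b, -, -, h⟩ |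
    ⟨-, -, h⟩ | ⟨-, -, h⟩ | ⟨j, j', -, -, -, h⟩ | ⟨j, j', -, -, -, h⟩ |
    ⟨b, -, -, h⟩ | ⟨b, -, -, h⟩ | ⟨b, u, u', -, -, h⟩ <;> try cases h
  cases h'
  rcases u with ⟨t', u⟩ | _
  · rcases ANd.step_cases hu' with ⟨w, hw, h⟩ | ⟨rfl, -, w, hw, h⟩
    · cases h
      exact Closed.step hL hg hl (hc _ _ _ rfl) hδ hw
    · cases h
      simp only [ANd.combStep] at hw
      split_ifs at hw <;> cases hw <;> exact hfin _
  · simp only [ANd.step] at hu'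
    split_ifs at hu' <;> cases hu'
    exact hfin _

/-- If the gate cannot be reached from the far end, then the exit cannot be left. -/
theorem closed_exit (hL : Large B.Q n σ.L σ.N) (hg : σ.guarded = false)
    (hl : ∀ s, (s, σ.base) ∈ Cyclic (walk B) → visit B s ≠ some σ.l) (x : Bool)
    (src : Bool × Fin n) (bit : Bool → Bool) :
    ∀ c ∈ {c : B.Q × Nd F | ∃ u, c.2 = .exit x u ∧ (c.1, u) ∈ Closed B}, ∀ c',
      F.bnext B src bit c = some c' →
      c' ∈ {c : B.Q × Nd F | ∃ u, c.2 = .exit x u ∧ (c.1, u) ∈ Closed B} := by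
  rintro ⟨s, v⟩ ⟨u, rfl, hu⟩ ⟨s', v'⟩ hc'
  obtain ⟨d, hδ, hstep⟩ := Frame.bnext_eq_some.1 hc'
  have hns : u ≠ .start σ := by
    rintro rfl
    exact hu
  rcases Nd.step_cases hstep with ⟨b, u, u', h, -⟩ | ⟨b, h, -⟩ | ⟨b, h, -⟩ |
    ⟨h, -⟩ | ⟨h, -⟩ | ⟨j, j', -, h, -⟩ | ⟨j, j', -, h, -⟩ |
    ⟨b, h, -⟩ | ⟨b, h, -⟩ | ⟨b, u, u', h, hu', h'⟩ <;> cases h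
  · exact (hns rfl).elim
  · exact ⟨u', h', Closed.step hL hg hl hu hδ hu'⟩

end Confusion

end Main

open Dr

section Main

variable {n K : ℕ} [NeZero n] {σ : Spec n K} {F : Frame σ} {B : Automaton (sig K)}

namespace Confusion

variable {src : Bool → Bool × Fin n} {p : B.Q}

/-- From an exit the automaton has to return to a configuration that does not depend on the
test graph. -/
theorem exists_common_of_exit (h : Confusion F B src p) (hB : Blocked σ B) {c : B.Q × Nd F}
    (hc : Common F B src p c) {x : Bool} (hx : c.2 = .exit x (.finish σ)) :
    ∃ r, Common F B src p r ∧ ∃ t > 0, Run (F.bnext B (src false) fun _ => true) t c r := by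
  rcases hB with ⟨x₀, hx₀⟩ | ⟨hg, hl⟩
  · have key : ∀ e bit, ∃ t > 0,
        Run (F.bnext B (src e) bit) t c (x₀, .exit x (.ring σ.E)) := by
      intro e bit
      by_contra hno
      refine h.not_stays_exit hc e x bit fun T c' hT => ?_
      have hcS : c ∈ onSide F B (.exit x) σ.R σ.E := ⟨_, hx, Or.inl rfl⟩
      rcases hT.mem_or_exit (onSide_exit h.large hx₀ x _ _) hcS with
        ⟨u, hu, -⟩ | ⟨t, ht, -, hr⟩
      · exact ⟨u, hu⟩
      · exact (hno ⟨t, ht, hr⟩).elim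
    refine ⟨_, fun e bit => ?_, key false _⟩
    obtain ⟨T, hT⟩ := hc e bit
    obtain ⟨t, -, ht⟩ := key e bit
    exact ⟨T + t, hT.add ht⟩
  · refine (h.not_stays_exit hc false x (fun _ => true) fun T c' hT => ?_).elim
    obtain ⟨u, hu, -⟩ := hT.mem (closed_exit h.large hg hl x _ _)
      ⟨_, hx, fun h => σ.ne h.1.symm, Or.inl rfl⟩
    exact ⟨u, hu⟩

/-- The automaton cannot return from the hub to one of the possible initial nodes. -/
theorem ne_root (h : Confusion F B src p) (hB : Blocked σ B) {c : B.Q × Nd F}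
    (hc : Common F B src p c) (e : Bool) : c.2 ≠ F.root (src e) := by
  intro hx
  rcases hB with ⟨x₀, hx₀⟩ | ⟨hg, hl⟩
  · set b := (src e).1 with hb
    set t := (src e).2 with ht
    set f := F.bnext B (src e) (fun _ => true) with hf
    set S := onSide F B (fun u => .arm b (.tooth t u)) σ.E σ.R with hS
    have hstep := onSide_tooth (F := F) h.large hx₀ b t (src e) (fun _ => true)
    have hroot : ∀ s, (s, F.root (src e)) ∈ S := fun s => ⟨.start σ, rfl, rfl⟩
    -- The run from the initial node to the hub passes the far end of the diode.
    obtain ⟨T, hT⟩ := h.run e (fun _ => true)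
    obtain ⟨u, -, huT, hu⟩ := (hT.mem_or_exit hstep (hroot _)).resolve_left (by
      rintro ⟨u, hu, -⟩
      cases hu)
    obtain ⟨k, rfl⟩ := Nat.exists_eq_add_of_le huT
    have hk := hu.cancel hT
    obtain ⟨T', hT'⟩ := hc e (fun _ => true)
    refine h.not_stays_arm hc e b fun T'' c' hT'' => ?_
    have hcS : c ∈ S := by
      have := hroot c.1
      rw [← hx] at this
      exact this
    rcases hT''.mem_or_exit hstep hcS with ⟨w, hw, -⟩ | ⟨m, hm, -, hr⟩
    · exact ⟨_, hw⟩
    · -- The automaton runs through a cycle.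
      have hcyc := (hk.add hT').add hr
      have h1 := Hits.not_of_cycle Frame.bnext_of_bacc (by omega) hcyc
      rw [← Hits.run_iff Frame.bnext_of_bacc hu] at h1
      exact (h1 ((h.accepts e _).2 rfl)).elim
  · obtain ⟨T, hT⟩ := hc e (fun _ => true)
    have h0 : ((p, .hub) : B.Q × Nd F) ∈ behindHub F B := by
      rintro b t u hu
      cases hu
    exact hT.mem (behindHub_step h.large hg hl _ _) h0 _ _ _ hx

/-- The automaton cannot leave the arms of both teeth in the same state. Until it reaches an exit,
its computation from the hub is the same on all the test graphs in question, since it does not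
return to their initial nodes; from an exit it returns to a configuration that is again common to
them. Hence it never accepts. -/
theorem absurd (h : Confusion F B src p) (hB : Blocked σ B) : False := by
  -- A common configuration is followed by another one, so the automaton never halts.
  have key : ∀ N c a, Common F B src p c → Run (F.bnext B (src false) fun _ => true) N c a →
      a ∈ F.bacc B (src false) (fun _ => true) → False := by
    intro N
    induction N using Nat.strong_induction_on with
    | _ N ih =>
      intro c a hc ha haF
      by_cases hx : ∃ x, c.2 = .exit x (.finish σ)
      · obtain ⟨x, hx⟩ := hx
        obtain ⟨r, hr, t, ht, hrun⟩ := h.exists_common_of_exit hB hc hx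
        obtain ⟨k, rfl⟩ := Nat.exists_eq_add_of_le
          (Hits.le_of_run Frame.bnext_of_bacc hrun ha haF)
        exact ih k (by omega) r a hr (hrun.cancel ha) haF
      · have hlab : ∀ e bit, Nd.label (src false) (fun _ => true) c.2 =
            Nd.label (src e) bit c.2 := fun e bit =>
          Frame.label_congr (h.ne_root hB hc false) (h.ne_root hB hc e)
            fun x hx' => (hx ⟨x, hx'⟩).elim
        rcases N with _ | N
        · cases ha
          have h1 : c ∈ F.bacc B (src false) (fun _ => false) :=
            (Frame.bacc_congr (hlab false _)).1 haF
          have := (h.hits_iff hc false (fun _ => false)).1 ⟨0, c, rfl, h1⟩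
          cases this
        · obtain ⟨c', hc', ha⟩ := ha
          refine ih N (by omega) c' a (fun e bit => ?_) ha haF
          obtain ⟨T, hT⟩ := hc e bit
          rw [Frame.bnext_congr (hlab e bit)] at hc'
          exact ⟨T + 1, hT.add (.one hc')⟩
  have h0 : Common F B src p (p, .hub) := fun _ _ => ⟨0, rfl⟩
  obtain ⟨N, a, ha, haF⟩ := (h.hits_iff h0 false (fun _ => true)).2 rfl
  exact key N _ a h0 ha haF

end Confusion

/-! ### The lower bound -/

section LowerBound

variable [NeZero K]

/-- For any two teeth there is a test graph in which the automaton goes from them to different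
exits. -/
theorem exists_frame (hn : 1 < n) (hK : 5 ≤ K) (J : Joints σ) {i i' : Fin n × Dr K}
    (hi : i ≠ i') : ∃ F : Frame σ, F.toJoints = J ∧ ∃ b b' : Bool, F.d b = i.2 ∧ F.d b' = i'.2 ∧
      (∀ bit, (aut K n).Accepts ((hom K).apply (F.graph (b, i.1) bit).graph) ↔
        bit false = true) ∧
      (∀ bit, (aut K n).Accepts ((hom K).apply (F.graph (b', i'.1) bit).graph) ↔
        bit true = true) := by
  obtain ⟨t, d⟩ := i
  obtain ⟨t', d'⟩ := i'
  by_cases hd : d = d'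
  · -- Different teeth at the same arm: `t` nodes behind the hub turn the state `n - t` into zero.
    subst hd
    have htt : t.val ≠ t'.val := fun h => hi (by rw [Fin.ext h])
    obtain ⟨e, he⟩ := exists_avoid hK ![d, pairX d, d, d]
    let F : Frame σ := ⟨J, fun b => if b then pairX d else d, by simpa using pairX_ne d, e, by
      rintro (_ | _)
      · exact he 0
      · exact he 1, .mv, Or.inr rfl, t.val⟩
    refine ⟨F, rfl, false, false, rfl, rfl, fun bit => ?_, fun bit => ?_⟩
    · refine (F.accepts_mv rfl false t).trans ?_
      have : (n - t.val + F.m) % n = 0 := by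
        rw [show F.m = t.val from rfl, Nat.sub_add_cancel t.2.le, Nat.mod_self]
      rw [decide_eq_false (not_not.2 this)]
    · refine (F.accepts_mv rfl false t').trans ?_
      have : ¬ (n - t'.val + F.m) % n = 0 := by
        rw [show F.m = t.val from rfl]
        intro h
        obtain ⟨c, hc⟩ := Nat.dvd_of_mod_eq_zero h
        have h1 := t.2
        have h2 := t'.2
        have h3 : c < 2 := by
          by_contra h3
          have := Nat.mul_le_mul_left n (not_lt.1 h3)
          omega
        interval_cases c <;> omega
      rw [decide_eq_true this]
  · -- Different directions: a hub of the kind `pair` tells the arms apart.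
    obtain ⟨e, he⟩ := exists_avoid hK ![d, d', d, d]
    let F : Frame σ := ⟨J, fun b => if b then d' else d, by simpa using hd, e, by
      rintro (_ | _)
      · exact he 0
      · exact he 1, .pair, Or.inl rfl, 0⟩
    exact ⟨F, rfl, false, true, rfl, rfl, fun bit => F.accepts_pair hn rfl rfl false t,
      fun bit => F.accepts_pair hn rfl rfl true t'⟩

/-- An automaton that is blocked by a diode has at least `n (4 + K)` states, because it leaves the
arm in a different state for each of the `n` teeth and each of the `4 + K` directions of the arm. -/
theorem Blocked.card_le (hn : 1 < n) (hK : 5 ≤ K) (hL : Large B.Q n σ.L σ.N) (hB : Blocked σ B)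
    (hBA : ∀ G : Graph (sig K), B.Accepts G ↔ (aut K n).Accepts ((hom K).apply G)) :
    n * (4 + K) ≤ Fintype.card B.Q := by
  obtain ⟨J⟩ := exists_joints hK σ
  have hacc : ∀ (F : Frame σ) (src : Bool × Fin n) (bit : Bool → Bool),
      Hits (F.bnext B src bit) (F.bacc B src bit) (B.q0, F.root src) ↔
        (aut K n).Accepts ((hom K).apply (F.graph src bit).graph) := by
    intro F src bit
    rw [← hBA, Automaton.accepts_graph_iff]
    rfl
  -- An automaton that stays in the arm would ignore the marks of the exits.
  have hout : ∀ i : Fin n × Dr K, ∃ p, Frame.ArmOut J B i.1 i.2 p := by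
    intro i
    have : Nontrivial (Fin n) := Fin.nontrivial_iff_two_le.2 hn
    obtain ⟨t', ht'⟩ := exists_ne i.1
    obtain ⟨F, rfl, b, -, hb, -, hF, -⟩ := exists_frame hn hK J (i := i) (i' := (t', i.2))
      (fun h => ht' (congrArg Prod.fst h).symm)
    by_contra hno
    push Not at hno
    rw [← hb] at hno
    have h1 := (hacc F (b, i.1) (fun _ => true)).2 ((hF _).2 rfl)
    have hlab : ∀ c' : B.Q × Nd F, (∃ u, c'.2 = .arm b u) →
        Nd.label (b, i.1) (fun _ => true) c'.2 = Nd.label (b, i.1) (fun _ => false) c'.2 := by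
      rintro ⟨s, v⟩ ⟨u, rfl⟩
      rfl
    rw [Hits.congr (S := {c' : B.Q × Nd F | ∃ u, c'.2 = .arm b u})
      (fun c' hc' => Frame.bnext_congr (hlab c' hc'))
      (fun c' hc' => Frame.bacc_congr (hlab c' hc'))
      (Frame.stays_of_not_armOut hno)] at h1
    cases (hF _).1 ((hacc F (b, i.1) (fun _ => false)).1 h1)
  choose p hp using hout
  have hinj : Function.Injective p := by
    intro i i' hpp
    by_contra hne
    obtain ⟨F, rfl, b, b', hb, hb', hF, hF'⟩ := exists_frame hn hK J hne
    have h1 := hp i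
    have h2 := hp i'
    rw [← hpp] at h2
    rw [← hb] at h1
    rw [← hb'] at h2
    refine Confusion.absurd (F := F) (B := B) (p := p i)
      (src := fun x => if x then (b', i'.1) else (b, i.1)) ⟨hL, ?_, ?_⟩ hB
    · rintro (_ | _) bit
      · exact (hacc F _ bit).trans (hF bit)
      · exact (hacc F _ bit).trans (hF' bit)
    · rintro (_ | _) bit
      · exact h1.run bit
      · exact h2.run bit
  have := Fintype.card_le_of_injective p hinj
  simpa using this

end LowerBound

end Main

end GraphWalking

theorem mainTheorem2 (k : ℕ) (hk : 9 ≤ k) :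
    ∃ S : GraphWalking.Signature, Fintype.card S.Dir = k ∧
      ∃ h : GraphWalking.Homomorphism S,
        ∀ n : ℕ, 4 ≤ n →
          ∃ A : GraphWalking.Automaton S, A.numStates = n ∧
            ∀ B : GraphWalking.Automaton S,
              B.language = h.apply ⁻¹' A.language → n * k ≤ B.numStates := by
  obtain ⟨K, rfl⟩ := Nat.exists_eq_add_of_le (show 4 ≤ k by omega)
  have hK : 5 ≤ K := by omega
  have : NeZero K := ⟨by omega⟩
  refine ⟨GraphWalking.sig K, GraphWalking.card_sig K, GraphWalking.hom K, fun n hn => ?_⟩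
  have : NeZero n := ⟨by omega⟩
  refine ⟨GraphWalking.aut K n, Fintype.card_fin n, fun B hB => ?_⟩
  have hBA : ∀ G : GraphWalking.Graph (GraphWalking.sig K),
      B.Accepts G ↔ (GraphWalking.aut K n).Accepts ((GraphWalking.hom K).apply G) :=
    fun G => Set.ext_iff.1 hB G
  change n * (4 + K) ≤ Fintype.card B.Q
  by_contra hcard
  set M := GraphWalking.baseCard B.Q n with hM
  obtain ⟨L, hL⟩ : ∃ L, 2 * M * (2 * M + 2) + (2 * M + 2) < L := ⟨_, Nat.lt_succ_self _⟩
  obtain ⟨N, hN⟩ : ∃ N, 2 * M * (L * (2 * n) + 2 * M + 2) + L * (2 * n) + 2 * M + 2 < N :=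
    ⟨_, Nat.lt_succ_self _⟩
  have hL0 : 0 < L := by omega
  have hN0 : L * (2 * n) < N := by omega
  -- The diode is made of the base, or of the base and the direction, in which `B` is deficient.
  rcases GraphWalking.few_states (n := n) (GraphWalking.visit B)
    (fun _ _ => GraphWalking.walk_of_visit) (not_le.1 hcard) with ⟨i, hi⟩ | ⟨l, q, hq⟩
  · let σ : GraphWalking.Spec n K := ⟨i, 0, true, L, N, hL0, hN0, by simp⟩
    have hB' : GraphWalking.Blocked σ B := by
      rcases hi.eq_empty_or_singleton with h | ⟨x, h⟩
      · exact Or.inl ⟨B.q0, fun s hs => by rw [h] at hs; exact hs.elim⟩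
      · exact Or.inl ⟨x, fun s hs => by rw [h] at hs; exact hs⟩
    exact hcard (hB'.card_le (by omega) hK ⟨hL, hN⟩ hBA)
  · have hqn : ((q.val : ℕ) : ZMod (2 * n)).val < n := by
      rw [ZMod.val_cast_of_lt (by omega)]
      exact q.2
    let σ : GraphWalking.Spec n K :=
      ⟨((q.val : ℕ) : ZMod (2 * n)), l, false, L, N, hL0, hN0, fun _ => hqn⟩
    have hB' : GraphWalking.Blocked σ B := Or.inr ⟨rfl, hq⟩
    exact hcard (hB'.card_le (by omega) hK ⟨hL, hN⟩ hBA)
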